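/- Let $\rho=\frac{\sqrt5-1}{2}$, let $q_0=(\frac12,\frac{\sqrt3}{2})$, $q_1=(0,0)$, $q_2=(1,0)$, $V_0=\{q_0,q_1,q_2\}\subset\mathbb R^2$, and let $F_0(x)=\rho^2(x-q_0)+q_0$, $F_i(x)=\rho(x-q_i)+q_i$ for $i=1,2$. For a word $w=w_1\cdots w_m$ in the letters $0,1,2$ put $F_w=F_{w_1}\circ\cdots\circ F_{w_m}$ and $|w|=m$. Let $W_1\subset\bigcup_{n\ge 0}\{1,2\}^n\times\{0\}$ be any set of words such that every $F_w$ with $w\in\bigcup_{n\ge0}\{1,2\}^n\times\{0\}$ equals $F_{w'}$ for exactly one $w'\in W_1$. Let $V_1=\bigcup_{w\in W_1}F_wV_0$ and let $\bar V_1$ be its closure (so $V_0\subset\bar V_1$). Let $\mathcal M$ be the set of all (non-degenerate) resistance forms on $V_0$; each $\mathcal D\in\mathcal M$ has the form $\mathcal D(f,g)=\frac12\sum_{i,j}a_{i,j}(f(q_i)-f(q_j))(g(q_i)-g(q_j))$ with $a_{i,j}=a_{j,i}\ge0$, and $\mathcal D$ is called symmetric if $a_{0,1}=a_{0,2}$.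 Write $\mathcal D(f)=\mathcal D(f,f)$. For $\rho<r<1$ and $\mathcal D\in\mathcal M$ let \[\Psi_r\mathcal D(f)=\sum_{w\in W_1}r^{-|w|+1}\mathcal D(f\circ F_w)\in[0,\infty],\] and let $\mathcal R_r\mathcal D$ be the trace of this form on $V_0$, that is, the quadratic form \[\mathcal R_r\mathcal D(u)=\inf\{\Psi_r\mathcal D(f): f\in C(\bar V_1),\ \Psi_r\mathcal D(f)<\infty,\ f|_{V_0}=u\},\qquad u:V_0\to\mathbb R.\] Theorem. (a) There is a function $\lambda:(\rho,1)\to(0,\infty)$, continuous and strictly decreasing, such that for each $r\in(\rho,1)$ there is a symmetric form $\mathcal D(r)\in\mathcal M$ with $\mathcal R_r\mathcal D(r)=\lambda(r)\mathcal D(r)$, and whenever $\lambda'>0$ and $\mathcal D'\in\mathcal M$ satisfy $\mathcal R_r\mathcal D'=\lambda'\mathcal D'$, then $\lambda'=\lambda(r)$ and $\mathcal D'=t\,\mathcal D(r)$ for some constant $t>0$. (b) There is exactly one $r\in(\rho,1)$ for which the equation $\mathcal R_r\mathcal D=r^2\mathcal D$ has a solution $\mathcal D\in\mathcal M$, and for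 this $r$ the solution is unique up to multiplication by a positive constant. -/

import Mathlib

open Set
open scoped ENNReal

noncomputable section

namespace GoldenGasket

/-- The Euclidean plane. -/
abbrev Plane : Type := EuclideanSpace ℝ (Fin 2)

/-- The golden ratio `ρ = (√5 - 1) / 2`. -/
def rho : ℝ := (Real.sqrt 5 - 1) / 2

/-- The vertices of the equilateral triangle; `V₀ = {q 0, q 1, q 2}`. -/
def q : Fin 3 → Plane :=
  ![!₂[1 / 2, Real.sqrt 3 / 2], !₂[0, 0], !₂[1, 0]]

/-- The contraction ratios `ρ², ρ, ρ` of the three similitudes. -/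
def ratio : Fin 3 → ℝ := ![rho ^ 2, rho, rho]

/-- The similitudes `F i x = ρ_i (x - q i) + q i`. -/
def F (i : Fin 3) (x : Plane) : Plane := ratio i • (x - q i) + q i

/-- `F_w = F_{w₁} ∘ ⋯ ∘ F_{w_m}` for a word `w = w₁ ⋯ w_m`; the identity for the empty word. -/
def wordMap (w : List (Fin 3)) : Plane → Plane :=
  w.foldr (fun i g => F i ∘ g) id

/-- The words in `⋃ₙ {1,2}ⁿ × {0}`. -/
def stemWords : Set (List (Fin 3)) :=
  {w | ∃ v : List (Fin 3), (∀ i ∈ v, i ≠ 0) ∧ w = v ++ [0]}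

/-- `W` is an admissible choice of the index set `W₁`: a set of words of `⋃ₙ {1,2}ⁿ × {0}` that
realizes every map `F_w`, `w ∈ ⋃ₙ {1,2}ⁿ × {0}`, and realizes no map twice. -/
structure IsIndexSet (W : Set (List (Fin 3))) : Prop where
  subset : W ⊆ stemWords
  realizes : ∀ w ∈ stemWords, ∃ w' ∈ W, wordMap w = wordMap w'
  injOn : InjOn wordMap W

/-- `V₁ = ⋃_{w ∈ W₁} F_w V₀`. -/
def V1 (W : Set (List (Fin 3))) : Set Plane :=
  ⋃ w ∈ W, wordMap w '' range q

/-- A (non-degenerate) resistance form `(E, 𝓕)` on a set `X`. -/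
structure IsResistanceForm {X : Type*} (𝓕 : Submodule ℝ (X → ℝ))
    (E : LinearMap.BilinForm ℝ 𝓕) : Prop where
  /-- (RF1) The domain contains the constants. -/
  const_mem : ∀ c : ℝ, (fun _ : X => c) ∈ 𝓕
  /-- (RF1) The form is symmetric. -/
  symm : ∀ f g : 𝓕, E f g = E g f
  /-- (RF1) The form is nonnegative. -/
  nonneg : ∀ f : 𝓕, 0 ≤ E f f
  /-- (RF1) The energy vanishes exactly at the constants. -/
  eq_zero_iff : ∀ f : 𝓕, E f f = 0 ↔ ∃ c : ℝ, ∀ x, (f : X → ℝ) x = c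
  /-- (RF2) The space `𝓕` modulo constants is complete for the inner product `E`. -/
  complete : ∀ u : ℕ → 𝓕,
    (∀ ε > 0, ∃ N, ∀ m ≥ N, ∀ n ≥ N, E (u m - u n) (u m - u n) < ε) →
      ∃ f : 𝓕, Filter.Tendsto (fun n => E (u n - f) (u n - f)) Filter.atTop (nhds 0)
  /-- (RF3) Every function on a finite subset extends to a function in the domain. -/
  extend : ∀ (V : Finset X) (u : X → ℝ), ∃ f : 𝓕, ∀ x ∈ V, (f : X → ℝ) x = u x
  /-- (RF4) The effective resistance between distinct points is finite. -/
  resistance_finite : ∀ x y : X, x ≠ y →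
    BddAbove {t : ℝ | ∃ f : 𝓕, 0 < E f f ∧ t = |(f : X → ℝ) x - (f : X → ℝ) y| ^ 2 / E f f}
  /-- (RF5) The Markov property. -/
  markov : ∀ f : 𝓕, ∃ g : 𝓕,
    (g : X → ℝ) = (fun x => min (max ((f : X → ℝ) x) 0) 1) ∧ E g g ≤ E f f

/-- Bilinear forms on `l(V₀)`; a function on `V₀` is given by its values at `q 0, q 1, q 2`. -/
abbrev Form : Type := LinearMap.BilinForm ℝ (Fin 3 → ℝ)

/-- The collection `𝓜` of all resistance forms on `V₀`. As `V₀` is finite, (RF3) forces the domain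
of such a form to be all of `l(V₀)`. -/
def resistanceForms : Set Form :=
  {D | IsResistanceForm ⊤ (D.restrict ⊤)}

/-- The coefficient `a_{i,j}`, `i ≠ j`, in the representation
`D(f, g) = ½ ∑_{i,j} a_{i,j} (f(q_i) - f(q_j)) (g(q_i) - g(q_j))` of a resistance form on `V₀`. -/
def conductance (D : Form) (i j : Fin 3) : ℝ :=
  -D (Pi.single i 1) (Pi.single j 1)

/-- The collection `𝓜_S` of all symmetric resistance forms on `V₀`: those with
`a_{0,1} = a_{0,2}`. -/
def symmetricForms : Set Form :=
  {D | D ∈ resistanceForms ∧ conductance D 0 1 = conductance D 0 2}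

/-- The energy `Ψ_r D(f) = ∑_{w ∈ W₁} r^{-|w|+1} D(f ∘ F_w, f ∘ F_w) ∈ [0, ∞]`. It only depends on
the values of `f` on `V₁`, and `f` belongs to `Dom(Ψ_r D)` exactly if it is finite. -/
def energy (W : Set (List (Fin 3))) (r : ℝ) (D : Form) (f : Plane → ℝ) : ℝ≥0∞ :=
  ∑' w : W, ENNReal.ofReal (r ^ (1 - ((w : List (Fin 3)).length : ℤ)) *
    D (fun i => f (wordMap w (q i))) (fun i => f (wordMap w (q i))))

/-- The renormalized form `𝓡_r D = [Ψ_r D]_{V₀}`, through its values `𝓡_r D(u)` on the diagonal: the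
infimum of `Ψ_r D(f)` over the functions `f` on the closure of `V₁` in the domain of `Ψ_r D` that
extend `u`. Such functions are continuous on the closure of `V₁` (the points `q 1` and `q 2` of `V₀`
lie in the closure, but not in `V₁` itself); functions of infinite energy do not affect the
infimum. -/
def renormalize (W : Set (List (Fin 3))) (r : ℝ) (D : Form) (u : Fin 3 → ℝ) : ℝ≥0∞ :=
  ⨅ f ∈ {f : Plane → ℝ | ContinuousOn f (closure (V1 W)) ∧ ∀ i, f (q i) = u i}, energy W r D f

/-- The renormalization equation `𝓡_r D = c D`, as an identity of quadratic forms on `l(V₀)`. -/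
def SolvesRenormalization (W : Set (List (Fin 3))) (r c : ℝ) (D : Form) : Prop :=
  ∀ u : Fin 3 → ℝ, renormalize W r D u = ENNReal.ofReal (c * D u u)

end GoldenGasket

end

open GoldenGasket

/-! Because ρ² = 1 - ρ, a vertex F_v q_0 with v ∈ {1,2}ⁿ is determined by its level n and a
horizontal offset b, and the triangle F_v F_0 V_0 has the corners (n, b), (n+1, b) and (n+1, b +
ρ^(n+2)). Hence every admissible W₁ gives the same network: a graded graph in which each vertex has
a left and a right child, vertices may share children, and the triangles of level n carry weight
r^(-n). The boundary points q_1 and q_2 are the limits of the leftmost and the rightmost ray. Level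
energies of Lipschitz functions of the offset are O(ρⁿ), so r > ρ gives finite-energy extensions;
the rays have finite resistance ∑ rⁿ, so r < 1 lets the energy control the boundary values.

Existence. Up to scaling, symmetric forms depend on one parameter s (`symForm`), and by reflection
the trace of such a form is again symmetric, with coefficients A(s) and B(s); an eigenform is a
solution of B(s) = s A(s). At s = 1/4 the contraction f ↦ |f| gives B ≥ A/4. For large s, test
functions that vanish on many levels show that B grows more slowly than any multiple of s, while A
stays above (1 - r)/2. Concavity in s gives continuity, and the intermediate value theorem applies
(`exists_eigenform`).

Uniqueness. If D ≤ M D' with M optimal, monotonicity of the trace at a vector of equality compares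
the eigenvalues, so they agree. If D and D' are not proportional, a limit of near-minimizers is
harmonic and satisfies D = M D' on every triangle (`exists_common_harmonic`). The null space of M D'
- D then forces its values on each triangle to be an affine copy of its boundary values. Such a
function is described by a flow that splits in a fixed ratio at each vertex, and the loops of the
graph, which come from coincidences such as F_2 F_1 F_1 = F_1 F_2 F_2, make this impossible
(`no_proportional_harmonic`).

Dependence on r. Cutting a function off at a level chosen by averaging costs an arbitrarily small
fraction of its energy (Hardy inequality and interpolation), after which only finitely many weights
matter; this gives continuity. Raising r lowers all weights except that of level 0; since the
eigenvalue is below 1, a fixed share of the energy lies on the lower levels, and the eigenvalue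
drops strictly. Finally λ(r) - r² is strictly decreasing, and explicit networks give λ(31/50) ≥ 2/5
> (31/50)² and λ(9/10) ≤ 20/29 < (9/10)². -/

noncomputable section

/-! ### Vertices as pairs of a level and an offset. -/

namespace GoldenGasket

lemma rho_sq : rho ^ 2 = 1 - rho := by
  have h : Real.sqrt 5 ^ 2 = 5 := Real.sq_sqrt (by norm_num)
  unfold rho
  linarith [h, show ((Real.sqrt 5 - 1) / 2) ^ 2 = (Real.sqrt 5 ^ 2 - 2 * Real.sqrt 5 + 1) / 4 by ring]

lemma rho_gt : 0.618 < rho := by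
  have : (2.236 : ℝ) < Real.sqrt 5 := Real.lt_sqrt_of_sq_lt (by norm_num)
  unfold rho; linarith

lemma rho_lt : rho < 0.6181 := by
  have : Real.sqrt 5 < (2.2361 : ℝ) := (Real.sqrt_lt' (by norm_num)).2 (by norm_num)
  unfold rho; linarith

lemma rho_pos : 0 < rho := by linarith [rho_gt]

lemma rho_lt_one : rho < 1 := by linarith [rho_lt]

lemma rho_pow_pos (n : ℕ) : 0 < rho ^ n := pow_pos rho_pos n

lemma rho_pow_add_two (n : ℕ) : rho ^ (n + 2) = rho ^ n - rho ^ (n + 1) := by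
  rw [pow_add, rho_sq, pow_succ]; ring

/-- The offsets of the maps `F_v`, `v ∈ {1,2}ⁿ`. -/
def stem : ℕ → Finset ℝ
  | 0 => {0}
  | n + 1 => stem n ∪ (stem n).image (· + rho ^ (n + 2))

/-- The point `F_v (q 0)` for a word `v` of length `n` with offset `b`. -/
def vtx (n : ℕ) (b : ℝ) : Plane := !₂[b + rho ^ n / 2, rho ^ n * (Real.sqrt 3 / 2)]

/-- The set of all vertices `F_v (q 0)`. -/
def verts : Set Plane := {p | ∃ n, ∃ b ∈ stem n, p = vtx n b}

lemma mem_stem_succ {n : ℕ} {b : ℝ} :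
    b ∈ stem (n + 1) ↔ b ∈ stem n ∨ b - rho ^ (n + 2) ∈ stem n := by
  simp only [stem, Finset.mem_union, Finset.mem_image]
  constructor
  · rintro (h | ⟨a, ha, rfl⟩)
    · exact Or.inl h
    · right; simpa using ha
  · rintro (h | h)
    · exact Or.inl h
    · exact Or.inr ⟨_, h, by ring⟩

lemma stem_left {n : ℕ} {b : ℝ} (h : b ∈ stem n) : b ∈ stem (n + 1) :=
  mem_stem_succ.2 (Or.inl h)

lemma stem_right {n : ℕ} {b : ℝ} (h : b ∈ stem n) : b + rho ^ (n + 2) ∈ stem (n + 1) :=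
  mem_stem_succ.2 (Or.inr (by simpa using h))

lemma zero_mem_stem (n : ℕ) : (0 : ℝ) ∈ stem n := by
  induction n with
  | zero => simp [stem]
  | succ n ih => exact stem_left ih

lemma stem_reflect {n : ℕ} {b : ℝ} (h : b ∈ stem n) : 1 - rho ^ n - b ∈ stem n := by
  induction n generalizing b with
  | zero => simp [stem] at h ⊢; simp [h]
  | succ n ih =>
    have e := rho_pow_add_two n
    rcases mem_stem_succ.1 h with h | h
    · refine mem_stem_succ.2 (Or.inr ?_)
      convert ih h using 1; linarith
    · refine mem_stem_succ.2 (Or.inl ?_)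
      convert ih h using 1; linarith

lemma last_mem_stem (n : ℕ) : 1 - rho ^ n ∈ stem n := by
  simpa using stem_reflect (zero_mem_stem n)

lemma stem_nonneg {n : ℕ} {b : ℝ} (h : b ∈ stem n) : 0 ≤ b := by
  induction n generalizing b with
  | zero => simp [stem] at h; simp [h]
  | succ n ih =>
    rcases mem_stem_succ.1 h with h | h
    · exact ih h
    · linarith [ih h, rho_pow_pos (n + 2)]

lemma stem_le {n : ℕ} {b : ℝ} (h : b ∈ stem n) : b ≤ 1 - rho ^ n := by
  linarith [stem_nonneg (stem_reflect h)]

lemma vtx_inj {n m : ℕ} {b c : ℝ} (h : vtx n b = vtx m c) : n = m ∧ b = c := by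
  have h0 : b + rho ^ n / 2 = c + rho ^ m / 2 := by
    have := congrArg (fun p : Plane => p 0) h; simpa [vtx] using this
  have h1 : rho ^ n * (Real.sqrt 3 / 2) = rho ^ m * (Real.sqrt 3 / 2) := by
    have := congrArg (fun p : Plane => p 1) h; simpa [vtx] using this
  have h3 : (0 : ℝ) < Real.sqrt 3 := Real.sqrt_pos.2 (by norm_num)
  have h2 : rho ^ n = rho ^ m := mul_right_cancel₀ (by positivity) h1
  refine ⟨pow_right_injective₀ rho_pos rho_lt_one.ne h2, ?_⟩
  linarith

/-- The offset of the word `v`: `F_v x = ρ^|v| x + (off v, 0)`. -/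
def off : List (Fin 3) → ℝ
  | [] => 0
  | i :: v => rho * off v + if i = 2 then rho ^ 2 else 0

lemma off_append (v : List (Fin 3)) (i : Fin 3) :
    off (v ++ [i]) = off v + if i = 2 then rho ^ (v.length + 2) else 0 := by
  induction v with
  | nil => simp [off]
  | cons j v ih =>
    simp only [List.cons_append, off, ih, List.length_cons]
    split_ifs <;> ring

lemma off_mem_stem (v : List (Fin 3)) : off v ∈ stem v.length := by
  induction v using List.reverseRecOn with
  | nil => simp [off, stem]
  | append_singleton v i ih =>
    rw [off_append, List.length_append, List.length_singleton]
    split_ifs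
    · exact stem_right ih
    · simpa using stem_left ih

lemma exists_word_of_mem_stem {n : ℕ} {b : ℝ} (h : b ∈ stem n) :
    ∃ v : List (Fin 3), (∀ i ∈ v, i ≠ 0) ∧ v.length = n ∧ off v = b := by
  induction n generalizing b with
  | zero => exact ⟨[], by simp, rfl, by simpa [stem, off, eq_comm] using h⟩
  | succ n ih =>
    rcases mem_stem_succ.1 h with h | h
    · obtain ⟨v, hv, hl, ho⟩ := ih h
      refine ⟨v ++ [1], ?_, by simp [hl], by simp [off_append, ho]⟩
      intro i hi
      rcases List.mem_append.1 hi with hi | hi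
      · exact hv i hi
      · simp at hi; simp [hi]
    · obtain ⟨v, hv, hl, ho⟩ := ih h
      refine ⟨v ++ [2], ?_, by simp [hl], by simp [off_append, ho, hl]⟩
      intro i hi
      rcases List.mem_append.1 hi with hi | hi
      · exact hv i hi
      · simp at hi; simp [hi]

lemma wordMap_append (v w : List (Fin 3)) (x : Plane) :
    wordMap (v ++ w) x = wordMap v (wordMap w x) := by
  induction v with
  | nil => rfl
  | cons i v ih =>
    have : ∀ u : List (Fin 3), wordMap (i :: u) = F i ∘ wordMap u := fun _ => rfl
    simp [List.cons_append, this, ih]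

lemma wordMap_stem {v : List (Fin 3)} (hv : ∀ i ∈ v, i ≠ 0) (x : Plane) :
    wordMap v x = !₂[rho ^ v.length * x 0 + off v, rho ^ v.length * x 1] := by
  induction v with
  | nil => ext i; fin_cases i <;> simp [wordMap, off]
  | cons i v ih =>
    have h1 : wordMap (i :: v) x = F i (wordMap v x) := rfl
    rw [h1, ih (fun j hj => hv j (List.mem_cons_of_mem _ hj))]
    have hi : i ≠ 0 := hv i List.mem_cons_self
    have e := rho_sq
    ext j
    fin_cases i
    · exact absurd rfl hi
    · fin_cases j <;> simp [F, q, ratio, off, pow_succ] <;> ring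
    · fin_cases j <;> simp [F, q, ratio, off, pow_succ]
      · linear_combination -e
      · ring

lemma wordMap_stem_zero {v : List (Fin 3)} (hv : ∀ i ∈ v, i ≠ 0) (x : Plane) :
    wordMap (v ++ [0]) x =
      !₂[rho ^ v.length * (rho ^ 2 * x 0 + rho / 2) + off v,
        rho ^ v.length * (rho ^ 2 * x 1 + rho * (Real.sqrt 3 / 2))] := by
  rw [wordMap_append, wordMap_stem hv]
  have h : wordMap [0] x = F 0 x := rfl
  have e := rho_sq
  rw [h]
  ext j
  fin_cases j <;> simp [F, q, ratio]
  · left; linear_combination (-1 / 2) * e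
  · left; linear_combination (-Real.sqrt 3 / 2) * e

/-- Since 1 - ρ² = ρ, the lower corners of F_0 V_0 are F_1 q_0 and F_2 q_0. The lower corners of a
triangle are therefore tops of triangles of the next level: a left child with the same offset and a
right child shifted by ρ^(n+2). -/
lemma wordMap_q {v : List (Fin 3)} (hv : ∀ i ∈ v, i ≠ 0) (i : Fin 3) :
    wordMap (v ++ [0]) (q i) =
      ![vtx v.length (off v), vtx (v.length + 1) (off v),
        vtx (v.length + 1) (off v + rho ^ (v.length + 2))] i := by
  rw [wordMap_stem_zero hv]
  have e := rho_sq
  ext j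
  fin_cases i <;> fin_cases j <;> simp [q, vtx, pow_succ]
  · linear_combination (rho ^ v.length / 2) * e
  · left; linear_combination (Real.sqrt 3 / 2) * e
  · ring
  · ring
  · ring
  · ring

/-- The values of `g` at the three vertices of the triangle with top `(n, b)`. -/
def tri (g : ℕ → ℝ → ℝ) (n : ℕ) (b : ℝ) : Fin 3 → ℝ :=
  ![g n b, g (n + 1) b, g (n + 1) (b + rho ^ (n + 2))]

/-- The energy of the triangles of level `n`. -/
def lev (D : Form) (g : ℕ → ℝ → ℝ) (n : ℕ) : ℝ :=
  ∑ b ∈ stem n, D (tri g n b) (tri g n b)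

/-- The restriction to the vertices. -/
def onVerts (f : Plane → ℝ) (n : ℕ) (b : ℝ) : ℝ := f (vtx n b)

lemma word_decomp {W : Set (List (Fin 3))} (hW : IsIndexSet W) (w : W) :
    ∃ v : List (Fin 3), (∀ i ∈ v, i ≠ 0) ∧ (w : List (Fin 3)) = v ++ [0] :=
  hW.subset w.2

/-- The prefix in `{1,2}ⁿ` of a word of the index set. -/
def pre (w : List (Fin 3)) : List (Fin 3) := w.dropLast

lemma pre_spec {W : Set (List (Fin 3))} (hW : IsIndexSet W) (w : W) :
    (∀ i ∈ pre w, i ≠ 0) ∧ (w : List (Fin 3)) = pre w ++ [0] := by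
  obtain ⟨v, hv, h⟩ := word_decomp hW w
  have : pre w = v := by simp [pre, h]
  rw [this]; exact ⟨hv, h⟩

/-- The level and the offset of a word. -/
def code {W : Set (List (Fin 3))} (w : W) : Σ n : ℕ, {b : ℝ // b ∈ stem n} :=
  ⟨(pre w).length, off (pre w), off_mem_stem _⟩

lemma sigma_stem_ext {x y : Σ n : ℕ, {b : ℝ // b ∈ stem n}} (h : x.1 = y.1)
    (h' : (x.2 : ℝ) = y.2) : x = y := by
  obtain ⟨n, b⟩ := x
  obtain ⟨m, c⟩ := y
  obtain rfl : n = m := h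
  have hbc : b = c := Subtype.ext h'
  rw [hbc]

/-- A map F_v F_0 depends only on the length and the offset of v, and its value at q_0 recovers
both. This removes the choice of the index set from the energy. -/
lemma code_bijective {W : Set (List (Fin 3))} (hW : IsIndexSet W) :
    Function.Bijective (code (W := W)) := by
  constructor
  · intro w w' h
    obtain ⟨hv, hw⟩ := pre_spec hW w
    obtain ⟨hv', hw'⟩ := pre_spec hW w'
    have h1 : (pre w).length = (pre w').length := congrArg Sigma.fst h
    have h2 : off (pre w) = off (pre w') :=
      congrArg (fun x : (Σ n : ℕ, {b : ℝ // b ∈ stem n}) => (x.2 : ℝ)) h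
    apply Subtype.ext
    apply hW.injOn w.2 w'.2
    funext x
    rw [hw, hw', wordMap_stem_zero hv, wordMap_stem_zero hv', h1, h2]
  · rintro ⟨n, b, hb⟩
    obtain ⟨v, hv, hl, ho⟩ := exists_word_of_mem_stem hb
    obtain ⟨w, hw, he⟩ := hW.realizes (v ++ [0]) ⟨v, hv, rfl⟩
    refine ⟨⟨w, hw⟩, ?_⟩
    obtain ⟨hv', hw'⟩ := pre_spec hW ⟨w, hw⟩
    have h1 := wordMap_q hv 0
    have h2 := wordMap_q hv' 0
    simp only at hw'
    rw [← hw', ← he] at h2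
    rw [h2] at h1
    obtain ⟨h3, h4⟩ := vtx_inj (by simpa using h1)
    exact sigma_stem_ext (h3.trans hl) (h4.trans ho)

lemma energy_eq {W : Set (List (Fin 3))} (hW : IsIndexSet W) {r : ℝ} (hr : 0 < r) {D : Form}
    (hD : ∀ x, 0 ≤ D x x) (f : Plane → ℝ) :
    energy W r D f = ∑' n, ENNReal.ofReal ((r ^ n)⁻¹ * lev D (onVerts f) n) := by
  have h1 : ∀ n, ENNReal.ofReal ((r ^ n)⁻¹ * lev D (onVerts f) n) =
      ∑' b : {b : ℝ // b ∈ stem n}, ENNReal.ofReal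
        ((r ^ n)⁻¹ * D (tri (onVerts f) n b) (tri (onVerts f) n b)) := by
    intro n
    rw [lev, Finset.mul_sum, ENNReal.ofReal_sum_of_nonneg]
    · exact (Finset.tsum_subtype (stem n) fun b => ENNReal.ofReal
        ((r ^ n)⁻¹ * D (tri (onVerts f) n b) (tri (onVerts f) n b))).symm
    · intro b _
      have := hD (tri (onVerts f) n b)
      positivity
  simp_rw [h1]
  rw [← ENNReal.tsum_sigma (fun n (b : {b : ℝ // b ∈ stem n}) => ENNReal.ofReal
        ((r ^ n)⁻¹ * D (tri (onVerts f) n b) (tri (onVerts f) n b))),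
    ← (Equiv.ofBijective _ (code_bijective hW)).tsum_eq]
  unfold energy
  refine tsum_congr fun w => ?_
  obtain ⟨hv, hw⟩ := pre_spec hW w
  have hx : (fun i => f (wordMap w (q i))) =
      tri (onVerts f) (pre w).length (off (pre w)) := by
    funext i
    rw [hw, wordMap_q hv, ← hw]
    fin_cases i <;> simp [tri, onVerts]
  have hl : (w : List (Fin 3)).length = (pre w).length + 1 := by
    conv_lhs => rw [hw]
    simp
  rw [hx, hl]
  simp [code, Equiv.ofBijective]

lemma V1_eq {W : Set (List (Fin 3))} (hW : IsIndexSet W) : V1 W = verts := by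
  ext p
  simp only [V1, mem_iUnion, verts, mem_ofPred_eq]
  constructor
  · rintro ⟨w, hw, x, ⟨i, rfl⟩, rfl⟩
    obtain ⟨hv, hw'⟩ := pre_spec hW ⟨w, hw⟩
    simp only at hw'
    rw [hw', wordMap_q hv]
    have hm := off_mem_stem (pre w)
    fin_cases i
    · exact ⟨_, _, hm, rfl⟩
    · exact ⟨_, _, stem_left hm, rfl⟩
    · exact ⟨_, _, stem_right hm, rfl⟩
  · rintro ⟨n, b, hb, rfl⟩
    obtain ⟨v, hv, hl, ho⟩ := exists_word_of_mem_stem hb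
    obtain ⟨w, hw, he⟩ := hW.realizes (v ++ [0]) ⟨v, hv, rfl⟩
    refine ⟨w, hw, q 0, mem_range_self 0, ?_⟩
    rw [← he, wordMap_q hv, hl, ho]; rfl

end GoldenGasket

/-! ### Continuous functions seen on the vertices. -/

namespace GoldenGasket

/-- `g` is the restriction to the vertices of a continuous function with boundary values `u`. -/
def Adm (u : Fin 3 → ℝ) (g : ℕ → ℝ → ℝ) : Prop :=
  ∃ f : Plane → ℝ, ContinuousOn f (closure verts) ∧ (∀ i, f (q i) = u i) ∧
    ∀ n, ∀ b ∈ stem n, g n b = f (vtx n b)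

lemma vtx_mem {n : ℕ} {b : ℝ} (h : b ∈ stem n) : vtx n b ∈ verts := ⟨n, b, h, rfl⟩

lemma tendsto_rho_pow : Filter.Tendsto (fun n => rho ^ n) Filter.atTop (nhds 0) :=
  tendsto_pow_atTop_nhds_zero_of_lt_one rho_pos.le rho_lt_one

lemma continuous_plane_mk {X : Type*} [TopologicalSpace X] {x y : X → ℝ} (hx : Continuous x)
    (hy : Continuous y) : Continuous fun t => (!₂[x t, y t] : Plane) := by
  refine (PiLp.continuous_toLp 2 _).comp (continuous_pi fun i => ?_)
  fin_cases i
  · exact hx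
  · exact hy

lemma vtx_zero_zero : vtx 0 0 = q 0 := by
  ext i; fin_cases i <;> simp [vtx, q]

lemma tendsto_vtx_left : Filter.Tendsto (fun n => vtx n 0) Filter.atTop (nhds (q 1)) := by
  have hc : Continuous fun t : ℝ => (!₂[0 + t / 2, t * (Real.sqrt 3 / 2)] : Plane) :=
    continuous_plane_mk (by fun_prop) (by fun_prop)
  have := (hc.tendsto 0).comp tendsto_rho_pow
  convert this using 2
  · rfl
  · ext i; fin_cases i <;> simp [q]

lemma tendsto_vtx_right :
    Filter.Tendsto (fun n => vtx n (1 - rho ^ n)) Filter.atTop (nhds (q 2)) := by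
  have hc : Continuous fun t : ℝ => (!₂[1 - t + t / 2, t * (Real.sqrt 3 / 2)] : Plane) :=
    continuous_plane_mk (by fun_prop) (by fun_prop)
  have := (hc.tendsto 0).comp tendsto_rho_pow
  convert this using 2
  · rfl
  · ext i; fin_cases i <;> simp [q]

lemma q_mem_closure (i : Fin 3) : q i ∈ closure verts := by
  fin_cases i
  · refine vtx_zero_zero ▸ ?_
    exact subset_closure (vtx_mem (zero_mem_stem 0))
  · exact mem_closure_of_tendsto tendsto_vtx_left
      (Filter.Eventually.of_forall fun n => vtx_mem (zero_mem_stem n))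
  · exact mem_closure_of_tendsto tendsto_vtx_right
      (Filter.Eventually.of_forall fun n => vtx_mem (last_mem_stem n))

namespace Adm

variable {u v : Fin 3 → ℝ} {g k : ℕ → ℝ → ℝ}

lemma root (h : Adm u g) : g 0 0 = u 0 := by
  obtain ⟨f, -, hq, hg⟩ := h
  rw [hg 0 0 (zero_mem_stem 0), vtx_zero_zero, hq]

lemma tendsto_left (h : Adm u g) :
    Filter.Tendsto (fun n => g n 0) Filter.atTop (nhds (u 1)) := by
  obtain ⟨f, hf, hq, hg⟩ := h
  have h1 : Filter.Tendsto (fun n => vtx n 0) Filter.atTop (nhdsWithin (q 1) (closure verts)) :=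
    tendsto_nhdsWithin_iff.2 ⟨tendsto_vtx_left, Filter.Eventually.of_forall fun n =>
      subset_closure (vtx_mem (zero_mem_stem n))⟩
  have := (hf (q 1) (q_mem_closure 1)).tendsto.comp h1
  rw [hq] at this
  exact this.congr fun n => (hg n 0 (zero_mem_stem n)).symm

lemma tendsto_right (h : Adm u g) :
    Filter.Tendsto (fun n => g n (1 - rho ^ n)) Filter.atTop (nhds (u 2)) := by
  obtain ⟨f, hf, hq, hg⟩ := h
  have h1 : Filter.Tendsto (fun n => vtx n (1 - rho ^ n)) Filter.atTop
      (nhdsWithin (q 2) (closure verts)) :=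
    tendsto_nhdsWithin_iff.2 ⟨tendsto_vtx_right, Filter.Eventually.of_forall fun n =>
      subset_closure (vtx_mem (last_mem_stem n))⟩
  have := (hf (q 2) (q_mem_closure 2)).tendsto.comp h1
  rw [hq] at this
  exact this.congr fun n => (hg n _ (last_mem_stem n)).symm

lemma add (h : Adm u g) (h' : Adm v k) : Adm (u + v) (g + k) := by
  obtain ⟨f, hf, hq, hg⟩ := h
  obtain ⟨f', hf', hq', hg'⟩ := h'
  exact ⟨f + f', hf.add hf', fun i => by simp [hq, hq'],
    fun n b hb => by simp [hg n b hb, hg' n b hb]⟩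

lemma smul (c : ℝ) (h : Adm u g) : Adm (c • u) (c • g) := by
  obtain ⟨f, hf, hq, hg⟩ := h
  exact ⟨c • f, hf.const_smul c, fun i => by simp [hq],
    fun n b hb => by simp [hg n b hb]⟩

lemma sub (h : Adm u g) (h' : Adm v k) : Adm (u - v) (g - k) := by
  have := h.add (h'.smul (-1))
  simpa [sub_eq_add_neg] using this

lemma const (c : ℝ) : Adm (fun _ => c) (fun _ _ => c) :=
  ⟨fun _ => c, continuousOn_const, fun _ => rfl, fun _ _ _ => rfl⟩

lemma abs (h : Adm u g) : Adm (fun i => |u i|) (fun n b => |g n b|) := by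
  obtain ⟨f, hf, hq, hg⟩ := h
  exact ⟨fun p => |f p|, hf.abs, fun i => by simp [hq],
    fun n b hb => by simp [hg n b hb]⟩

end Adm

/-- The reflection of a function on the vertices in the vertical axis of the triangle. -/
def refl (g : ℕ → ℝ → ℝ) (n : ℕ) (b : ℝ) : ℝ := g n (1 - rho ^ n - b)

/-- The reflection of boundary values. -/
def swap (u : Fin 3 → ℝ) : Fin 3 → ℝ := ![u 0, u 2, u 1]

lemma Adm.refl {u : Fin 3 → ℝ} {g : ℕ → ℝ → ℝ} (h : Adm u g) : Adm (swap u) (refl g) := by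
  obtain ⟨f, hf, hq, hg⟩ := h
  let S : Plane → Plane := fun p => !₂[1 - p 0, p 1]
  have hS : Continuous S := continuous_plane_mk (by fun_prop) (by fun_prop)
  have hv : ∀ n b, S (vtx n b) = vtx n (1 - rho ^ n - b) := by
    intro n b
    ext i; fin_cases i <;> simp [S, vtx]
    ring
  have hm : MapsTo S verts verts := by
    rintro _ ⟨n, b, hb, rfl⟩
    rw [hv]; exact vtx_mem (stem_reflect hb)
  refine ⟨f ∘ S, hf.comp hS.continuousOn (hm.closure hS), ?_, ?_⟩
  · have h0 : S (q 0) = q 0 := by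
      ext i; fin_cases i <;> simp [S, q]; norm_num
    have h1 : S (q 1) = q 2 := by ext i; fin_cases i <;> simp [S, q]
    have h2 : S (q 2) = q 1 := by ext i; fin_cases i <;> simp [S, q]
    intro i
    fin_cases i
    · simp [h0, hq, swap]
    · simp [h1, hq, swap]
    · simp [h2, hq, swap]
  · intro n b hb
    simp only [GoldenGasket.refl, Function.comp, hv]
    exact hg n _ (stem_reflect hb)

/-- The linear functional on the plane with value `b` at the vertex `(n, b)`. -/
def horiz (p : Plane) : ℝ := p 0 - p 1 / Real.sqrt 3

lemma sqrt_three_pos : 0 < Real.sqrt 3 := Real.sqrt_pos.2 (by norm_num)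

lemma horiz_vtx (n : ℕ) (b : ℝ) : horiz (vtx n b) = b := by
  have := sqrt_three_pos
  simp [horiz, vtx]
  field_simp
  ring

lemma horiz_continuous : Continuous horiz := by unfold horiz; fun_prop

/-- A function on the vertices that depends only on the offset from some level on, continuously,
extends continuously to the closure. -/
lemma adm_of_eventually_horiz {g : ℕ → ℝ → ℝ} {G : ℝ → ℝ} {N : ℕ} (hG : Continuous G)
    (h : ∀ n > N, ∀ b ∈ stem n, g n b = G b) : Adm ![g 0 0, G 0, G 1] g := by
  classical
  have hs := sqrt_three_pos
  let c : ℝ := Real.sqrt 3 / 2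
  have hc : 0 < c := by positivity
  let S : Set Plane := {p | ∃ n ≤ N, ∃ b ∈ stem n, p = vtx n b}
  have hSfin : S.Finite := by
    have : S = ⋃ n ∈ Finset.range (N + 1), (vtx n) '' (stem n : Set ℝ) := by
      ext p
      simp only [S, mem_ofPred_eq, mem_iUnion, Finset.mem_range, mem_image, Finset.mem_coe,
        Nat.lt_succ_iff, exists_prop, eq_comm]
    rw [this]
    exact (Finset.range (N + 1)).finite_toSet.biUnion fun n _ => (stem n).finite_toSet.image _
  have hlow : ∀ n b, vtx n b 1 = rho ^ n * c := fun n b => by simp [vtx, c]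
  have hSy : ∀ p ∈ S, rho ^ N * c ≤ p 1 := by
    rintro _ ⟨n, hn, b, -, rfl⟩
    rw [hlow]
    exact mul_le_mul_of_nonneg_right (pow_le_pow_of_le_one rho_pos.le rho_lt_one.le hn) hc.le
  -- The finitely many vertices of level at most N lie strictly above all the rest of the closure,
  -- hence are isolated in it. Arbitrary values may be prescribed there without harming continuity.
  have hcl : closure verts ⊆ S ∪ {p | p 1 ≤ rho ^ (N + 1) * c} := by
    refine closure_minimal ?_ (hSfin.isClosed.union (isClosed_le (by fun_prop) (by fun_prop)))
    rintro _ ⟨n, b, hb, rfl⟩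
    by_cases hn : n ≤ N
    · exact Or.inl ⟨n, hn, b, hb, rfl⟩
    · right
      change vtx n b 1 ≤ _
      rw [hlow]
      exact mul_le_mul_of_nonneg_right
        (pow_le_pow_of_le_one rho_pos.le rho_lt_one.le (by omega)) hc.le
  have hlt : rho ^ (N + 1) * c < rho ^ N * c := by
    refine mul_lt_mul_of_pos_right ?_ hc
    exact pow_lt_pow_right_of_lt_one₀ rho_pos rho_lt_one (by omega)
  have hsel : ∀ p, ∃ y, (p ∈ S → ∀ n b, p = vtx n b → y = g n b) ∧ (p ∉ S → y = G (horiz p)) := by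
    intro p
    by_cases hp : p ∈ S
    · obtain ⟨n, hn, b, hb, rfl⟩ := id hp
      refine ⟨g n b, fun _ m b' e => ?_, fun h => absurd hp h⟩
      obtain ⟨rfl, rfl⟩ := vtx_inj e
      rfl
    · exact ⟨G (horiz p), fun h => absurd h hp, fun _ => rfl⟩
  choose f hf1 hf2 using hsel
  refine ⟨f, ?_, ?_, ?_⟩
  · intro p hp
    by_cases hpS : p ∈ S
    · have hU : {x : Plane | rho ^ (N + 1) * c < x 1} ∩ (S \ {p})ᶜ ∈ nhds p := by
        refine Filter.inter_mem ((isOpen_lt (by fun_prop) (by fun_prop)).mem_nhds ?_)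
          ((hSfin.subset sdiff_subset).isClosed.isOpen_compl.mem_nhds (by simp))
        exact hlt.trans_le (hSy p hpS)
      have : f =ᶠ[nhdsWithin p (closure verts)] fun _ => f p := by
        filter_upwards [self_mem_nhdsWithin, mem_nhdsWithin_of_mem_nhds hU] with x hx hxU
        have hxS : x ∈ S := by
          rcases hcl hx with h | h
          · exact h
          · exact absurd (show rho ^ (N + 1) * c < x 1 from hxU.1) (not_lt.2 h)
        by_cases hxp : x = p
        · rw [hxp]
        · exact absurd ⟨hxS, hxp⟩ hxU.2
      exact (continuousWithinAt_const.congr_of_eventuallyEq this rfl)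
    · have hU : Sᶜ ∈ nhds p := hSfin.isClosed.isOpen_compl.mem_nhds hpS
      have : f =ᶠ[nhdsWithin p (closure verts)] fun x => G (horiz x) := by
        filter_upwards [mem_nhdsWithin_of_mem_nhds hU] with x hx
        exact hf2 x hx
      exact ((hG.comp horiz_continuous).continuousWithinAt).congr_of_eventuallyEq this (hf2 p hpS)
  · have h1 : q 1 ∉ S := fun h => by
      have := hSy _ h
      have h3 : 0 < rho ^ N * c := mul_pos (rho_pow_pos N) hc
      simp [q] at this; linarith
    have h2 : q 2 ∉ S := fun h => by
      have := hSy _ h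
      have h3 : 0 < rho ^ N * c := mul_pos (rho_pow_pos N) hc
      simp [q] at this; linarith
    intro i
    fin_cases i
    · exact hf1 (q 0) ⟨0, Nat.zero_le _, 0, zero_mem_stem 0, vtx_zero_zero.symm⟩ 0 0
        vtx_zero_zero.symm
    · simpa [horiz, q] using hf2 _ h1
    · simpa [horiz, q] using hf2 _ h2
  · intro n b hb
    by_cases hn : n ≤ N
    · exact (hf1 _ ⟨n, hn, b, hb, rfl⟩ n b rfl).symm
    · rw [hf2 _, horiz_vtx, h n (by omega) b hb]
      intro hS
      have := hSy _ hS
      rw [hlow] at this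
      have h4 : rho ^ n * c ≤ rho ^ (N + 1) * c := mul_le_mul_of_nonneg_right
        (pow_le_pow_of_le_one rho_pos.le rho_lt_one.le (by omega)) hc.le
      linarith

end GoldenGasket

namespace GoldenGasket

/-! Separation of the offsets. -/

/-- The list of possible differences reproduces itself under the shifts by ±ρ^(n+2) that lead to
level n + 1, because ρ^(n+1) - ρ^(n+2) = ρ^(n+3), ρⁿ - ρ^(n+2) = ρ^(n+1) and 2ρ^(n+2) ≥ ρ^(n+1). -/
lemma stem_diff {n : ℕ} {x y : ℝ} (hx : x ∈ stem n) (hy : y ∈ stem n) (hxy : x ≤ y) :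
    y - x = 0 ∨ y - x = rho ^ (n + 2) ∨ y - x = rho ^ (n + 1) ∨ rho ^ n ≤ y - x := by
  induction n generalizing x y with
  | zero =>
    simp [stem] at hx hy
    left; simp [hx, hy]
  | succ n ih =>
    have e0 := rho_pow_add_two n
    have e1 := rho_pow_add_two (n + 1)
    have e2 : rho ^ (n + 1 + 1) = rho ^ (n + 2) := rfl
    have e3 : rho ^ (n + 1 + 2) = rho ^ (n + 3) := rfl
    rw [e2, e3] at e1
    rw [e2, e3]
    have p2 := rho_pow_pos (n + 2)
    have p3 := rho_pow_pos (n + 3)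
    have p4 : rho ^ (n + 3) < rho ^ (n + 2) :=
      pow_lt_pow_right_of_lt_one₀ rho_pos rho_lt_one (by omega)
    have key : ∀ a ∈ stem n, ∀ b ∈ stem n, (b - a = 0 ∨ b - a = rho ^ (n + 2) ∨
        b - a = rho ^ (n + 1) ∨ rho ^ n ≤ b - a) ∨ (a - b = rho ^ (n + 2) ∨
        a - b = rho ^ (n + 1) ∨ rho ^ n ≤ a - b) := by
      intro a ha b hb
      rcases le_total a b with h | h
      · exact Or.inl (ih ha hb h)
      · rcases ih hb ha h with h' | h' | h' | h'
        · left; left; linarith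
        · right; left; linarith
        · right; right; left; linarith
        · right; right; right; linarith
    rcases mem_stem_succ.1 hx with hx | hx <;> rcases mem_stem_succ.1 hy with hy | hy <;>
      rcases key _ hx _ hy with (h | h | h | h) | (h | h | h)
    all_goals first
      | (left; linarith)
      | (right; left; linarith)
      | (right; right; left; linarith)
      | (right; right; right; linarith)

lemma stem_sep {n : ℕ} {x y : ℝ} (hx : x ∈ stem n) (hy : y ∈ stem n) (hxy : x < y) :
    x + rho ^ (n + 2) ≤ y := by
  have e0 := rho_pow_add_two n
  have p1 := rho_pow_pos (n + 1)
  have e1 := rho_pow_add_two (n + 1)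
  have e2 : rho ^ (n + 1 + 1) = rho ^ (n + 2) := rfl
  have p3 := rho_pow_pos (n + 1 + 2)
  rcases stem_diff hx hy hxy.le with h | h | h | h <;> linarith

/-- `x < y` are consecutive elements of `B`. -/
def Consec (B : Finset ℝ) (x y : ℝ) : Prop :=
  x ∈ B ∧ y ∈ B ∧ x < y ∧ ∀ z ∈ B, z ≤ x ∨ y ≤ z

lemma exists_consec {B : Finset ℝ} {x y : ℝ} (hx : x ∈ B) (hy : y ∈ B) (hxy : x < y) :
    ∃ z, Consec B x z := by
  have hne : (B.filter (x < ·)).Nonempty := ⟨y, by simp [hy, hxy]⟩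
  have hm := Finset.mem_filter.1 (Finset.min'_mem _ hne)
  refine ⟨_, hx, hm.1, hm.2, fun z hz => ?_⟩
  rcases le_or_gt z x with h | h
  · exact Or.inl h
  · exact Or.inr (Finset.min'_le _ _ (by simp [hz, h]))

/-- Consecutive offsets of level `n + 1` either bound the bottom side of a triangle of level `n`,
or they have a common child. -/
lemma consec_stem {n : ℕ} {x y : ℝ} (h : Consec (stem (n + 1)) x y) :
    (x ∈ stem n ∧ y = x + rho ^ (n + 2)) ∨ y = x + rho ^ (n + 3) := by
  induction n generalizing x y with
  | zero =>
    obtain ⟨hx, hy, hxy, -⟩ := h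
    have := rho_pow_pos 2
    simp [stem] at hx hy
    rcases hx with rfl | rfl <;> rcases hy with rfl | rfl <;>
      first
      | (exfalso; linarith)
      | (left; simp [stem])
  | succ n ih =>
    obtain ⟨hx, hy, hxy, hc⟩ := h
    have e0 := rho_pow_add_two (n + 1)
    have e1 := rho_pow_add_two (n + 2)
    have p3 := rho_pow_pos (n + 3)
    have p4 := rho_pow_pos (n + 4)
    have p5 : rho ^ (n + 4) < rho ^ (n + 3) :=
      pow_lt_pow_right_of_lt_one₀ rho_pos rho_lt_one (by omega)
    have h3 : rho ^ (n + 1 + 2) = rho ^ (n + 3) := rfl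
    have h3' : rho ^ (n + 2 + 1) = rho ^ (n + 3) := rfl
    have h4 : rho ^ (n + 2 + 2) = rho ^ (n + 4) := rfl
    have h2' : rho ^ (n + 1 + 1) = rho ^ (n + 2) := rfl
    have h4' : rho ^ (n + 1 + 3) = rho ^ (n + 4) := rfl
    have d := stem_diff hx hy hxy.le
    have d4 : rho ^ (n + 1 + 1 + 2) = rho ^ (n + 4) := rfl
    have d3 : rho ^ (n + 1 + 1 + 1) = rho ^ (n + 3) := rfl
    rw [h4', h3]
    rw [d4, d3] at d
    -- If x is already an offset of level n + 1, its right child x + ρ^(n+3) bounds y. Otherwise x =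
    -- p + ρ^(n+3) with p of level n + 1; the induction hypothesis for p and its successor p' leaves
    -- only p' = p + ρ^(n+2) = x + ρ^(n+4), since p' = x is excluded, and p' bounds y.
    by_cases hxs : x ∈ stem (n + 1)
    · have hz := stem_right hxs
      rw [h3] at hz
      rcases hc _ hz with h | h
      · linarith
      · rcases d with d | d | d | d
        · linarith
        · right; linarith
        · left; exact ⟨hxs, by linarith⟩
        · linarith
    · right
      have hp : x - rho ^ (n + 3) ∈ stem (n + 1) := (mem_stem_succ.1 hx).resolve_left hxs
      have hy' := stem_le hy
      have hl := last_mem_stem (n + 1)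
      have hlt : x - rho ^ (n + 3) < 1 - rho ^ (n + 1) := by linarith
      obtain ⟨p', hp'⟩ := exists_consec hp hl hlt
      rcases ih hp' with ⟨-, h⟩ | h
      · have hm := stem_left hp'.2.1
        have : p' = x + rho ^ (n + 4) := by rw [h]; linarith
        rcases hc _ hm with h' | h'
        · linarith
        · rcases d with d | d | d | d <;> linarith
      · exact absurd (by convert hp'.2.1 using 1; linarith) hxs

/-! ### Energy of piecewise linear functions of the offset. -/

lemma sum_disjoint_intervals {H : ℝ → ℝ} (hH : Monotone H) {B : Finset ℝ} {δ l m : ℝ}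
    (hsep : ∀ x ∈ B, ∀ y ∈ B, x < y → x + δ ≤ y)
    (hl : ∀ x, l ≤ H x) (hm : ∀ x, H x ≤ m) :
    ∑ t ∈ B, (H (t + δ) - H t) ≤ m - l := by
  have key : ∀ B : Finset ℝ, (∀ x ∈ B, ∀ y ∈ B, x < y → x + δ ≤ y) → ∀ T, (∀ x ∈ B, x + δ ≤ T) →
      ∑ t ∈ B, (H (t + δ) - H t) ≤ H T - l := by
    intro B
    induction B using Finset.induction_on_max with
    | empty => intro _ T _; simpa using hl T
    | insert a s ha ih =>
      intro hs T hT
      rw [Finset.sum_insert (fun h => lt_irrefl _ (ha a h))]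
      have h1 := ih (fun x hx y hy => hs x (by simp [hx]) y (by simp [hy])) a
        (fun x hx => hs x (by simp [hx]) a (by simp) (ha x hx))
      have h2 := hH (hT a (by simp))
      linarith
  obtain ⟨T, hT⟩ : ∃ T, ∀ x ∈ B, x + δ ≤ T := by
    obtain ⟨T, hT⟩ := B.bddAbove
    exact ⟨T + δ, fun x hx => by linarith [hT hx]⟩
  linarith [key B hsep T hT, hm T]

/-- The bottom sides [t, t + ρ^(n+2)] of the triangles of one level do not overlap, by `stem_sep`,
so the increments of H over them add up to at most m - l. The factor ρ^(n+2) is the source of the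
condition ρ < r. -/
lemma sum_sq_le_of_interpolant {G H : ℝ → ℝ} (hH : Monotone H)
    (hGH : ∀ x y, x ≤ y → (G y - G x) ^ 2 ≤ (y - x) * (H y - H x)) {l m : ℝ}
    (hl : ∀ x, l ≤ H x) (hm : ∀ x, H x ≤ m) (n : ℕ) :
    ∑ t ∈ stem n, (G (t + rho ^ (n + 2)) - G t) ^ 2 ≤ rho ^ (n + 2) * (m - l) := by
  have p := rho_pow_pos (n + 2)
  calc ∑ t ∈ stem n, (G (t + rho ^ (n + 2)) - G t) ^ 2
      ≤ ∑ t ∈ stem n, rho ^ (n + 2) * (H (t + rho ^ (n + 2)) - H t) := by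
        refine Finset.sum_le_sum fun t _ => ?_
        have := hGH t (t + rho ^ (n + 2)) (by linarith)
        simpa using this
    _ = rho ^ (n + 2) * ∑ t ∈ stem n, (H (t + rho ^ (n + 2)) - H t) := by
        rw [Finset.mul_sum]
    _ ≤ _ := mul_le_mul_of_nonneg_left
        (sum_disjoint_intervals hH (fun x hx y hy => stem_sep hx hy) hl hm) p.le

/-- The series law for resistors: read a, b as potential drops, l, l' as resistances and h, h' as
energies. The same inequality serves for path estimates and for gluing interpolants. -/
lemma sq_add_le_mul_add {a b l l' h h' : ℝ} (hl : 0 ≤ l) (hl' : 0 ≤ l') (hh : 0 ≤ h)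
    (hh' : 0 ≤ h') (ha : a ^ 2 ≤ l * h) (hb : b ^ 2 ≤ l' * h') :
    (a + b) ^ 2 ≤ (l + l') * (h + h') := by
  have h1 : (2 * (a * b)) ≤ l * h' + l' * h := by
    have h2 : (a * b) ^ 2 ≤ (l * h') * (l' * h) := by
      calc (a * b) ^ 2 = a ^ 2 * b ^ 2 := by ring
        _ ≤ (l * h) * (l' * h') := mul_le_mul ha hb (sq_nonneg _) (by positivity)
        _ = _ := by ring
    have h3 : (0 : ℝ) ≤ l * h' := by positivity
    have h4 : (0 : ℝ) ≤ l' * h := by positivity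
    refine le_of_abs_le (abs_le_of_sq_le_sq ?_ (by positivity))
    nlinarith [sq_nonneg (l * h' - l' * h)]
  nlinarith

/-- The piecewise linear interpolant `G` of the values `f` on a finite set, with a primitive `H` of
the square of its derivative. -/
lemma exists_interpolant (B : Finset ℝ) (f e : ℝ → ℝ) (he : ∀ x, 0 ≤ e x)
    (h : ∀ x y, Consec B x y → (f y - f x) ^ 2 ≤ (y - x) * e x) :
    ∃ G H : ℝ → ℝ, Continuous G ∧ Monotone H ∧ (∀ x ∈ B, G x = f x) ∧
      (∀ x y, x ≤ y → (G y - G x) ^ 2 ≤ (y - x) * (H y - H x)) ∧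
      (∀ x, 0 ≤ H x) ∧ (∀ x, H x ≤ ∑ z ∈ B, e z) ∧
      (∀ b, (∀ x ∈ B, x ≤ b) → b ∈ B → 
        (∀ x, b ≤ x → G x = f b ∧ H x = H b) ∧ ∀ x, H x + e b ≤ ∑ z ∈ B, e z) := by
  induction B using Finset.induction_on_max with
  | empty => exact ⟨fun _ => 0, fun _ => 0, continuous_const, monotone_const, by simp, by simp,
      by simp, by simp, by simp⟩
  | insert a s ha ih =>
    have has : a ∉ s := fun h => lt_irrefl _ (ha a h)
    rcases s.eq_empty_or_nonempty with rfl | hs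
    · refine ⟨fun _ => f a, fun _ => 0, continuous_const, monotone_const, by simp, by simp,
        by simp, by simpa using he a,
        fun b _ hb => ?_⟩
      obtain rfl : b = a := by simpa using hb
      simp
    obtain ⟨G, H, hG, hH, hGf, hGH, hH0, hHm, hend⟩ := ih (by
      rintro x y ⟨hx, hy, hxy, hc⟩
      refine h x y ⟨by simp [hx], by simp [hy], hxy, fun z hz => ?_⟩
      rcases Finset.mem_insert.1 hz with rfl | hz
      · exact Or.inr (ha y hy).le
      · exact hc z hz)
    obtain ⟨b, hb, hbm⟩ : ∃ b ∈ s, ∀ x ∈ s, x ≤ b := ⟨s.max' hs, s.max'_mem hs, fun x hx =>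
      s.le_max' x hx⟩
    -- Beyond the last node b both functions are constant, and the budget e b is still unspent. It
    -- pays for the new gap from b to a, which is filled by a ramp `cl` rising from 0 at b to 1 at
    -- a.
    obtain ⟨hend, hHe⟩ := hend b hbm hb
    have hba := ha b hb
    have hd : 0 < a - b := by linarith
    have hab : (f a - f b) ^ 2 ≤ (a - b) * e b := by
      refine h b a ⟨by simp [hb], by simp, hba, fun z hz => ?_⟩
      rcases Finset.mem_insert.1 hz with rfl | hz
      · exact Or.inr le_rfl
      · exact Or.inl (hbm z hz)
    let cl : ℝ → ℝ := fun t => max 0 (min 1 ((t - b) / (a - b)))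
    have hclc : Continuous cl := by
      refine continuous_const.max (continuous_const.min ?_)
      fun_prop
    have hclm : Monotone cl := by
      intro x y hxy
      refine max_le_max le_rfl (min_le_min le_rfl ?_)
      gcongr
    have hcl0 : ∀ t, t ≤ b → cl t = 0 := by
      intro t ht
      refine max_eq_left ((min_le_right _ _).trans ?_)
      exact div_nonpos_of_nonpos_of_nonneg (by linarith) hd.le
    have hcl1 : ∀ t, a ≤ t → cl t = 1 := by
      intro t ht
      have : 1 ≤ (t - b) / (a - b) := by rw [le_div_iff₀ hd]; linarith
      simp [cl, min_eq_left this]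
    have hclip : ∀ x y, x ≤ y → cl y - cl x ≤ (y - x) / (a - b) := by
      intro x y hxy
      have e1 : (y - b) / (a - b) = (x - b) / (a - b) + (y - x) / (a - b) := by
        rw [← add_div]; congr 1; ring
      have e2 : 0 ≤ (y - x) / (a - b) := div_nonneg (by linarith) hd.le
      simp only [cl, e1]
      rcases max_cases 0 (min 1 ((x - b) / (a - b))) with h | h <;>
      rcases max_cases 0 (min 1 ((x - b) / (a - b) + (y - x) / (a - b))) with h' | h' <;>
      rcases min_cases 1 ((x - b) / (a - b)) with h'' | h'' <;>
      rcases min_cases 1 ((x - b) / (a - b) + (y - x) / (a - b)) with h3 | h3 <;> linarith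
    have hle1 : ∀ t, cl t ≤ 1 := fun t => max_le zero_le_one (min_le_left _ _)
    have hge0 : ∀ t, 0 ≤ cl t := fun t => le_max_left _ _
    let c := f a - f b
    have hclGH : ∀ x y, x ≤ y → (c * cl y - c * cl x) ^ 2 ≤ (y - x) * (e b * cl y - e b * cl x) := by
      intro x y hxy
      have h1 := hclip x y hxy
      have h2 : 0 ≤ cl y - cl x := sub_nonneg.2 (hclm hxy)
      have h3 : (cl y - cl x) * (a - b) ≤ y - x := by rwa [le_div_iff₀ hd] at h1
      calc (c * cl y - c * cl x) ^ 2 = c ^ 2 * ((cl y - cl x) * (cl y - cl x)) := by ring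
        _ ≤ ((a - b) * e b) * ((cl y - cl x) * (cl y - cl x)) :=
          mul_le_mul_of_nonneg_right hab (by positivity)
        _ = ((cl y - cl x) * (a - b)) * (e b * (cl y - cl x)) := by ring
        _ ≤ (y - x) * (e b * (cl y - cl x)) :=
          mul_le_mul_of_nonneg_right h3 (mul_nonneg (he b) h2)
        _ = _ := by ring
    refine ⟨fun t => G t + c * cl t, fun t => H t + e b * cl t, by fun_prop,
      fun x y hxy => add_le_add (hH hxy) (mul_le_mul_of_nonneg_left (hclm hxy) (he b)),
      ?_, ?_, fun x => add_nonneg (hH0 x) (mul_nonneg (he b) (hge0 x)), ?_, ?_⟩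
    · intro x hx
      rcases Finset.mem_insert.1 hx with rfl | hx
      · simp only [hcl1 x le_rfl, (hend x hba.le).1, c]; ring
      · simp [hcl0 x (hbm x hx), hGf x hx]
    · have left : ∀ x y, x ≤ y → y ≤ b → (G y + c * cl y - (G x + c * cl x)) ^ 2 ≤
          (y - x) * (H y + e b * cl y - (H x + e b * cl x)) := by
        intro x y hxy hy
        rw [hcl0 y hy, hcl0 x (hxy.trans hy)]
        simpa using hGH x y hxy
      have right : ∀ x y, x ≤ y → b ≤ x → (G y + c * cl y - (G x + c * cl x)) ^ 2 ≤
          (y - x) * (H y + e b * cl y - (H x + e b * cl x)) := by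
        intro x y hxy hx
        rw [(hend x hx).1, (hend x hx).2, (hend y (hx.trans hxy)).1,
          (hend y (hx.trans hxy)).2]
        have := hclGH x y hxy
        convert this using 1 <;> ring
      intro x y hxy
      rcases le_total y b with hy | hy
      · exact left x y hxy hy
      rcases le_total b x with hx | hx
      · exact right x y hxy hx
      have h1 := left x b hx le_rfl
      have h2 := right b y hy le_rfl
      have m1 := hH hx
      have m2 := hH hy
      have m3 := mul_le_mul_of_nonneg_left (hclm hx) (he b)
      have m4 := mul_le_mul_of_nonneg_left (hclm hy) (he b)
      have := sq_add_le_mul_add (by linarith) (by linarith) (by linarith) (by linarith) h1 h2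
      convert this using 1 <;> ring
    · intro x
      rw [Finset.sum_insert has]
      linarith [hHe x, he a, mul_le_mul_of_nonneg_left (hle1 x) (he b)]
    · intro b' hb' hb'm
      have hb'a : b' = a := by
        rcases Finset.mem_insert.1 hb'm with h | h
        · exact h
        · exact absurd (hb' a (by simp)) (not_le.2 (ha b' h))
      subst hb'a
      refine ⟨fun x hx => ?_, fun x => ?_⟩
      · have hx' := hba.le.trans hx
        simp only [hcl1 x hx, hcl1 b' le_rfl, (hend x hx').1, (hend x hx').2,
          (hend b' hba.le).2, c]
        exact ⟨by ring, trivial⟩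
      · rw [Finset.sum_insert has]
        linarith [hHe x, mul_le_mul_of_nonneg_left (hle1 x) (he b)]

end GoldenGasket

/-! ### Energy forms on three points and their comparison. -/

namespace GoldenGasket

/-- A symmetric nonnegative form vanishing exactly at the constants. -/
structure IsEnergy (D : Form) : Prop where
  symm : ∀ x y, D x y = D y x
  nonneg : ∀ x, 0 ≤ D x x
  zero_iff : ∀ x, D x x = 0 ↔ ∃ c : ℝ, ∀ i, x i = c

lemma isEnergy_of_mem {D : Form} (h : D ∈ resistanceForms) : IsEnergy D where
  symm x y := h.symm ⟨x, trivial⟩ ⟨y, trivial⟩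
  nonneg x := h.nonneg ⟨x, trivial⟩
  zero_iff x := h.eq_zero_iff ⟨x, trivial⟩

lemma form_add_self {D : Form} (hs : ∀ x y, D x y = D y x) (x y : Fin 3 → ℝ) (t : ℝ) :
    D (x + t • y) (x + t • y) = D x x + 2 * t * D x y + t ^ 2 * D y y := by
  simp only [map_add, map_smul, LinearMap.add_apply, LinearMap.smul_apply, smul_eq_mul, hs y x]
  ring

/-- A linear function of `t` plus a square that stays nonnegative has no linear part. -/
lemma eq_zero_of_forall_quadratic {X Y : ℝ} (h : ∀ t : ℝ, 0 ≤ 2 * t * X + t ^ 2 * Y) : X = 0 := by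
  by_contra hX
  have hY : 0 < |Y| + 1 := by positivity
  have h1 := h (-X / (|Y| + 1))
  have h2 : 2 * (-X / (|Y| + 1)) * X + (-X / (|Y| + 1)) ^ 2 * Y =
      (X ^ 2 / (|Y| + 1) ^ 2) * (Y - 2 * (|Y| + 1)) := by
    field_simp; ring
  rw [h2] at h1
  have h3 : 0 < X ^ 2 / (|Y| + 1) ^ 2 := by positivity
  nlinarith [le_abs_self Y]

lemma form_eq_zero_of_null {D : Form} (hs : ∀ x y, D x y = D y x) (hn : ∀ x, 0 ≤ D x x)
    {u : Fin 3 → ℝ} (hu : D u u = 0) (y : Fin 3 → ℝ) : D u y = 0 := by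
  have key : ∀ t : ℝ, 0 ≤ 2 * t * D y u + t ^ 2 * 0 + D y y := by
    intro t
    have := hn (y + t • u)
    rw [form_add_self hs, hu] at this
    linarith
  rw [hs]
  by_contra h
  have := key (-(D y y + 1) / (2 * D y u))
  have e : 2 * (-(D y y + 1) / (2 * D y u)) * D y u = -(D y y + 1) := by field_simp
  rw [e] at this
  linarith

lemma vec_decomp (x : Fin 3 → ℝ) :
    x = (x 0) • (fun _ => (1 : ℝ)) + ((x 1 - x 0) • ![0, 1, 0] + (x 2 - x 0) • ![0, 0, 1]) := by
  ext i; fin_cases i <;> simp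

/-- A psd form killing the constants in the coordinates `x 1 - x 0`, `x 2 - x 0`. -/
lemma form_expand {D : Form} (hs : ∀ x y, D x y = D y x) (hn : ∀ x, 0 ≤ D x x)
    (h1 : D (fun _ => 1) (fun _ => 1) = 0) (x y : Fin 3 → ℝ) :
    D x y = (x 1 - x 0) * (y 1 - y 0) * D ![0, 1, 0] ![0, 1, 0] +
      ((x 1 - x 0) * (y 2 - y 0) + (x 2 - x 0) * (y 1 - y 0)) * D ![0, 1, 0] ![0, 0, 1] +
      (x 2 - x 0) * (y 2 - y 0) * D ![0, 0, 1] ![0, 0, 1] := by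
  have hl := form_eq_zero_of_null hs hn h1
  have hr : ∀ z, D z (fun _ => 1) = 0 := fun z => by rw [hs]; exact hl z
  have hc := hs ![0, 0, 1] ![0, 1, 0]
  conv_lhs => rw [vec_decomp x, vec_decomp y]
  simp only [map_add, map_smul, LinearMap.add_apply, LinearMap.smul_apply, smul_eq_mul, hl, hr, hc]
  ring

lemma IsEnergy.const_null {D : Form} (h : IsEnergy D) : D (fun _ => 1) (fun _ => 1) = 0 :=
  (h.zero_iff _).2 ⟨1, fun _ => rfl⟩

lemma IsEnergy.pos {D : Form} (h : IsEnergy D) {u : Fin 3 → ℝ} (hu : ¬∃ c : ℝ, ∀ i, u i = c) :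
    0 < D u u :=
  lt_of_le_of_ne (h.nonneg u) fun e => hu ((h.zero_iff u).1 e.symm)

/-- Two energy forms are comparable, with a best constant that is attained. -/
lemma exists_best_bound {D₁ D₂ : Form} (h₁ : IsEnergy D₁) (h₂ : IsEnergy D₂) :
    ∃ M : ℝ, 0 < M ∧ (∀ x, D₁ x x ≤ M * D₂ x x) ∧
      ∃ u : Fin 3 → ℝ, (¬∃ c : ℝ, ∀ i, u i = c) ∧ D₁ u u = M * D₂ u u := by
  let v : ℝ × ℝ → (Fin 3 → ℝ) := fun y => ![0, y.1, y.2]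
  have hv : ∀ y, y ≠ 0 → ¬∃ c : ℝ, ∀ i, v y i = c := by
    rintro y hy ⟨c, hc⟩
    have h0 := hc 0
    have h1 := hc 1
    have h2 := hc 2
    simp [v] at h0 h1 h2
    exact hy (Prod.ext (by simp [h1, h0]) (by simp [h2, h0]))
  have hcont : ∀ {D : Form}, IsEnergy D → Continuous fun y => D (v y) (v y) := by
    intro D hD
    have : (fun y => D (v y) (v y)) = fun y : ℝ × ℝ => y.1 * y.1 * D ![0, 1, 0] ![0, 1, 0] +
      (y.1 * y.2 + y.2 * y.1) * D ![0, 1, 0] ![0, 0, 1] +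
      y.2 * y.2 * D ![0, 0, 1] ![0, 0, 1] := by
      funext y
      rw [form_expand hD.symm hD.nonneg hD.const_null]
      simp [v]
    rw [this]; fun_prop
  have hne : ∀ y ∈ Metric.sphere (0 : ℝ × ℝ) 1, y ≠ 0 := by
    rintro y hy rfl
    simp at hy
  obtain ⟨y, hy, hmax⟩ := (isCompact_sphere (0 : ℝ × ℝ) 1).exists_isMaxOn
    (NormedSpace.sphere_nonempty.2 zero_le_one)
    (f := fun y => D₁ (v y) (v y) / D₂ (v y) (v y))
    ((hcont h₁).continuousOn.div (hcont h₂).continuousOn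
      fun y hy => (h₂.pos (hv y (hne y hy))).ne')
  have p1 := h₁.pos (hv y (hne y hy))
  have p2 := h₂.pos (hv y (hne y hy))
  refine ⟨D₁ (v y) (v y) / D₂ (v y) (v y), by positivity, ?_, v y, hv y (hne y hy), by field_simp⟩
  intro x
  by_cases hx : ∃ c : ℝ, ∀ i, x i = c
  · rw [(h₁.zero_iff x).2 hx, (h₂.zero_iff x).2 hx]; simp
  · let z : ℝ × ℝ := (x 1 - x 0, x 2 - x 0)
    have hz : z ≠ 0 := by
      intro h
      have e1 : x 1 - x 0 = 0 := congrArg Prod.fst h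
      have e2 : x 2 - x 0 = 0 := congrArg Prod.snd h
      refine hx ⟨x 0, fun i => ?_⟩
      fin_cases i
      · rfl
      · exact sub_eq_zero.1 e1
      · exact sub_eq_zero.1 e2
    have hzn : 0 < ‖z‖ := norm_pos_iff.2 hz
    have hD : ∀ {D : Form}, IsEnergy D →
        D x x = ‖z‖ ^ 2 * D (v (‖z‖⁻¹ • z)) (v (‖z‖⁻¹ • z)) := by
      intro D hD
      rw [form_expand hD.symm hD.nonneg hD.const_null x x,
        form_expand hD.symm hD.nonneg hD.const_null (v _) (v _)]
      simp only [v, Prod.smul_fst, Prod.smul_snd, smul_eq_mul, Matrix.cons_val_zero,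
        Matrix.cons_val_one, Matrix.cons_val, z]
      have : ‖(x 1 - x 0, x 2 - x 0)‖ ≠ 0 := hzn.ne'
      field_simp
      ring
    have hs : ‖z‖⁻¹ • z ∈ Metric.sphere (0 : ℝ × ℝ) 1 := by
      simp [norm_smul, hzn.ne']
    have hm : D₁ (v (‖z‖⁻¹ • z)) (v (‖z‖⁻¹ • z)) / D₂ (v (‖z‖⁻¹ • z)) (v (‖z‖⁻¹ • z)) ≤
      D₁ (v y) (v y) / D₂ (v y) (v y) := hmax hs
    rw [div_le_iff₀ (h₂.pos (hv _ (hne _ hs)))] at hm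
    rw [hD h₁, hD h₂]
    have := mul_le_mul_of_nonneg_left hm (sq_nonneg ‖z‖)
    linarith

/-- The symmetric form with conductances `1/2, 1/2, s - 1/4`. -/
def symForm (s : ℝ) : Form :=
  LinearMap.mk₂ ℝ (fun x y => (x 0 - (x 1 + x 2) / 2) * (y 0 - (y 1 + y 2) / 2) +
    s * ((x 1 - x 2) * (y 1 - y 2)))
    (by intros; simp; ring) (by intros; simp; ring) (by intros; simp; ring) (by intros; simp; ring)

lemma symForm_apply (s : ℝ) (x y : Fin 3 → ℝ) :
    symForm s x y = (x 0 - (x 1 + x 2) / 2) * (y 0 - (y 1 + y 2) / 2) +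
      s * ((x 1 - x 2) * (y 1 - y 2)) := rfl

lemma symForm_isEnergy {s : ℝ} (hs : 0 < s) : IsEnergy (symForm s) where
  symm x y := by simp only [symForm_apply]; ring
  nonneg x := by
    simp only [symForm_apply]
    have := mul_nonneg hs.le (mul_self_nonneg (x 1 - x 2))
    nlinarith [mul_self_nonneg (x 0 - (x 1 + x 2) / 2)]
  zero_iff x := by
    simp only [symForm_apply]
    constructor
    · intro h
      have h1 := mul_nonneg hs.le (mul_self_nonneg (x 1 - x 2))
      have h2 := mul_self_nonneg (x 0 - (x 1 + x 2) / 2)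
      have h3 : x 1 - x 2 = 0 := by
        have : s * ((x 1 - x 2) * (x 1 - x 2)) = 0 := by linarith
        simpa [hs.ne'] using this
      have h4 : x 0 - (x 1 + x 2) / 2 = 0 := mul_self_eq_zero.1 (by linarith)
      refine ⟨x 0, fun i => ?_⟩
      fin_cases i
      · rfl
      · change x 1 = x 0; linarith
      · change x 2 = x 0; linarith
    · rintro ⟨c, hc⟩
      rw [hc, hc, hc]; ring

/-- The form with conductances `1/2, 1/2, 0`, used for comparison. -/
abbrev stdForm : Form := symForm (1 / 4)

lemma stdForm_isEnergy : IsEnergy stdForm := symForm_isEnergy (by norm_num)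

lemma stdForm_apply (x : Fin 3 → ℝ) :
    stdForm x x = ((x 0 - x 1) ^ 2 + (x 0 - x 2) ^ 2) / 2 := by
  rw [symForm_apply]; ring

lemma IsEnergy.exists_le {D : Form} (h : IsEnergy D) :
    ∃ K : ℝ, 0 < K ∧ ∀ x, D x x ≤ K * stdForm x x := by
  obtain ⟨M, hM, h1, -⟩ := exists_best_bound h stdForm_isEnergy
  exact ⟨M, hM, h1⟩

lemma IsEnergy.exists_ge {D : Form} (h : IsEnergy D) :
    ∃ K : ℝ, 0 < K ∧ ∀ x, stdForm x x ≤ K * D x x := by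
  obtain ⟨M, hM, h1, -⟩ := exists_best_bound stdForm_isEnergy h
  exact ⟨M, hM, h1⟩

/-! The real-valued energy and trace. -/

/-- The contribution of level `n` to the energy. -/
def wlev (r : ℝ) (D : Form) (g : ℕ → ℝ → ℝ) (n : ℕ) : ℝ := (r ^ n)⁻¹ * lev D g n

/-- The function `g` has finite energy. -/
def FiniteEnergy (r : ℝ) (D : Form) (g : ℕ → ℝ → ℝ) : Prop := Summable (wlev r D g)

/-- The energy of `g`, as a real number. -/
def en (r : ℝ) (D : Form) (g : ℕ → ℝ → ℝ) : ℝ := ∑' n, wlev r D g n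

/-- The trace `𝓡_r D`, as a real number. -/
def trc (r : ℝ) (D : Form) (u : Fin 3 → ℝ) : ℝ :=
  sInf (en r D '' {g | Adm u g ∧ FiniteEnergy r D g})

lemma tri_add (g k : ℕ → ℝ → ℝ) (n : ℕ) (b : ℝ) : tri (g + k) n b = tri g n b + tri k n b := by
  ext i; fin_cases i <;> simp [tri]

lemma tri_smul (c : ℝ) (g : ℕ → ℝ → ℝ) (n : ℕ) (b : ℝ) : tri (c • g) n b = c • tri g n b := by
  ext i; fin_cases i <;> simp [tri]

lemma tri_congr {g k : ℕ → ℝ → ℝ} (h : ∀ n, ∀ b ∈ stem n, g n b = k n b) {n : ℕ} {b : ℝ}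
    (hb : b ∈ stem n) : tri g n b = tri k n b := by
  simp only [tri, h n b hb, h _ _ (stem_left hb), h _ _ (stem_right hb)]

lemma lev_congr {g k : ℕ → ℝ → ℝ} (h : ∀ n, ∀ b ∈ stem n, g n b = k n b) (D : Form) (n : ℕ) :
    lev D g n = lev D k n :=
  Finset.sum_congr rfl fun b hb => by rw [tri_congr h hb]

lemma wlev_congr {g k : ℕ → ℝ → ℝ} (h : ∀ n, ∀ b ∈ stem n, g n b = k n b) (r : ℝ) (D : Form) :
    wlev r D g = wlev r D k := by
  funext n; rw [wlev, wlev, lev_congr h]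

lemma lev_nonneg {D : Form} (hD : IsEnergy D) (g : ℕ → ℝ → ℝ) (n : ℕ) : 0 ≤ lev D g n :=
  Finset.sum_nonneg fun _ _ => hD.nonneg _

lemma wlev_nonneg {r : ℝ} (hr : 0 < r) {D : Form} (hD : IsEnergy D) (g : ℕ → ℝ → ℝ) (n : ℕ) :
    0 ≤ wlev r D g n := by
  have := lev_nonneg hD g n
  unfold wlev; positivity

lemma en_nonneg {r : ℝ} (hr : 0 < r) {D : Form} (hD : IsEnergy D) (g : ℕ → ℝ → ℝ) :
    0 ≤ en r D g := tsum_nonneg fun n => wlev_nonneg hr hD g n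

lemma lev_le {D D' : Form} {M : ℝ} (h : ∀ x, D x x ≤ M * D' x x) (g : ℕ → ℝ → ℝ) (n : ℕ) :
    lev D g n ≤ M * lev D' g n := by
  rw [lev, lev, Finset.mul_sum]
  exact Finset.sum_le_sum fun _ _ => h _

lemma wlev_le {r : ℝ} (hr : 0 < r) {D D' : Form} {M : ℝ} (h : ∀ x, D x x ≤ M * D' x x)
    (g : ℕ → ℝ → ℝ) (n : ℕ) : wlev r D g n ≤ M * wlev r D' g n := by
  have := mul_le_mul_of_nonneg_left (lev_le h g n) (by positivity : (0 : ℝ) ≤ (r ^ n)⁻¹)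
  unfold wlev; linarith

lemma FiniteEnergy.mono {r : ℝ} (hr : 0 < r) {D D' : Form} (hD : IsEnergy D) {M : ℝ}
    (h : ∀ x, D x x ≤ M * D' x x) {g : ℕ → ℝ → ℝ} (hg : FiniteEnergy r D' g) : FiniteEnergy r D g :=
  Summable.of_nonneg_of_le (wlev_nonneg hr hD g) (wlev_le hr h g) (hg.mul_left M)

lemma FiniteEnergy.change {r : ℝ} (hr : 0 < r) {D D' : Form} (hD : IsEnergy D) (hD' : IsEnergy D')
    {g : ℕ → ℝ → ℝ} (hg : FiniteEnergy r D' g) : FiniteEnergy r D g := by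
  obtain ⟨M, -, h, -⟩ := exists_best_bound hD hD'
  exact hg.mono hr hD h

lemma en_le {r : ℝ} (hr : 0 < r) {D D' : Form} (hD : IsEnergy D) {M : ℝ}
    (h : ∀ x, D x x ≤ M * D' x x) {g : ℕ → ℝ → ℝ} (hg : FiniteEnergy r D' g) :
    en r D g ≤ M * en r D' g := by
  unfold en
  rw [← tsum_mul_left]
  exact Summable.tsum_le_tsum (wlev_le hr h g) (hg.mono hr hD h) (hg.mul_left M)

/-- The place where r > ρ is used: against the weights r^(-n), level energies of order ρⁿ form a
convergent geometric series. -/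
lemma fin_of_lev_le {r : ℝ} (hr : rho < r) {D : Form} (hD : IsEnergy D) {g : ℕ → ℝ → ℝ} {C : ℝ}
    {N : ℕ} (h : ∀ n ≥ N, lev D g n ≤ C * rho ^ n) : FiniteEnergy r D g := by
  have hr0 : 0 < r := rho_pos.trans hr
  unfold FiniteEnergy
  rw [← summable_nat_add_iff N]
  have hs : Summable fun n => C * (rho / r) ^ (n + N) :=
    (((summable_nat_add_iff N).2 (summable_geometric_of_lt_one (by have := rho_pos; positivity)
      ((div_lt_one hr0).2 hr)))).mul_left C
  refine Summable.of_nonneg_of_le (fun n => wlev_nonneg hr0 hD g _) (fun n => ?_) hs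
  have := mul_le_mul_of_nonneg_left (h (n + N) (by omega))
    (by positivity : (0 : ℝ) ≤ (r ^ (n + N))⁻¹)
  unfold wlev
  refine this.trans (le_of_eq ?_)
  rw [div_pow]; field_simp

/-- A linear interpolation between two values. -/
lemma exists_ramp (a b : ℝ) : ∃ G : ℝ → ℝ, Continuous G ∧ G 0 = a ∧ G 1 = b ∧
    ∀ n, ∑ t ∈ stem n, (G (t + rho ^ (n + 2)) - G t) ^ 2 ≤ rho ^ (n + 2) * (2 * (b - a) ^ 2) := by
  obtain ⟨G, H, hG, hH, hf, hGH, h0, hm, -⟩ := exists_interpolant {0, 1}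
    (fun x => if x = 0 then a else b) (fun _ => (b - a) ^ 2) (fun _ => sq_nonneg _) (by
      rintro x y ⟨hx, hy, hxy, -⟩
      simp at hx hy
      rcases hx with rfl | rfl <;> rcases hy with rfl | rfl
      · exact absurd hxy (lt_irrefl _)
      · norm_num
      · exact absurd hxy (by norm_num)
      · exact absurd hxy (lt_irrefl _))
  refine ⟨G, hG, by simpa using hf 0 (by simp), by simpa using hf 1 (by simp), fun n => ?_⟩
  have := sum_sq_le_of_interpolant hH hGH h0 hm n
  rw [Finset.sum_pair (by norm_num)] at this
  linarith

lemma lev_std_of_horiz {g : ℕ → ℝ → ℝ} {G : ℝ → ℝ} {n : ℕ} (h : ∀ b ∈ stem n, g n b = G b)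
    (h' : ∀ b ∈ stem (n + 1), g (n + 1) b = G b) :
    lev stdForm g n = (∑ t ∈ stem n, (G (t + rho ^ (n + 2)) - G t) ^ 2) / 2 := by
  rw [lev, Finset.sum_div]
  refine Finset.sum_congr rfl fun t ht => ?_
  rw [stdForm_apply]
  simp only [tri, h t ht, h' t (stem_left ht), h' _ (stem_right ht), Matrix.cons_val_zero,
    Matrix.cons_val_one, Matrix.cons_val]
  ring

lemma fin_of_horiz {r : ℝ} (hr : rho < r) {D : Form} (hD : IsEnergy D) {g : ℕ → ℝ → ℝ}
    {G : ℝ → ℝ} {N : ℕ} (h : ∀ n > N, ∀ b ∈ stem n, g n b = G b) {C : ℝ}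
    (hG : ∀ n, ∑ t ∈ stem n, (G (t + rho ^ (n + 2)) - G t) ^ 2 ≤ rho ^ (n + 2) * C) :
    FiniteEnergy r D g := by
  refine FiniteEnergy.change (rho_pos.trans hr) hD stdForm_isEnergy ?_
  refine fin_of_lev_le hr stdForm_isEnergy (C := rho ^ 2 * C / 2) (N := N + 1) fun n hn => ?_
  rw [lev_std_of_horiz (h n (by omega)) (h (n + 1) (by omega))]
  have := hG n
  rw [show rho ^ (n + 2) * C = rho ^ n * rho ^ 2 * C by ring] at this
  linarith

lemma exists_fin {r : ℝ} (hr : rho < r) {D : Form} (hD : IsEnergy D) (u : Fin 3 → ℝ) :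
    ∃ g, Adm u g ∧ FiniteEnergy r D g := by
  obtain ⟨G, hG, h0, h1, hs⟩ := exists_ramp (u 1) (u 2)
  refine ⟨fun n b => if n = 0 then u 0 else G b, ?_,
    fin_of_horiz hr hD (N := 0) (G := G) (fun n hn b _ => by simp [Nat.pos_iff_ne_zero.1 hn]) hs⟩
  have := adm_of_eventually_horiz (g := fun n b => if n = 0 then u 0 else G b) (N := 0) hG
    (fun n hn b _ => by simp [Nat.pos_iff_ne_zero.1 hn])
  convert this using 1
  ext i; fin_cases i <;> simp [h0, h1]

/-! ### The trace as a quadratic form in the boundary values. -/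

section Trace

variable {r : ℝ} {D : Form} {u : Fin 3 → ℝ}

lemma trc_le (hr : 0 < r) (hD : IsEnergy D) {g : ℕ → ℝ → ℝ} (hg : Adm u g) (hf : FiniteEnergy r D g) :
    trc r D u ≤ en r D g :=
  csInf_le ⟨0, by rintro _ ⟨k, -, rfl⟩; exact en_nonneg hr hD k⟩ ⟨g, ⟨hg, hf⟩, rfl⟩

lemma le_trc (hr : rho < r) (hD : IsEnergy D) {c : ℝ}
    (h : ∀ g, Adm u g → FiniteEnergy r D g → c ≤ en r D g) : c ≤ trc r D u := by
  obtain ⟨g, hg⟩ := exists_fin hr hD u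
  refine le_csInf ⟨_, g, hg, rfl⟩ ?_
  rintro _ ⟨k, hk, rfl⟩
  exact h k hk.1 hk.2

lemma exists_near (hr : rho < r) (hD : IsEnergy D) (u : Fin 3 → ℝ) {ε : ℝ} (hε : 0 < ε) :
    ∃ g, Adm u g ∧ FiniteEnergy r D g ∧ en r D g < trc r D u + ε := by
  obtain ⟨g, hg⟩ := exists_fin hr hD u
  obtain ⟨_, ⟨k, hk, rfl⟩, hlt⟩ := exists_lt_of_csInf_lt
    (s := en r D '' {g | Adm u g ∧ FiniteEnergy r D g}) ⟨_, g, hg, rfl⟩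
    (lt_add_of_pos_right (sInf _) hε)
  exact ⟨k, hk.1, hk.2, hlt⟩

lemma trc_nonneg (hr : rho < r) (hD : IsEnergy D) : 0 ≤ trc r D u :=
  le_trc hr hD fun g _ _ => en_nonneg (rho_pos.trans hr) hD g

lemma renormalize_eq {W : Set (List (Fin 3))} (hW : IsIndexSet W) (hr : rho < r)
    (hD : IsEnergy D) (u : Fin 3 → ℝ) :
    renormalize W r D u = ENNReal.ofReal (trc r D u) := by
  have hr0 := rho_pos.trans hr
  have hfin : ∀ g, FiniteEnergy r D g →
      ∑' n, ENNReal.ofReal (wlev r D g n) = ENNReal.ofReal (en r D g) := fun g hg =>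
    (ENNReal.ofReal_tsum_of_nonneg (wlev_nonneg hr0 hD g) hg).symm
  apply le_antisymm
  · have key : ∀ ε > 0, renormalize W r D u ≤ ENNReal.ofReal (trc r D u + ε) := by
      intro ε hε
      obtain ⟨g, ⟨f, hf, hq, hgf⟩, hg, hlt⟩ := exists_near hr hD u hε
      have hw : wlev r D (onVerts f) = wlev r D g :=
        wlev_congr (fun n b hb => (hgf n b hb).symm) r D
      have hle : renormalize W r D u ≤ energy W r D f :=
        iInf₂_le f ⟨by rw [V1_eq hW]; exact hf, hq⟩
      refine hle.trans ?_
      rw [energy_eq hW hr0 hD.nonneg]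
      have : (fun n => (r ^ n)⁻¹ * lev D (onVerts f) n) = wlev r D g := hw
      simp only [funext_iff] at this
      simp only [this, hfin g hg]
      exact ENNReal.ofReal_le_ofReal hlt.le
    have ht : Filter.Tendsto (fun ε => ENNReal.ofReal (trc r D u + ε)) (nhdsWithin 0 (Ioi 0))
        (nhds (ENNReal.ofReal (trc r D u))) := by
      have : Continuous fun ε => ENNReal.ofReal (trc r D u + ε) :=
        ENNReal.continuous_ofReal.comp (by fun_prop)
      have := (this.tendsto 0).mono_left (nhdsWithin_le_nhds (s := Ioi 0))
      simpa using this
    exact ge_of_tendsto ht (Filter.eventually_of_mem self_mem_nhdsWithin key)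
  · refine le_iInf₂ fun f hf => ?_
    rw [V1_eq hW] at hf
    rw [energy_eq hW hr0 hD.nonneg]
    change _ ≤ ∑' n, ENNReal.ofReal (wlev r D (onVerts f) n)
    by_cases htop : ∑' n, ENNReal.ofReal (wlev r D (onVerts f) n) = ⊤
    · rw [htop]; exact le_top
    · have hg : FiniteEnergy r D (onVerts f) := by
        have := ENNReal.summable_toReal htop
        simp only [ENNReal.toReal_ofReal (wlev_nonneg hr0 hD _ _)] at this
        exact this
      rw [hfin _ hg]
      exact ENNReal.ofReal_le_ofReal (trc_le hr0 hD ⟨f, hf.1, hf.2, fun _ _ _ => rfl⟩ hg)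

lemma solves_iff {W : Set (List (Fin 3))} (hW : IsIndexSet W) (hr : rho < r)
    (hD : IsEnergy D) {c : ℝ} (hc : 0 < c) :
    SolvesRenormalization W r c D ↔ ∀ u, trc r D u = c * D u u := by
  refine forall_congr' fun u => ?_
  rw [renormalize_eq hW hr hD]
  exact ENNReal.ofReal_eq_ofReal_iff (trc_nonneg hr hD) (mul_nonneg hc.le (hD.nonneg u))

lemma trc_mono_form (hr : rho < r) {D' : Form} (hD : IsEnergy D) (hD' : IsEnergy D') {M : ℝ}
    (hM : 0 ≤ M) (h : ∀ x, D x x ≤ M * D' x x) (u : Fin 3 → ℝ) :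
    trc r D u ≤ M * trc r D' u := by
  have hr0 := rho_pos.trans hr
  have key : ∀ ε > 0, trc r D u ≤ M * (trc r D' u + ε) := by
    intro ε hε
    obtain ⟨g, hg, hf, hlt⟩ := exists_near hr hD' u hε
    exact (trc_le hr0 hD hg (hf.mono hr0 hD h)).trans ((en_le hr0 hD h hf).trans
      (mul_le_mul_of_nonneg_left hlt.le hM))
  refine le_of_forall_pos_le_add fun ε hε => ?_
  have := key (ε / (M + 1)) (by positivity)
  have h2 : M * (ε / (M + 1)) ≤ ε := by
    rw [mul_div_assoc', div_le_iff₀ (by positivity)]; nlinarith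
  linarith

lemma FiniteEnergy.smul {g : ℕ → ℝ → ℝ} (c : ℝ) (hg : FiniteEnergy r D g) :
    FiniteEnergy r D (c • g) ∧ en r D (c • g) = c ^ 2 * en r D g := by
  have : wlev r D (c • g) = fun n => c ^ 2 * wlev r D g n := by
    funext n
    simp only [wlev, lev, Finset.mul_sum]
    refine Finset.sum_congr rfl fun b _ => ?_
    rw [tri_smul, map_smul, LinearMap.map_smul, LinearMap.smul_apply]
    simp only [smul_eq_mul]
    ring
  unfold FiniteEnergy en
  rw [this]
  exact ⟨hg.mul_left _, tsum_mul_left⟩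

lemma FiniteEnergy.parallelogram (hr : 0 < r) (hD : IsEnergy D) {g k : ℕ → ℝ → ℝ} (hg : FiniteEnergy r D g)
    (hk : FiniteEnergy r D k) : FiniteEnergy r D (g + k) ∧ FiniteEnergy r D (g - k) ∧
      en r D (g + k) + en r D (g - k) = 2 * en r D g + 2 * en r D k := by
  have hp : ∀ n, wlev r D (g + k) n + wlev r D (g - k) n =
      2 * wlev r D g n + 2 * wlev r D k n := by
    intro n
    simp only [wlev, lev, Finset.mul_sum]
    rw [← Finset.sum_add_distrib, ← Finset.sum_add_distrib]
    refine Finset.sum_congr rfl fun b _ => ?_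
    have e : g - k = g + (-1 : ℝ) • k := by simp [sub_eq_add_neg]
    have e' : g + k = g + (1 : ℝ) • k := by simp
    rw [e, e', tri_add, tri_add, tri_smul, tri_smul, form_add_self hD.symm,
      form_add_self hD.symm]
    ring
  have hs := (hg.mul_left 2).add (hk.mul_left 2)
  have h1 : FiniteEnergy r D (g + k) := Summable.of_nonneg_of_le (wlev_nonneg hr hD _)
    (fun n => by linarith [hp n, wlev_nonneg hr hD (g - k) n]) hs
  have h2 : FiniteEnergy r D (g - k) := Summable.of_nonneg_of_le (wlev_nonneg hr hD _)
    (fun n => by linarith [hp n, wlev_nonneg hr hD (g + k) n]) hs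
  refine ⟨h1, h2, ?_⟩
  unfold en
  rw [← h1.tsum_add h2, ← tsum_mul_left, ← tsum_mul_left,
    ← (hg.mul_left 2).tsum_add (hk.mul_left 2)]
  exact tsum_congr hp

lemma trc_smul_le (hr : rho < r) (hD : IsEnergy D) (c : ℝ) (u : Fin 3 → ℝ) :
    trc r D (c • u) ≤ c ^ 2 * trc r D u := by
  have hr0 := rho_pos.trans hr
  have key : ∀ ε > 0, trc r D (c • u) ≤ c ^ 2 * (trc r D u + ε) := by
    intro ε hε
    obtain ⟨g, hg, hf, hlt⟩ := exists_near hr hD u hε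
    obtain ⟨h1, h2⟩ := hf.smul c
    refine (trc_le hr0 hD (hg.smul c) h1).trans ?_
    rw [h2]
    exact mul_le_mul_of_nonneg_left hlt.le (sq_nonneg c)
  refine le_of_forall_pos_le_add fun ε hε => ?_
  have := key (ε / (c ^ 2 + 1)) (by positivity)
  have h2 : c ^ 2 * (ε / (c ^ 2 + 1)) ≤ ε := by
    rw [mul_div_assoc', div_le_iff₀ (by positivity)]; nlinarith [sq_nonneg c]
  linarith

lemma trc_smul (hr : rho < r) (hD : IsEnergy D) (c : ℝ) (u : Fin 3 → ℝ) :
    trc r D (c • u) = c ^ 2 * trc r D u := by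
  refine le_antisymm (trc_smul_le hr hD c u) ?_
  rcases eq_or_ne c 0 with rfl | hc
  · simpa using trc_nonneg hr hD
  · have := trc_smul_le hr hD c⁻¹ (c • u)
    rw [smul_smul, inv_mul_cancel₀ hc, one_smul] at this
    calc c ^ 2 * trc r D u ≤ c ^ 2 * (c⁻¹ ^ 2 * trc r D (c • u)) :=
          mul_le_mul_of_nonneg_left this (sq_nonneg c)
      _ = _ := by field_simp

lemma trc_parallelogram_le (hr : rho < r) (hD : IsEnergy D) (u v : Fin 3 → ℝ) :
    trc r D (u + v) + trc r D (u - v) ≤ 2 * trc r D u + 2 * trc r D v := by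
  have hr0 := rho_pos.trans hr
  refine le_of_forall_pos_le_add fun ε hε => ?_
  obtain ⟨g, hg, hf, hlt⟩ := exists_near hr hD u (ε := ε / 4) (by positivity)
  obtain ⟨k, hk, hf', hlt'⟩ := exists_near hr hD v (ε := ε / 4) (by positivity)
  obtain ⟨h1, h2, h3⟩ := hf.parallelogram hr0 hD hf'
  have := trc_le hr0 hD (hg.add hk) h1
  have := trc_le hr0 hD (hg.sub hk) h2
  linarith

lemma trc_parallelogram (hr : rho < r) (hD : IsEnergy D) (u v : Fin 3 → ℝ) :
    trc r D (u + v) + trc r D (u - v) = 2 * trc r D u + 2 * trc r D v := by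
  refine le_antisymm (trc_parallelogram_le hr hD u v) ?_
  -- The inequality for u + v and u - v, combined with homogeneity of degree two, is the reverse
  -- inequality for u and v.
  have := trc_parallelogram_le hr hD (u + v) (u - v)
  rw [show u + v + (u - v) = (2 : ℝ) • u by rw [two_smul]; abel,
    show u + v - (u - v) = (2 : ℝ) • v by rw [two_smul]; abel, trc_smul hr hD, trc_smul hr hD]
    at this
  linarith

lemma trc_add_const_le (hr : rho < r) (hD : IsEnergy D) (u : Fin 3 → ℝ) (c : ℝ) :
    trc r D (u + fun _ => c) ≤ trc r D u := by
  have hr0 := rho_pos.trans hr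
  refine le_of_forall_pos_le_add fun ε hε => ?_
  obtain ⟨g, hg, hf, hlt⟩ := exists_near hr hD u hε
  have e : wlev r D (g + fun _ _ => c) = wlev r D g := by
    funext n
    simp only [wlev, lev]
    congr 1
    refine Finset.sum_congr rfl fun b _ => ?_
    rw [form_expand hD.symm hD.nonneg hD.const_null,
      form_expand hD.symm hD.nonneg hD.const_null (tri g n b)]
    simp [tri]
  have := trc_le hr0 hD (hg.add (Adm.const c)) (by unfold FiniteEnergy; rw [e]; exact hf)
  unfold en at this hlt
  rw [e] at this
  linarith

lemma trc_add_const (hr : rho < r) (hD : IsEnergy D) (u : Fin 3 → ℝ) (c : ℝ) :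
    trc r D (u + fun _ => c) = trc r D u := by
  refine le_antisymm (trc_add_const_le hr hD u c) ?_
  have := trc_add_const_le hr hD (u + fun _ => c) (-c)
  rwa [show (u + fun _ => c) + (fun _ => -c) = u by ext i; simp] at this

end Trace

end GoldenGasket

/-! ### Resistance estimates along the two boundary rays. -/

namespace GoldenGasket

lemma ray_finite {r : ℝ} (hr : 0 < r) {a w : ℕ → ℝ} (hw : ∀ n, 0 ≤ w n)
    (h : ∀ n, (a n - a (n + 1)) ^ 2 ≤ r ^ n * w n) (N k : ℕ) :
    (a N - a (N + k)) ^ 2 ≤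
      (∑ j ∈ Finset.range k, r ^ (N + j)) * ∑ j ∈ Finset.range k, w (N + j) := by
  induction k with
  | zero => simp
  | succ k ih =>
    rw [Finset.sum_range_succ, Finset.sum_range_succ]
    have := sq_add_le_mul_add (Finset.sum_nonneg fun j _ => (pow_pos hr (N + j)).le)
      (pow_pos hr (N + k)).le (Finset.sum_nonneg fun j _ => hw (N + j)) (hw (N + k)) ih (h (N + k))
    convert this using 2
    rw [← add_assoc]; ring

/-- The Cauchy–Schwarz bound along a ray of edges with resistances `r ^ n`. -/
lemma ray_bound {r : ℝ} (hr : 0 < r) (hr1 : r < 1) {a w : ℕ → ℝ} {l : ℝ} (hw : ∀ n, 0 ≤ w n)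
    (hs : Summable w) (h : ∀ n, (a n - a (n + 1)) ^ 2 ≤ r ^ n * w n)
    (hl : Filter.Tendsto a Filter.atTop (nhds l)) (N : ℕ) :
    (a N - l) ^ 2 ≤ r ^ N / (1 - r) * ∑' j, w (j + N) := by
  have hsN : Summable fun j => w (j + N) := (summable_nat_add_iff N).2 hs
  have hg : Summable fun j => r ^ (N + j) := by
    simp_rw [pow_add]; exact (summable_geometric_of_lt_one hr.le hr1).mul_left _
  have hgs : ∑' j, r ^ (N + j) = r ^ N / (1 - r) := by
    simp_rw [pow_add]; rw [tsum_mul_left, tsum_geometric_of_lt_one hr.le hr1]; rfl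
  have ht : Filter.Tendsto (fun k => (a N - a (N + k)) ^ 2) Filter.atTop
      (nhds ((a N - l) ^ 2)) := by
    have h1 : Filter.Tendsto (fun k => a (N + k)) Filter.atTop (nhds l) := by
      have := (Filter.tendsto_add_atTop_iff_nat N).2 hl
      simpa only [add_comm] using this
    exact (tendsto_const_nhds.sub h1).pow 2
  refine le_of_tendsto ht (Filter.Eventually.of_forall fun k => ?_)
  refine (ray_finite hr hw h N k).trans ?_
  rw [← hgs]
  refine mul_le_mul (hg.sum_le_tsum _ fun j _ => (pow_pos hr _).le) ?_
    (Finset.sum_nonneg fun j _ => hw _) (tsum_nonneg fun j => (pow_pos hr _).le)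
  have := hsN.sum_le_tsum (Finset.range k) fun j _ => hw _
  simpa only [add_comm] using this

lemma std_left_le (x : Fin 3 → ℝ) : (x 0 - x 1) ^ 2 ≤ 2 * stdForm x x := by
  rw [stdForm_apply]; nlinarith [sq_nonneg (x 0 - x 2)]

lemma std_right_le (x : Fin 3 → ℝ) : (x 0 - x 2) ^ 2 ≤ 2 * stdForm x x := by
  rw [stdForm_apply]; nlinarith [sq_nonneg (x 0 - x 1)]

lemma std_tri_le (g : ℕ → ℝ → ℝ) {n : ℕ} {b : ℝ} (hb : b ∈ stem n) :
    stdForm (tri g n b) (tri g n b) ≤ lev stdForm g n :=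
  Finset.single_le_sum (f := fun b => stdForm (tri g n b) (tri g n b))
    (fun _ _ => stdForm_isEnergy.nonneg _) hb

lemma lev_eq_wlev {r : ℝ} (hr : 0 < r) (D : Form) (g : ℕ → ℝ → ℝ) (n : ℕ) :
    lev D g n = r ^ n * wlev r D g n := by
  unfold wlev; field_simp

lemma left_edge_le (g : ℕ → ℝ → ℝ) (n : ℕ) :
    (g n 0 - g (n + 1) 0) ^ 2 ≤ 2 * lev stdForm g n := by
  have h1 := std_left_le (tri g n 0)
  have h2 := std_tri_le g (zero_mem_stem n)
  simp only [tri, Matrix.cons_val_zero, Matrix.cons_val_one] at h1 h2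
  linarith

lemma right_edge_le (g : ℕ → ℝ → ℝ) (n : ℕ) :
    (g n (1 - rho ^ n) - g (n + 1) (1 - rho ^ (n + 1))) ^ 2 ≤ 2 * lev stdForm g n := by
  have h1 := std_right_le (tri g n (1 - rho ^ n))
  have h2 := std_tri_le g (last_mem_stem n)
  have e : 1 - rho ^ n + rho ^ (n + 2) = 1 - rho ^ (n + 1) := by rw [rho_pow_add_two]; ring
  simp only [tri, Matrix.cons_val_zero, Matrix.cons_val, e] at h1 h2
  linarith

section

variable {r : ℝ} {u : Fin 3 → ℝ} {g : ℕ → ℝ → ℝ}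

lemma left_bound (hr : 0 < r) (hr1 : r < 1) (hg : Adm u g) (hf : FiniteEnergy r stdForm g) (N : ℕ) :
    (g N 0 - u 1) ^ 2 ≤ r ^ N / (1 - r) * (2 * ∑' j, wlev r stdForm g (j + N)) := by
  have hw := wlev_nonneg hr stdForm_isEnergy g
  have := ray_bound hr hr1 (a := fun n => g n 0) (w := fun n => 2 * wlev r stdForm g n)
    (fun n => by linarith [hw n]) (hf.mul_left 2) (fun n => by
      have := left_edge_le g n
      rw [lev_eq_wlev hr] at this
      linarith) hg.tendsto_left N
  rwa [tsum_mul_left] at this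

lemma right_bound (hr : 0 < r) (hr1 : r < 1) (hg : Adm u g) (hf : FiniteEnergy r stdForm g) (N : ℕ) :
    (g N (1 - rho ^ N) - u 2) ^ 2 ≤ r ^ N / (1 - r) * (2 * ∑' j, wlev r stdForm g (j + N)) := by
  have hw := wlev_nonneg hr stdForm_isEnergy g
  have := ray_bound hr hr1 (a := fun n => g n (1 - rho ^ n))
    (w := fun n => 2 * wlev r stdForm g n)
    (fun n => by linarith [hw n]) (hf.mul_left 2) (fun n => by
      have := right_edge_le g n
      rw [lev_eq_wlev hr] at this
      linarith) hg.tendsto_right N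
  rwa [tsum_mul_left] at this

/-- The left ray alone joins q_0 to q_1 with resistance at most 2 ∑ rⁿ = 2 / (1 - r). -/
lemma trc_std_lower (hr : rho < r) (hr1 : r < 1) (u : Fin 3 → ℝ) :
    (1 - r) / 2 * (u 0 - u 1) ^ 2 ≤ trc r stdForm u := by
  have hr0 := rho_pos.trans hr
  refine le_trc hr stdForm_isEnergy fun g hg hf => ?_
  have := left_bound hr0 hr1 hg hf 0
  simp only [pow_zero, add_zero, hg.root] at this
  have h1 : 0 < 1 - r := by linarith
  rw [div_mul_eq_mul_div, le_div_iff₀ h1] at this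
  unfold en
  linarith

lemma symForm_mono {s t : ℝ} (h : s ≤ t) (x : Fin 3 → ℝ) : symForm s x x ≤ symForm t x x := by
  simp only [symForm_apply]
  nlinarith [mul_nonneg (sub_nonneg.2 h) (mul_self_nonneg (x 1 - x 2))]

/-! Reflection symmetry. -/

lemma lev_refl (s : ℝ) (g : ℕ → ℝ → ℝ) (n : ℕ) :
    lev (symForm s) (refl g) n = lev (symForm s) g n := by
  unfold lev
  refine Finset.sum_nbij' (fun b => 1 - rho ^ n - b) (fun b => 1 - rho ^ n - b)
    (fun b hb => stem_reflect hb) (fun b hb => stem_reflect hb) (fun b _ => by ring)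
    (fun b _ => by ring) fun b _ => ?_
  have e := rho_pow_add_two n
  have e1 : 1 - rho ^ (n + 1) - b = 1 - rho ^ n - b + rho ^ (n + 2) := by linarith
  have e2 : 1 - rho ^ (n + 1) - (b + rho ^ (n + 2)) = 1 - rho ^ n - b := by linarith
  simp only [symForm_apply, tri, GoldenGasket.refl, Matrix.cons_val_zero, Matrix.cons_val_one,
    Matrix.cons_val, e1, e2]
  ring

lemma trc_swap_le (hr : rho < r) {s : ℝ} (hs : 0 < s) (u : Fin 3 → ℝ) :
    trc r (symForm s) (swap u) ≤ trc r (symForm s) u := by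
  have hr0 := rho_pos.trans hr
  refine le_trc hr (symForm_isEnergy hs) fun g hg hf => ?_
  have e : wlev r (symForm s) (refl g) = wlev r (symForm s) g := by
    funext n; rw [wlev, wlev, lev_refl]
  have := trc_le hr0 (symForm_isEnergy hs) hg.refl (by unfold FiniteEnergy; rw [e]; exact hf)
  rwa [en, e] at this

lemma trc_swap (hr : rho < r) {s : ℝ} (hs : 0 < s) (u : Fin 3 → ℝ) :
    trc r (symForm s) (swap u) = trc r (symForm s) u := by
  refine le_antisymm (trc_swap_le hr hs u) ?_
  have := trc_swap_le hr hs (swap u)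
  rwa [show swap (swap u) = u by ext i; fin_cases i <;> simp [swap]] at this

/-! ### Existence of a symmetric eigenform. -/

/-- The trace form at the symmetric eigenvector of the reflection. -/
def trcA (r s : ℝ) : ℝ := trc r (symForm s) ![1, 0, 0]

/-- The trace form at the antisymmetric eigenvector of the reflection. -/
def trcB (r s : ℝ) : ℝ := trc r (symForm s) ![0, 1 / 2, -1 / 2]

/-- Modulo constants u is v + w with v even and w odd under the reflection. The reflection takes v +
w to v - w and preserves the trace, so the parallelogram law leaves no mixed term. -/
lemma trc_symForm (hr : rho < r) {s : ℝ} (hs : 0 < s) (u : Fin 3 → ℝ) :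
    trc r (symForm s) u =
      (u 0 - (u 1 + u 2) / 2) ^ 2 * trcA r s + (u 1 - u 2) ^ 2 * trcB r s := by
  have hE := symForm_isEnergy hs
  let v : Fin 3 → ℝ := (u 0 - (u 1 + u 2) / 2) • ![1, 0, 0]
  let w : Fin 3 → ℝ := (u 1 - u 2) • ![0, 1 / 2, -1 / 2]
  have h1 : u = (v + w) + fun _ => (u 1 + u 2) / 2 := by
    ext i; fin_cases i <;> simp [v, w] <;> ring
  have h2 : swap (v + w) = v - w := by
    ext i; fin_cases i <;> simp [v, w, swap] <;> ring
  have h3 := trc_parallelogram hr hE v w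
  rw [← h2, trc_swap hr hs] at h3
  have h4 : trc r (symForm s) v = (u 0 - (u 1 + u 2) / 2) ^ 2 * trcA r s := trc_smul hr hE _ _
  have h5 : trc r (symForm s) w = (u 1 - u 2) ^ 2 * trcB r s := trc_smul hr hE _ _
  have h6 : trc r (symForm s) u = trc r (symForm s) (v + w) := by
    conv_lhs => rw [h1]
    exact trc_add_const hr hE _ _
  linarith

lemma symForm_abs_le {s : ℝ} (hs : 1 / 4 ≤ s) (x : Fin 3 → ℝ) :
    symForm s (fun i => |x i|) (fun i => |x i|) ≤ symForm s x x := by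
  have key : ∀ y : Fin 3 → ℝ, symForm s y y = (y 0 - y 1) ^ 2 / 2 + (y 0 - y 2) ^ 2 / 2 +
      (s - 1 / 4) * (y 1 - y 2) ^ 2 := fun y => by rw [symForm_apply]; ring
  have h : ∀ a b : ℝ, (|a| - |b|) ^ 2 ≤ (a - b) ^ 2 := fun a b =>
    sq_le_sq.2 (abs_abs_sub_abs_le_abs_sub a b)
  rw [key, key]
  have := mul_le_mul_of_nonneg_left (h (x 1) (x 2)) (sub_nonneg.2 hs)
  linarith [h (x 0) (x 1), h (x 0) (x 2)]

/-- For s ≥ 1/4 all conductances are nonnegative, so passing to |g| does not raise the energy.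
Applied to the boundary values (0, 1, -1), whose trace is 4B, this yields (0, 1, 1), whose trace is
A. -/
lemma trcA_le (hr : rho < r) {s : ℝ} (hs : 1 / 4 ≤ s) : trcA r s ≤ 4 * trcB r s := by
  have hr0 := rho_pos.trans hr
  have hs0 : 0 < s := by linarith
  have hE := symForm_isEnergy hs0
  have h : trc r (symForm s) ![0, 1, 1] ≤ trc r (symForm s) ![0, 1, -1] := by
    refine le_trc hr hE fun g hg hf => ?_
    have hle : ∀ n, wlev r (symForm s) (fun n b => |g n b|) n ≤ wlev r (symForm s) g n := by
      intro n
      unfold wlev lev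
      refine mul_le_mul_of_nonneg_left (Finset.sum_le_sum fun b _ => ?_) (by positivity)
      have := symForm_abs_le hs (tri g n b)
      rwa [show tri (fun n b => |g n b|) n b = fun i => |tri g n b i| by
        ext i; fin_cases i <;> simp [tri]]
    have hf' : FiniteEnergy r (symForm s) (fun n b => |g n b|) :=
      Summable.of_nonneg_of_le (wlev_nonneg hr0 hE _) hle hf
    have h1 := trc_le hr0 hE hg.abs hf'
    have e : (fun i => |(![0, 1, -1] : Fin 3 → ℝ) i|) = ![0, 1, 1] := by
      ext i; fin_cases i <;> simp
    rw [e] at h1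
    exact h1.trans (Summable.tsum_le_tsum hle hf' hf)
  rw [trc_symForm hr hs0, trc_symForm hr hs0] at h
  simp at h
  linarith

lemma trcA_mono (hr : rho < r) {s t : ℝ} (hs : 0 < s) (h : s ≤ t) : trcA r s ≤ trcA r t := by
  have := trc_mono_form hr (symForm_isEnergy hs) (symForm_isEnergy (hs.trans_le h)) zero_le_one
    (fun x => by simpa using symForm_mono h x) ![1, 0, 0]
  simpa [trcA] using this

lemma trcA_lower (hr : rho < r) (hr1 : r < 1) {s : ℝ} (hs : 1 / 4 ≤ s) :
    (1 - r) / 2 ≤ trcA r s := by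
  have := trc_std_lower hr hr1 ![1, 0, 0]
  simp at this
  exact this.trans (trcA_mono hr (by norm_num) hs)

lemma en_symForm_affine (hr : 0 < r) {s t a b : ℝ} (hs : 0 < s) (ht : 0 < t) (hab : a + b = 1)
    (hf : FiniteEnergy r (symForm s) g) :
    en r (symForm (a * s + b * t)) g = a * en r (symForm s) g + b * en r (symForm t) g := by
  have hf' := hf.change hr (symForm_isEnergy ht) (symForm_isEnergy hs)
  unfold en
  rw [← tsum_mul_left, ← tsum_mul_left, ← (hf.mul_left a).tsum_add (hf'.mul_left b)]
  refine tsum_congr fun n => ?_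
  simp only [wlev, lev, Finset.mul_sum]
  rw [← Finset.sum_add_distrib]
  refine Finset.sum_congr rfl fun c _ => ?_
  obtain rfl : b = 1 - a := by linarith
  simp only [symForm_apply]; ring

/-- The energy of a fixed function is affine in s and its finiteness does not depend on s, so the
trace is an infimum of affine functions. Concavity is wanted for the continuity that it implies on
the open half-line. -/
lemma trc_symForm_concave (hr : rho < r) (u : Fin 3 → ℝ) :
    ConcaveOn ℝ (Ioi 0) fun s => trc r (symForm s) u := by
  have hr0 := rho_pos.trans hr
  refine ⟨convex_Ioi 0, fun s hs t ht a b ha hb hab => ?_⟩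
  have hst : 0 < a * s + b * t := (convex_Ioi (0 : ℝ)) hs ht ha hb hab
  refine le_trc hr (symForm_isEnergy hst) fun g hg hf => ?_
  have hf' := hf.change hr0 (symForm_isEnergy hs) (symForm_isEnergy hst)
  have hf'' := hf.change hr0 (symForm_isEnergy ht) (symForm_isEnergy hst)
  simp only [smul_eq_mul]
  rw [en_symForm_affine hr0 hs ht hab hf']
  exact add_le_add
    (mul_le_mul_of_nonneg_left (trc_le hr0 (symForm_isEnergy hs) hg hf') ha)
    (mul_le_mul_of_nonneg_left (trc_le hr0 (symForm_isEnergy ht) hg hf'') hb)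

lemma trc_symForm_continuousOn (hr : rho < r) (u : Fin 3 → ℝ) :
    ContinuousOn (fun s => trc r (symForm s) u) (Ioi 0) :=
  (trc_symForm_concave hr u).continuousOn isOpen_Ioi

/-- Functions that vanish on many levels have little horizontal energy, so `trcB` grows slowly. -/
lemma trcB_upper (hr : rho < r) {ε : ℝ} (hε : 0 < ε) :
    ∃ C, ∀ s > 0, trcB r s ≤ C + s * ε := by
  have hr0 := rho_pos.trans hr
  obtain ⟨G, hG, h0, h1, hs⟩ := exists_ramp (1 / 2) (-1 / 2)
  have hgeo : Summable fun n : ℕ => (rho / r) ^ n :=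
    summable_geometric_of_lt_one (by have := rho_pos; positivity) ((div_lt_one hr0).2 hr)
  obtain ⟨N, hN⟩ : ∃ N, ∑' n, (rho / r) ^ (n + N) < ε / (2 * rho ^ 2) := by
    have := tendsto_sum_nat_add (fun n : ℕ => (rho / r) ^ n)
    exact ((tendsto_order.1 this).2 _ (by have := rho_pos; positivity)).exists
  -- The parameter s enters only through differences between lower corners. For this function they
  -- vanish on the triangles of level below N, so the coefficient of s is a tail of ∑ (ρ/r)ⁿ.
  let g : ℕ → ℝ → ℝ := fun n b => if n ≤ N then 0 else G b
  have hgh : ∀ n > N, ∀ b ∈ stem n, g n b = G b := fun n hn b _ => by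
    simp [g, not_le.2 hn]
  have hg : Adm ![0, 1 / 2, -1 / 2] g := by
    have := adm_of_eventually_horiz hG hgh
    convert this using 1
    ext i; fin_cases i <;> simp [h0, h1, g]
  have hf : FiniteEnergy r stdForm g := fin_of_horiz hr stdForm_isEnergy hgh hs
  let β : ℕ → ℝ := fun n => (r ^ n)⁻¹ * ∑ b ∈ stem n, (tri g n b 1 - tri g n b 2) ^ 2
  have hβ0 : ∀ n, 0 ≤ β n := fun n =>
    mul_nonneg (by positivity) (Finset.sum_nonneg fun _ _ => sq_nonneg _)
  have hsplit : ∀ s n, wlev r (symForm s) g n = wlev r stdForm g n + (s - 1 / 4) * β n := by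
    intro s n
    simp only [wlev, lev, β, Finset.mul_sum]
    rw [← Finset.sum_add_distrib]
    refine Finset.sum_congr rfl fun b _ => ?_
    simp only [symForm_apply]; ring
  have hβN : ∀ n < N, β n = 0 := by
    intro n hn
    have h2 : n + 1 ≤ N := hn
    simp only [β, tri, g, h2, if_true, Matrix.cons_val_one, Matrix.cons_val]
    simp
  have hβle : ∀ n, N ≤ n → β n ≤ 2 * rho ^ 2 * (rho / r) ^ n := by
    intro n hn
    have h2 : ¬ n + 1 ≤ N := by omega
    have : ∑ b ∈ stem n, (tri g n b 1 - tri g n b 2) ^ 2 =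
        ∑ t ∈ stem n, (G (t + rho ^ (n + 2)) - G t) ^ 2 := by
      refine Finset.sum_congr rfl fun b _ => ?_
      simp [tri, g, h2]; ring
    simp only [β]
    rw [this]
    have h3 := mul_le_mul_of_nonneg_left (hs n) (by positivity : (0 : ℝ) ≤ (r ^ n)⁻¹)
    refine h3.trans (le_of_eq ?_)
    rw [div_pow, pow_add]; field_simp; norm_num
  have hβs : Summable β := by
    rw [← summable_nat_add_iff N]
    exact Summable.of_nonneg_of_le (fun n => hβ0 _) (fun n => hβle _ (by omega))
      (((summable_nat_add_iff N).2 hgeo).mul_left (2 * rho ^ 2))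
  have hβt : ∑' n, β n ≤ ε := by
    rw [← hβs.sum_add_tsum_nat_add N, Finset.sum_eq_zero fun n hn => hβN n (Finset.mem_range.1 hn),
      zero_add]
    refine (Summable.tsum_le_tsum (fun n => hβle (n + N) (by omega))
      ((summable_nat_add_iff N).2 hβs)
      (((summable_nat_add_iff N).2 hgeo).mul_left (2 * rho ^ 2))).trans ?_
    rw [tsum_mul_left]
    have hp : 0 < 2 * rho ^ 2 := by have := rho_pos; positivity
    rw [lt_div_iff₀ hp] at hN
    linarith
  refine ⟨en r stdForm g, fun s hs => ?_⟩
  have hfs := hf.change hr0 (symForm_isEnergy hs) stdForm_isEnergy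
  refine (trc_le hr0 (symForm_isEnergy hs) hg hfs).trans ?_
  have e : en r (symForm s) g = en r stdForm g + (s - 1 / 4) * ∑' n, β n := by
    unfold en
    rw [← tsum_mul_left, ← hf.tsum_add (hβs.mul_left _)]
    exact tsum_congr (hsplit s)
  rw [e]
  have : 0 ≤ ∑' n, β n := tsum_nonneg hβ0
  nlinarith

/-- The renormalization map has a symmetric eigenform. -/
lemma exists_eigenform (hr : rho < r) (hr1 : r < 1) :
    ∃ s ≥ 1 / 4, ∀ u, trc r (symForm s) u = trcA r s * symForm s u u := by
  have hA0 : 0 < (1 - r) / 2 := by linarith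
  obtain ⟨C, hC⟩ := trcB_upper hr (ε := (1 - r) / 4) (by linarith)
  -- The coefficients of `symForm s` in the even and odd directions are 1 and s, so a zero of φ is
  -- exactly an eigenform, with eigenvalue `trcA r s`.
  let φ : ℝ → ℝ := fun s => trcB r s - s * trcA r s
  -- Chosen so that T (1 - r)/4 ≥ C; then B(T) ≤ C + T (1 - r)/4 ≤ T (1 - r)/2 ≤ T A(T).
  let T : ℝ := 1 / 4 + |C| * 4 / (1 - r)
  have hT : 1 / 4 ≤ T := by
    have : 0 ≤ |C| * 4 / (1 - r) := div_nonneg (by positivity) (by linarith)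
    simp only [T]; linarith
  have hφc : ContinuousOn φ (Icc (1 / 4) T) := by
    have hsub : Icc (1 / 4) T ⊆ Ioi (0 : ℝ) := fun x hx => by
      have := hx.1; simp only [mem_Ioi]; linarith
    exact ((trc_symForm_continuousOn hr _).mono hsub).sub
      (continuousOn_id.mul ((trc_symForm_continuousOn hr _).mono hsub))
  have h1 : 0 ≤ φ (1 / 4) := by
    have := trcA_le hr (le_refl (1 / 4 : ℝ))
    simp only [φ]; linarith
  have h2 : φ T ≤ 0 := by
    have h3 := hC T (by linarith)
    have h4 := mul_le_mul_of_nonneg_left (trcA_lower hr hr1 hT) (by linarith : (0 : ℝ) ≤ T)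
    have h5 : T * ((1 - r) / 4) = (1 - r) / 16 + |C| := by
      have : 1 - r ≠ 0 := by linarith
      simp only [T]; field_simp; ring
    have h6 := le_abs_self C
    simp only [φ]; linarith
  obtain ⟨s, hs, hφ⟩ := intermediate_value_Icc' hT hφc ⟨h2, h1⟩
  refine ⟨s, hs.1, fun u => ?_⟩
  have hs0 : 0 < s := by linarith [hs.1]
  have hB : trcB r s = s * trcA r s := sub_eq_zero.1 hφ
  rw [trc_symForm hr hs0, hB, symForm_apply]; ring

end

/-- The symmetric forms with nonnegative conductances are resistance forms. -/
lemma symForm_mem {s : ℝ} (hs : 1 / 4 ≤ s) : symForm s ∈ symmetricForms := by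
  have hE := symForm_isEnergy (show 0 < s by linarith)
  refine ⟨?_, ?_⟩
  · refine ⟨fun _ => trivial, fun f g => hE.symm _ _, fun f => hE.nonneg _,
      fun f => hE.zero_iff _, ?_, fun V u => ⟨⟨u, trivial⟩, fun _ _ => rfl⟩, ?_, ?_⟩
    · intro u hu
      obtain ⟨K, hK, hle⟩ := hE.exists_ge
      obtain ⟨K', hK', hle'⟩ := hE.exists_le
      let v : ℕ → Fin 3 → ℝ := fun n => (u n : Fin 3 → ℝ)
      have hu' : ∀ ε > 0, ∃ N, ∀ m ≥ N, ∀ n ≥ N, symForm s (v m - v n) (v m - v n) < ε := hu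
      have hcau : ∀ i : Fin 3, ∃ l, Filter.Tendsto (fun n => v n 0 - v n i) Filter.atTop
          (nhds l) := by
        intro i
        refine cauchySeq_tendsto_of_complete (Metric.cauchySeq_iff.2 fun ε hε => ?_)
        obtain ⟨N, hN⟩ := hu' (ε ^ 2 / (2 * K)) (by positivity)
        refine ⟨N, fun m hm n hn => ?_⟩
        have h1 := hN m hm n hn
        rw [lt_div_iff₀ (by positivity)] at h1
        have h2 := hle (v m - v n)
        rw [stdForm_apply] at h2
        simp only [Pi.sub_apply] at h2
        rw [Real.dist_eq]
        refine abs_lt_of_sq_lt_sq ?_ hε.le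
        fin_cases i
        · simp; positivity
        · simp only [Fin.mk_one]
          nlinarith [sq_nonneg (v m 0 - v n 0 - (v m 2 - v n 2))]
        · simp only [Fin.reduceFinMk]
          nlinarith [sq_nonneg (v m 0 - v n 0 - (v m 1 - v n 1))]
      choose l hl using hcau
      -- A Cauchy sequence for the form converges only modulo constants; the limit is normalized to
      -- vanish at the vertex 0.
      refine ⟨⟨fun i => -l i, trivial⟩, ?_⟩
      change Filter.Tendsto (fun n => symForm s (v n - fun i => -l i) (v n - fun i => -l i)) _ _
      have hl0 : l 0 = 0 := tendsto_nhds_unique (hl 0) (by simp)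
      have hz : Filter.Tendsto (fun n => K' * (((v n 0 - v n 1 - l 1) ^ 2 +
          (v n 0 - v n 2 - l 2) ^ 2) / 2)) Filter.atTop (nhds 0) := by
        have h1 := ((hl 1).sub_const (l 1)).pow 2
        have h2 := ((hl 2).sub_const (l 2)).pow 2
        have := (((h1.add h2).div_const 2).const_mul K')
        simpa using this
      refine squeeze_zero (fun n => hE.nonneg _) (fun n => (hle' _).trans (le_of_eq ?_)) hz
      rw [stdForm_apply]
      simp only [Pi.sub_apply, hl0]
      ring
    · intro x y _
      obtain ⟨K, hK, hle⟩ := hE.exists_ge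
      refine ⟨4 * K, ?_⟩
      rintro t ⟨f, hf, rfl⟩
      have hf' : 0 < symForm s f f := hf
      change |(f : Fin 3 → ℝ) x - (f : Fin 3 → ℝ) y| ^ 2 / symForm s f f ≤ _
      rw [div_le_iff₀ hf', sq_abs]
      have h2 := hle f
      rw [stdForm_apply] at h2
      generalize (f : Fin 3 → ℝ) = v at *
      have h3 := sq_nonneg (v 0 - v 1)
      have h4 := sq_nonneg (v 0 - v 2)
      have h5 := sq_nonneg (v 0 - v 1 + (v 0 - v 2))
      fin_cases x <;> fin_cases y <;> simp <;> nlinarith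
    · intro f
      refine ⟨⟨fun x => min (max ((f : Fin 3 → ℝ) x) 0) 1, trivial⟩, rfl, ?_⟩
      change symForm s (fun x => min (max ((f : Fin 3 → ℝ) x) 0) 1)
        (fun x => min (max ((f : Fin 3 → ℝ) x) 0) 1) ≤ symForm s f f
      generalize (f : Fin 3 → ℝ) = v
      have key : ∀ y : Fin 3 → ℝ, symForm s y y = (y 0 - y 1) ^ 2 / 2 + (y 0 - y 2) ^ 2 / 2 +
          (s - 1 / 4) * (y 1 - y 2) ^ 2 := fun y => by rw [symForm_apply]; ring
      have h : ∀ a b : ℝ, (min (max a 0) 1 - min (max b 0) 1) ^ 2 ≤ (a - b) ^ 2 := by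
        intro a b
        refine sq_le_sq.2 ?_
        exact (abs_min_sub_min_le_max _ _ _ _).trans (by
          simpa using abs_max_sub_max_le_abs a b 0)
      rw [key, key]
      have := mul_le_mul_of_nonneg_left (h (v 1) (v 2)) (sub_nonneg.2 hs)
      linarith [h (v 0) (v 1), h (v 0) (v 2)]
  · simp [conductance, symForm_apply]

/-! Comparison principle. -/

section

variable {r c c' : ℝ} {D D' : Form}

/-- With D ≤ M D' and equality at u, monotonicity of the trace gives c D(u) ≤ M c' D'(u) = c' D(u),
and D(u) > 0. Only an upper bound on the trace of D' is needed, so the lemma also serves for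
perturbed parameters. -/
lemma eigenvalue_le (hr : rho < r) (hD : IsEnergy D) (hD' : IsEnergy D')
    (h : ∀ u, trc r D u = c * D u u) (h' : ∀ u, trc r D' u ≤ c' * D' u u) : c ≤ c' := by
  obtain ⟨M, hM, hle, u, hu, heq⟩ := exists_best_bound hD hD'
  have h1 := trc_mono_form hr hD hD' hM.le hle u
  have h2 := mul_le_mul_of_nonneg_left (h' u) hM.le
  have h3 := hD.pos hu
  rw [h u] at h1
  have h4 : c * D u u ≤ c' * D u u := by rw [heq] at h1 ⊢; linarith
  exact le_of_mul_le_mul_right h4 h3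

lemma le_eigenvalue (hr : rho < r) (hD : IsEnergy D) (hD' : IsEnergy D')
    (h : ∀ u, trc r D u = c * D u u) (h' : ∀ u, c' * D' u u ≤ trc r D' u) : c' ≤ c := by
  obtain ⟨M, hM, hle, u, hu, heq⟩ := exists_best_bound hD' hD
  have h1 := trc_mono_form hr hD' hD hM.le hle u
  rw [h u] at h1
  have h3 := hD'.pos hu
  have h4 : c' * D' u u ≤ c * D' u u := by
    have := h' u
    rw [heq] at this ⊢; linarith
  exact le_of_mul_le_mul_right h4 h3

end

end GoldenGasket

/-! ### Continuity of the trace in the parameter: Hardy inequality and truncation. -/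

namespace GoldenGasket

/-- A discrete Hardy inequality. The bound of `ray_bound` on each separate term is not summable in
N; summability is what allows a cutoff level to be chosen by averaging. -/
lemma hardy_bound {r : ℝ} (hr : 0 < r) (hr1 : r < 1) {a w : ℕ → ℝ} {l : ℝ} (hw : ∀ n, 0 ≤ w n)
    (hs : Summable w) (h : ∀ n, (a n - a (n + 1)) ^ 2 ≤ r ^ n * w n)
    (hl : Filter.Tendsto a Filter.atTop (nhds l)) (M : ℕ) :
    ∑ N ∈ Finset.range M, (r ^ N)⁻¹ * (a N - l) ^ 2 ≤ 6 / (1 - r) ^ 2 * ∑' n, w n := by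
  have h1 : 0 < 1 - r := by linarith
  set E := ∑' n, w n with hE
  have hE0 : 0 ≤ E := tsum_nonneg hw
  let A : ℕ → ℝ := fun N => (r ^ N)⁻¹ * (a N - l) ^ 2
  have hA0 : ∀ N, 0 ≤ A N := fun N => by simp only [A]; positivity
  have hAE : ∀ N, A N ≤ E / (1 - r) := by
    intro N
    have h2 := ray_bound hr hr1 hw hs h hl N
    have h3 : ∑' j, w (j + N) ≤ E := by
      rw [hE, ← hs.sum_add_tsum_nat_add N]
      linarith [Finset.sum_nonneg fun (i : ℕ) (_ : i ∈ Finset.range N) => hw i]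
    have h4 : (a N - l) ^ 2 ≤ r ^ N / (1 - r) * E :=
      h2.trans (mul_le_mul_of_nonneg_left h3 (by positivity))
    simp only [A]
    calc (r ^ N)⁻¹ * (a N - l) ^ 2 ≤ (r ^ N)⁻¹ * (r ^ N / (1 - r) * E) :=
          mul_le_mul_of_nonneg_left h4 (by positivity)
      _ = _ := by field_simp
  -- Young's inequality with 1 + η = (1 + r)/(2r) and 1 + 1/η = (1 + r)/(1 - r). The weight r^(-N)
  -- turns the first factor into (1 + r)/2 < 1, so after summation that term is absorbed on the
  -- left.
  have hrec : ∀ N, A N ≤ (1 + r) / 2 * A (N + 1) + (1 + r) / (1 - r) * w N := by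
    intro N
    have key : (a N - l) ^ 2 ≤ (1 + r) / (2 * r) * (a (N + 1) - l) ^ 2 +
        (1 + r) / (1 - r) * (a N - a (N + 1)) ^ 2 := by
      have e : (1 + r) / (2 * r) * (a (N + 1) - l) ^ 2 +
          (1 + r) / (1 - r) * (a N - a (N + 1)) ^ 2 - (a N - l) ^ 2 =
          ((1 - r) * (a (N + 1) - l) - 2 * r * (a N - a (N + 1))) ^ 2 / (2 * r * (1 - r)) := by
        field_simp; ring
      have : 0 ≤ ((1 - r) * (a (N + 1) - l) - 2 * r * (a N - a (N + 1))) ^ 2 /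
          (2 * r * (1 - r)) := by positivity
      linarith
    have h2 : (1 + r) / (1 - r) * (a N - a (N + 1)) ^ 2 ≤ (1 + r) / (1 - r) * (r ^ N * w N) :=
      mul_le_mul_of_nonneg_left (h N) (by positivity)
    have h3 := mul_le_mul_of_nonneg_left (key.trans (add_le_add le_rfl h2))
      (by positivity : (0 : ℝ) ≤ (r ^ N)⁻¹)
    refine h3.trans (le_of_eq ?_)
    simp only [A]
    rw [pow_succ]; field_simp; ring
  have hsum : ∑ N ∈ Finset.range M, A N ≤
      (1 + r) / 2 * ∑ N ∈ Finset.range M, A (N + 1) +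
        (1 + r) / (1 - r) * ∑ N ∈ Finset.range M, w N := by
    rw [Finset.mul_sum, Finset.mul_sum, ← Finset.sum_add_distrib]
    exact Finset.sum_le_sum fun N _ => hrec N
  have hshift : ∑ N ∈ Finset.range M, A (N + 1) ≤ ∑ N ∈ Finset.range M, A N + E / (1 - r) := by
    have e1 := Finset.sum_range_succ A M
    have e2 := Finset.sum_range_succ' A M
    linarith [hA0 0, hAE M]
  have hwE : ∑ N ∈ Finset.range M, w N ≤ E := hs.sum_le_tsum _ fun n _ => hw n
  set S := ∑ N ∈ Finset.range M, A N with hS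
  have h5 : S ≤ (1 + r) / 2 * (S + E / (1 - r)) + (1 + r) / (1 - r) * E := by
    refine hsum.trans (add_le_add (mul_le_mul_of_nonneg_left hshift (by positivity))
      (mul_le_mul_of_nonneg_left hwE (by positivity)))
  have h6 : S * (1 - r) / 2 ≤ 3 * (E / (1 - r)) := by
    have e3 : (1 + r) / (1 - r) * E = (1 + r) * (E / (1 - r)) := by ring
    rw [e3] at h5
    have : 0 ≤ E / (1 - r) := by positivity
    nlinarith
  have h7 : S ≤ 6 / (1 - r) ^ 2 * E := by
    have e4 : 6 / (1 - r) ^ 2 * E = (3 * (E / (1 - r))) / ((1 - r) / 2) := by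
      field_simp; ring
    rw [e4, le_div_iff₀ (by positivity)]
    linarith
  exact h7

lemma sum_shift_ite_le {f : ℝ → ℝ} (hf : ∀ x, 0 ≤ f x) (B T : Finset ℝ) (c : ℝ) :
    ∑ x ∈ B, (if x + c ∈ T then f (x + c) else 0) ≤ ∑ x ∈ T, f x := by
  rw [← Finset.sum_image (f := fun y => if y ∈ T then f y else 0) (g := fun x => x + c)
    (fun x _ y _ h => by simpa using h), Finset.sum_ite_mem]
  exact Finset.sum_le_sum_of_subset_of_nonneg Finset.inter_subset_right fun x _ _ => hf x

/-- The quantity controlling the interpolation of `g` at level `m + 1`. -/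
def interpCost (u : Fin 3 → ℝ) (g : ℕ → ℝ → ℝ) (m : ℕ) : ℝ :=
  lev stdForm g m + lev stdForm g (m + 1) + (g (m + 1) 0 - u 1) ^ 2 +
    (g (m + 1) (1 - rho ^ (m + 1)) - u 2) ^ 2

/-- Interpolation of the values of level `m + 1` with small energy. -/
lemma exists_level_interpolant (u : Fin 3 → ℝ) (g : ℕ → ℝ → ℝ) (m : ℕ) :
    ∃ G : ℝ → ℝ, Continuous G ∧ G 0 = u 1 ∧ G 1 = u 2 ∧
      (∀ x ∈ stem (m + 1), x ≠ 0 → G x = g (m + 1) x) ∧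
      ∀ n, ∑ t ∈ stem n, (G (t + rho ^ (n + 2)) - G t) ^ 2 ≤
        rho ^ (n + 2) * ((rho ^ (m + 3))⁻¹ * (16 * interpCost u g m)) := by
  have p1 := rho_pow_pos (m + 1)
  have p2 := rho_pow_pos (m + 2)
  have p3 := rho_pow_pos (m + 3)
  have p4 := rho_pow_pos (m + 4)
  have r1 : rho ^ (m + 3) = rho ^ (m + 1) - rho ^ (m + 2) := rho_pow_add_two (m + 1)
  have r2 : rho ^ (m + 4) = rho ^ (m + 2) - rho ^ (m + 3) := rho_pow_add_two (m + 2)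
  have hP := inv_pos.2 p3
  have one_notMem : (1 : ℝ) ∉ stem (m + 1) := fun h => by linarith [stem_le h]
  -- The interpolant has to take the boundary values at 0 and 1. The offset 0 occurs on level m + 1,
  -- where the value of g is overridden; the offset 1 does not occur and is added as a node.
  let f : ℝ → ℝ := fun x => if x = 0 then u 1 else if x = 1 then u 2 else g (m + 1) x
  let τ : ℕ → ℝ → ℝ := fun n x => if x ∈ stem n then stdForm (tri g n x) (tri g n x) else 0
  have hτ0 : ∀ n x, 0 ≤ τ n x := by
    intro n x
    simp only [τ]; split_ifs
    · exact stdForm_isEnergy.nonneg _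
    · exact le_rfl
  let a := (g (m + 1) 0 - u 1) ^ 2
  let a' := (g (m + 1) (1 - rho ^ (m + 1)) - u 2) ^ 2
  have ha : 0 ≤ a := sq_nonneg _
  have ha' : 0 ≤ a' := sq_nonneg _
  -- The factors 4 of `hgap` are doubled to allow for the overridden value at 0, through (p + q)² ≤
  -- 2p² + 2q². Summing over the nodes gives at most 8, 16, 2 and 1 times the four terms of
  -- `interpCost`, whence the constant 16.
  let e0 : ℝ → ℝ := fun x => 8 * τ m x + 8 * τ (m + 1) x + 8 * τ (m + 1) (x + rho ^ (m + 3)) +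
    (if x = 0 then 2 * a else 0) + (if x = 1 - rho ^ (m + 1) then a' else 0)
  have he0 : ∀ x, 0 ≤ e0 x := by
    intro x
    have h1 := hτ0 m x
    have h2 := hτ0 (m + 1) x
    have h3 := hτ0 (m + 1) (x + rho ^ (m + 3))
    have h4 : 0 ≤ (if x = 0 then 2 * a else 0) := by split_ifs <;> positivity
    have h5 : 0 ≤ (if x = 1 - rho ^ (m + 1) then a' else 0) := by split_ifs <;> positivity
    simp only [e0]; linarith
  -- By `consec_stem` two consecutive vertices are joined by a path of two edges: through the common
  -- parent on level m, or through the common child on level m + 2.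
  have hgap : ∀ x y, Consec (stem (m + 1)) x y →
      (g (m + 1) y - g (m + 1) x) ^ 2 ≤
        4 * τ m x + 4 * τ (m + 1) x + 4 * τ (m + 1) (x + rho ^ (m + 3)) := by
    intro x y hxy
    have h1 := hτ0 m x
    have h2 := hτ0 (m + 1) x
    have h3 := hτ0 (m + 1) (x + rho ^ (m + 3))
    rcases consec_stem hxy with ⟨hx, rfl⟩ | rfl
    · have : τ m x = stdForm (tri g m x) (tri g m x) := by simp [τ, hx]
      rw [stdForm_apply] at this
      simp only [tri, Matrix.cons_val_zero, Matrix.cons_val_one, Matrix.cons_val] at this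
      nlinarith [sq_nonneg (g m x - g (m + 1) x + (g m x - g (m + 1) (x + rho ^ (m + 2))))]
    · have t1 : τ (m + 1) x = stdForm (tri g (m + 1) x) (tri g (m + 1) x) := by
        simp [τ, hxy.1]
      have t2 : τ (m + 1) (x + rho ^ (m + 3)) = stdForm (tri g (m + 1) (x + rho ^ (m + 3)))
        (tri g (m + 1) (x + rho ^ (m + 3))) := by simp [τ, hxy.2.1]
      have l1 := std_right_le (tri g (m + 1) x)
      have l2 := std_left_le (tri g (m + 1) (x + rho ^ (m + 3)))
      rw [← t1] at l1
      rw [← t2] at l2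
      simp only [tri, Matrix.cons_val_zero, Matrix.cons_val_one, Matrix.cons_val] at l1 l2
      have e1 : rho ^ (m + 1 + 2) = rho ^ (m + 3) := rfl
      rw [e1] at l1
      nlinarith [sq_nonneg (g (m + 1) x - g (m + 1 + 1) (x + rho ^ (m + 3)) +
        (g (m + 1) (x + rho ^ (m + 3)) - g (m + 1 + 1) (x + rho ^ (m + 3))))]
  have hcons : ∀ x y, Consec (insert 1 (stem (m + 1))) x y →
      (f y - f x) ^ 2 ≤ (y - x) * ((rho ^ (m + 3))⁻¹ * e0 x) := by
    rintro x y ⟨hx, hy, hxy, hc⟩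
    have hx1 : x ∈ stem (m + 1) := by
      rcases Finset.mem_insert.1 hx with rfl | h
      · rcases Finset.mem_insert.1 hy with rfl | h'
        · exact absurd hxy (lt_irrefl _)
        · linarith [stem_le h']
      · exact h
    have hx0 := stem_nonneg hx1
    have hxne : x ≠ 1 := fun h => one_notMem (h ▸ hx1)
    have hmain : rho ^ (m + 3) ≤ y - x ∧ (f y - f x) ^ 2 ≤ e0 x := by
      have t1 := hτ0 m x
      have t2 := hτ0 (m + 1) x
      have t3 := hτ0 (m + 1) (x + rho ^ (m + 3))
      rcases Finset.mem_insert.1 hy with rfl | hy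
      · have hxm : x = 1 - rho ^ (m + 1) := by
          rcases hc _ (Finset.mem_insert_of_mem (last_mem_stem (m + 1))) with h | h
          · linarith [stem_le hx1]
          · linarith
        have hxn : x ≠ 0 := by
          have : rho ^ (m + 1) < 1 := pow_lt_one₀ rho_pos.le rho_lt_one (by omega)
          intro h; linarith
        refine ⟨by linarith, ?_⟩
        have : f 1 - f x = -(g (m + 1) (1 - rho ^ (m + 1)) - u 2) := by
          simp only [f, if_true, if_false, one_ne_zero, hxm]
          have h1 : 1 - rho ^ (m + 1) ≠ 0 := hxm ▸ hxn
          have h2 : 1 - rho ^ (m + 1) ≠ 1 := hxm ▸ hxne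
          simp only [h1, h2, if_false]; ring
        rw [this, neg_sq]
        simp only [e0, hxn, if_false, if_pos hxm]
        have : a' = (g (m + 1) (1 - rho ^ (m + 1)) - u 2) ^ 2 := rfl
        linarith
      · have hxy' : Consec (stem (m + 1)) x y :=
          ⟨hx1, hy, hxy, fun z hz => hc z (Finset.mem_insert_of_mem hz)⟩
        refine ⟨by linarith [stem_sep hx1 hy hxy, show rho ^ (m + 1 + 2) = rho ^ (m + 3) from rfl],
          ?_⟩
        have hy0 : y ≠ 0 := by linarith
        have hy1 : y ≠ 1 := fun h => one_notMem (h ▸ hy)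
        have hg := hgap x y hxy'
        have h5 : 0 ≤ (if x = 1 - rho ^ (m + 1) then a' else 0) := by split_ifs <;> positivity
        by_cases hxz : x = 0
        · have e1 : f y - f x = (g (m + 1) y - g (m + 1) x) + (g (m + 1) 0 - u 1) := by
            simp only [f, hy0, hy1, hxz, if_true, if_false]; ring
          rw [e1]
          simp only [e0, if_pos hxz]
          have : a = (g (m + 1) 0 - u 1) ^ 2 := rfl
          nlinarith [sq_nonneg ((g (m + 1) y - g (m + 1) x) - (g (m + 1) 0 - u 1))]
        · have e1 : f y - f x = g (m + 1) y - g (m + 1) x := by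
            simp only [f, hy0, hy1, hxz, hxne, if_false]
          rw [e1]
          simp only [e0, if_neg hxz]
          linarith
    have h1 : 1 ≤ (y - x) * (rho ^ (m + 3))⁻¹ := by
      rw [← div_eq_mul_inv, le_div_iff₀ p3]; linarith [hmain.1]
    calc (f y - f x) ^ 2 ≤ 1 * e0 x := by linarith [hmain.2]
      _ ≤ ((y - x) * (rho ^ (m + 3))⁻¹) * e0 x := mul_le_mul_of_nonneg_right h1 (he0 x)
      _ = _ := by ring
  obtain ⟨G, H, hG, hH, hGf, hGH, hH0, hHm, -⟩ := exists_interpolant (insert 1 (stem (m + 1))) f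
    (fun x => (rho ^ (m + 3))⁻¹ * e0 x) (fun x => mul_nonneg hP.le (he0 x)) hcons
  have htot : ∑ z ∈ insert 1 (stem (m + 1)), (rho ^ (m + 3))⁻¹ * e0 z ≤
      (rho ^ (m + 3))⁻¹ * (16 * interpCost u g m) := by
    rw [← Finset.mul_sum]
    refine mul_le_mul_of_nonneg_left ?_ hP.le
    simp only [e0, Finset.sum_add_distrib, ← Finset.mul_sum]
    have s1 := sum_shift_ite_le (f := fun x => stdForm (tri g m x) (tri g m x))
      (fun x => stdForm_isEnergy.nonneg _) (insert 1 (stem (m + 1))) (stem m) 0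
    have s2 := sum_shift_ite_le (f := fun x => stdForm (tri g (m + 1) x) (tri g (m + 1) x))
      (fun x => stdForm_isEnergy.nonneg _) (insert 1 (stem (m + 1))) (stem (m + 1)) 0
    have s3 := sum_shift_ite_le (f := fun x => stdForm (tri g (m + 1) x) (tri g (m + 1) x))
      (fun x => stdForm_isEnergy.nonneg _) (insert 1 (stem (m + 1))) (stem (m + 1))
      (rho ^ (m + 3))
    simp only [add_zero] at s1 s2
    have s4 : ∑ x ∈ insert 1 (stem (m + 1)), (if x = 0 then 2 * a else 0) ≤ 2 * a := by
      rw [Finset.sum_ite_eq']; split_ifs <;> linarith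
    have s5 : ∑ x ∈ insert 1 (stem (m + 1)), (if x = 1 - rho ^ (m + 1) then a' else 0) ≤ a' := by
      rw [Finset.sum_ite_eq']; split_ifs <;> linarith
    have hl : 0 ≤ lev stdForm g m := lev_nonneg stdForm_isEnergy g m
    have e1 : interpCost u g m = lev stdForm g m + lev stdForm g (m + 1) + a + a' := rfl
    rw [e1]
    have d1 : ∑ x ∈ stem m, stdForm (tri g m x) (tri g m x) = lev stdForm g m := rfl
    have d2 : ∑ x ∈ stem (m + 1), stdForm (tri g (m + 1) x) (tri g (m + 1) x) =
      lev stdForm g (m + 1) := rfl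
    rw [d1] at s1
    rw [d2] at s2 s3
    simp only [τ]
    linarith
  refine ⟨G, hG, ?_, ?_, ?_, fun n => ?_⟩
  · rw [hGf 0 (Finset.mem_insert_of_mem (zero_mem_stem _))]; simp [f]
  · rw [hGf 1 (Finset.mem_insert_self _ _)]; simp [f]
  · intro x hx hx0
    rw [hGf x (Finset.mem_insert_of_mem hx)]
    have : x ≠ 1 := fun h => one_notMem (h ▸ hx)
    simp [f, hx0, this]
  · have := sum_sq_le_of_interpolant hH hGH hH0 (fun x => (hHm x).trans htot) n
    rwa [sub_zero] at this

lemma interpCost_nonneg (u : Fin 3 → ℝ) (g : ℕ → ℝ → ℝ) (m : ℕ) : 0 ≤ interpCost u g m := by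
  have h1 := lev_nonneg stdForm_isEnergy g m
  have h2 := lev_nonneg stdForm_isEnergy g (m + 1)
  unfold interpCost; positivity

/-- Replacing a function below level `m + 1` by an interpolation of its values at this level. -/
lemma exists_truncation {u : Fin 3 → ℝ} {g : ℕ → ℝ → ℝ} (hg : Adm u g) (m : ℕ) :
    ∃ k, Adm u k ∧ (∀ n < m + 1, ∀ D, lev D k n = lev D g n) ∧
      ∀ j, lev stdForm k (j + (m + 1)) ≤ 18 * interpCost u g m * rho ^ j := by
  obtain ⟨G, hG, h0, h1, hGg, hs⟩ := exists_level_interpolant u g m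
  have hX := interpCost_nonneg u g m
  have p3 := rho_pow_pos (m + 3)
  -- Level m + 1 keeps the values of g, so no triangle of level at most m changes. Every lower level
  -- follows the interpolant.
  let k : ℕ → ℝ → ℝ := fun n b => if n ≤ m + 1 then g n b else G b
  have hkh : ∀ n > m + 1, ∀ b ∈ stem n, k n b = G b := fun n hn b _ => by
    simp only [k, if_neg (not_le.2 hn)]
  refine ⟨k, ?_, ?_, ?_⟩
  · have := adm_of_eventually_horiz hG hkh
    convert this using 1
    ext i; fin_cases i
    · simp [k, hg.root]
    · simp [h0]
    · simp [h1]
  · intro n hn D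
    refine Finset.sum_congr rfl fun b _ => ?_
    have e1 : n ≤ m + 1 := hn.le
    have e2 : n + 1 ≤ m + 1 := hn
    have : tri k n b = tri g n b := by simp only [tri, k, e1, e2, if_true]
    rw [this]
  · intro j
    have hsj := hs (j + (m + 1))
    have e : rho ^ (j + (m + 1) + 2) * ((rho ^ (m + 3))⁻¹ * (16 * interpCost u g m)) =
        16 * interpCost u g m * rho ^ j := by
      rw [show j + (m + 1) + 2 = j + (m + 3) by ring, pow_add]; field_simp
    rw [e] at hsj
    have pj := rho_pow_pos j
    rcases Nat.eq_zero_or_pos j with rfl | hj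
    -- On the transition level g and the interpolant disagree only at offset 0. This costs one extra
    -- term 2 (g - u 1)², which raises 16 to 18.
    · simp only [zero_add, pow_zero, mul_one] at hsj ⊢
      have hle : ∀ t ∈ stem (m + 1), stdForm (tri k (m + 1) t) (tri k (m + 1) t) ≤
          (if t = 0 then 2 * (g (m + 1) 0 - u 1) ^ 2 else 0) +
            (G (t + rho ^ (m + 1 + 2)) - G t) ^ 2 := by
        intro t ht
        have e2 : ¬ m + 1 + 1 ≤ m + 1 := by omega
        rw [stdForm_apply]
        simp only [tri, k, le_refl, if_true, e2, if_false, Matrix.cons_val_zero,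
          Matrix.cons_val_one, Matrix.cons_val]
        split_ifs with h
        · rw [h, h0]
          nlinarith [sq_nonneg ((g (m + 1) 0 - u 1) + (G (0 + rho ^ (m + 1 + 2)) - u 1)),
            sq_nonneg (g (m + 1) 0 - u 1)]
        · rw [hGg t ht h]
          nlinarith [sq_nonneg (g (m + 1) t - G (t + rho ^ (m + 1 + 2)))]
      refine (Finset.sum_le_sum hle).trans ?_
      rw [Finset.sum_add_distrib, Finset.sum_ite_eq', if_pos (zero_mem_stem _)]
      have h2 := lev_nonneg stdForm_isEnergy g m
      have h3 := lev_nonneg stdForm_isEnergy g (m + 1)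
      have h4 : (g (m + 1) 0 - u 1) ^ 2 ≤ interpCost u g m := by
        unfold interpCost; nlinarith [sq_nonneg (g (m + 1) (1 - rho ^ (m + 1)) - u 2)]
      linarith
    · rw [lev_std_of_horiz (hkh _ (by omega)) (hkh _ (by omega))]
      have : 0 ≤ interpCost u g m * rho ^ j := by positivity
      linarith

/-- The two level energies in the cost sum to at most three times the energy, because r⁻¹ ≤ 2, and
each of the boundary errors is summed by the Hardy inequality. -/
lemma sum_interpCost_le {r : ℝ} (hr : rho < r) (hr1 : r < 1) {u : Fin 3 → ℝ} {g : ℕ → ℝ → ℝ}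
    (hg : Adm u g) (hf : FiniteEnergy r stdForm g) (M : ℕ) :
    ∑ m ∈ Finset.range M, (r ^ (m + 1))⁻¹ * interpCost u g m ≤
      (3 + 24 / (1 - r) ^ 2) * en r stdForm g := by
  have hr0 := rho_pos.trans hr
  have hw := wlev_nonneg hr0 stdForm_isEnergy g
  have hl := hardy_bound hr0 hr1 (a := fun n => g n 0) (w := fun n => 2 * wlev r stdForm g n)
    (fun n => by linarith [hw n]) (hf.mul_left 2) (fun n => by
      have := left_edge_le g n
      rw [lev_eq_wlev hr0] at this
      linarith) hg.tendsto_left (M + 1)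
  have hrr := hardy_bound hr0 hr1 (a := fun n => g n (1 - rho ^ n))
    (w := fun n => 2 * wlev r stdForm g n)
    (fun n => by linarith [hw n]) (hf.mul_left 2) (fun n => by
      have := right_edge_le g n
      rw [lev_eq_wlev hr0] at this
      linarith) hg.tendsto_right (M + 1)
  rw [tsum_mul_left] at hl hrr
  rw [Finset.sum_range_succ'] at hl hrr
  have hz : (0 : ℝ) ≤ (r ^ 0)⁻¹ * (g 0 0 - u 1) ^ 2 := by positivity
  have hz' : (0 : ℝ) ≤ (r ^ 0)⁻¹ * (g 0 (1 - rho ^ 0) - u 2) ^ 2 := by positivity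
  have h1 : ∑ m ∈ Finset.range M, wlev r stdForm g m ≤ en r stdForm g :=
    hf.sum_le_tsum _ fun n _ => hw n
  have h2 : ∑ m ∈ Finset.range M, wlev r stdForm g (m + 1) ≤ en r stdForm g := by
    have := hf.sum_le_tsum (Finset.range (M + 1)) fun n _ => hw n
    rw [Finset.sum_range_succ'] at this
    unfold en
    linarith [hw 0]
  have hri : r⁻¹ ≤ 2 := by
    rw [inv_le_comm₀ hr0 two_pos]; linarith [rho_gt]
  have hsum : ∑ m ∈ Finset.range M, (r ^ (m + 1))⁻¹ * interpCost u g m =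
      r⁻¹ * ∑ m ∈ Finset.range M, wlev r stdForm g m +
      ∑ m ∈ Finset.range M, wlev r stdForm g (m + 1) +
      ∑ m ∈ Finset.range M, (r ^ (m + 1))⁻¹ * (g (m + 1) 0 - u 1) ^ 2 +
      ∑ m ∈ Finset.range M, (r ^ (m + 1))⁻¹ * (g (m + 1) (1 - rho ^ (m + 1)) - u 2) ^ 2 := by
    rw [Finset.mul_sum, ← Finset.sum_add_distrib, ← Finset.sum_add_distrib,
      ← Finset.sum_add_distrib]
    refine Finset.sum_congr rfl fun m _ => ?_
    simp only [interpCost, wlev, pow_succ, mul_inv]; ring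
  rw [hsum]
  have hS0 : 0 ≤ ∑ m ∈ Finset.range M, wlev r stdForm g m := Finset.sum_nonneg fun n _ => hw n
  have h3 : r⁻¹ * ∑ m ∈ Finset.range M, wlev r stdForm g m ≤ 2 * en r stdForm g :=
    mul_le_mul hri h1 hS0 (by norm_num)
  have e1 : 6 / (1 - r) ^ 2 * (2 * ∑' n, wlev r stdForm g n) =
    12 / (1 - r) ^ 2 * en r stdForm g := by unfold en; ring
  rw [e1] at hl hrr
  have e2 : (3 + 24 / (1 - r) ^ 2) * en r stdForm g = 3 * en r stdForm g +
    12 / (1 - r) ^ 2 * en r stdForm g + 12 / (1 - r) ^ 2 * en r stdForm g := by ring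
  rw [e2]
  linarith

/-- Comparison of the traces for different parameters. -/
lemma trc_le_of_near {r r' : ℝ} (hr : rho < r) (hr1 : r < 1) (hr' : rho < r') {D : Form}
    (hD : IsEnergy D) {K K' : ℝ} (hK : 0 ≤ K) (h : ∀ x, D x x ≤ K * stdForm x x) (hK' : 0 ≤ K')
    (h' : ∀ x, stdForm x x ≤ K' * D x x) {M : ℕ} (hM : 0 < M) (u : Fin 3 → ℝ) :
    trc r' D u ≤ max 1 (r / r') ^ M *
      (1 + K * 18 * (3 + 24 / (1 - r) ^ 2) * K' / (1 - rho / r') / M) * trc r D u := by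
  have hr0 := rho_pos.trans hr
  have hr0' := rho_pos.trans hr'
  have hq0 : 0 ≤ rho / r' := by have := rho_pos; positivity
  have hq1 : rho / r' < 1 := (div_lt_one hr0').2 hr'
  have hq2 : 0 < 1 - rho / r' := by linarith
  set ω := max 1 (r / r') ^ M with hω
  have hω1 : 1 ≤ ω := one_le_pow₀ (le_max_left _ _)
  set C := K * 18 * (3 + 24 / (1 - r) ^ 2) * K' / (1 - rho / r') with hC
  have hC0 : 0 ≤ C := by positivity
  have hM0 : (0 : ℝ) < M := by exact_mod_cast hM
  have key : ∀ g, Adm u g → FiniteEnergy r D g → trc r' D u ≤ ω * (1 + C / M) * en r D g := by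
    intro g hg hf
    have hfs := hf.change hr0 stdForm_isEnergy hD
    have hX := interpCost_nonneg u g
    -- Among M levels one has cost at most a fraction 1/M of the total. Cutting there is essential
    -- when r' < r, since finite energy for r need not mean finite energy for r'.
    obtain ⟨m, hm, hmle⟩ : ∃ m ∈ Finset.range M, (r ^ (m + 1))⁻¹ * interpCost u g m ≤
        (3 + 24 / (1 - r) ^ 2) * en r stdForm g / M := by
      refine Finset.exists_le_of_sum_le ⟨0, by simpa using hM⟩ ?_
      rw [Finset.sum_const, Finset.card_range, nsmul_eq_mul, mul_div_cancel₀ _ hM0.ne']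
      exact sum_interpCost_le hr hr1 hg hfs M
    have hmM : m + 1 ≤ M := Finset.mem_range.1 hm
    obtain ⟨k, hk, hk1, hk2⟩ := exists_truncation hg m
    have hpow : ∀ n ≤ M, (r' ^ n)⁻¹ ≤ ω * (r ^ n)⁻¹ := by
      intro n hn
      have h1 : (r / r') ^ n ≤ ω := (pow_le_pow_left₀ (by positivity) (le_max_right _ _) n).trans
        (pow_le_pow_right₀ (le_max_left _ _) hn)
      calc (r' ^ n)⁻¹ = (r / r') ^ n * (r ^ n)⁻¹ := by rw [div_pow]; field_simp
        _ ≤ _ := mul_le_mul_of_nonneg_right h1 (by positivity)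
    have htail : ∀ j, wlev r' D k (j + (m + 1)) ≤
        (r' ^ (m + 1))⁻¹ * (K * (18 * interpCost u g m)) * (rho / r') ^ j := by
      intro j
      have h1 := (lev_le h k (j + (m + 1))).trans (mul_le_mul_of_nonneg_left (hk2 j) hK)
      have h2 := mul_le_mul_of_nonneg_left h1 (by positivity : (0 : ℝ) ≤ (r' ^ (j + (m + 1)))⁻¹)
      refine h2.trans (le_of_eq ?_)
      rw [div_pow, pow_add]; field_simp
    have hgeo := (summable_geometric_of_lt_one hq0 hq1).mul_left
      ((r' ^ (m + 1))⁻¹ * (K * (18 * interpCost u g m)))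
    have hks : Summable fun j => wlev r' D k (j + (m + 1)) :=
      Summable.of_nonneg_of_le (fun j => wlev_nonneg hr0' hD k _) htail hgeo
    have hkf : FiniteEnergy r' D k := (summable_nat_add_iff (m + 1)).1 hks
    refine (trc_le hr0' hD hk hkf).trans ?_
    unfold en
    rw [← hkf.sum_add_tsum_nat_add (m + 1)]
    have hA : ∑ n ∈ Finset.range (m + 1), wlev r' D k n ≤ ω * en r D g := by
      calc ∑ n ∈ Finset.range (m + 1), wlev r' D k n
          ≤ ∑ n ∈ Finset.range (m + 1), ω * wlev r D g n := by
            refine Finset.sum_le_sum fun n hn => ?_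
            have hn' := Finset.mem_range.1 hn
            unfold wlev
            rw [hk1 n hn', ← mul_assoc]
            exact mul_le_mul_of_nonneg_right (hpow n (by omega)) (lev_nonneg hD g n)
        _ = ω * ∑ n ∈ Finset.range (m + 1), wlev r D g n := by rw [Finset.mul_sum]
        _ ≤ _ := mul_le_mul_of_nonneg_left
          (hf.sum_le_tsum _ fun n _ => wlev_nonneg hr0 hD g n) (by linarith)
    have hB : ∑' j, wlev r' D k (j + (m + 1)) ≤ ω * (C / M) * en r D g := by
      refine (Summable.tsum_le_tsum htail hks hgeo).trans ?_
      rw [tsum_mul_left, tsum_geometric_of_lt_one hq0 hq1]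
      have h1 : (r' ^ (m + 1))⁻¹ * interpCost u g m ≤
          ω * ((3 + 24 / (1 - r) ^ 2) * (K' * en r D g) / M) := by
        calc (r' ^ (m + 1))⁻¹ * interpCost u g m ≤ ω * (r ^ (m + 1))⁻¹ * interpCost u g m :=
              mul_le_mul_of_nonneg_right (hpow _ hmM) (hX m)
          _ = ω * ((r ^ (m + 1))⁻¹ * interpCost u g m) := by ring
          _ ≤ ω * ((3 + 24 / (1 - r) ^ 2) * en r stdForm g / M) :=
              mul_le_mul_of_nonneg_left hmle (by linarith)
          _ ≤ _ := by
              have := en_le hr0 stdForm_isEnergy h' hf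
              gcongr
      calc (r' ^ (m + 1))⁻¹ * (K * (18 * interpCost u g m)) * (1 - rho / r')⁻¹
          = K * 18 * (1 - rho / r')⁻¹ * ((r' ^ (m + 1))⁻¹ * interpCost u g m) := by ring
        _ ≤ K * 18 * (1 - rho / r')⁻¹ * (ω * ((3 + 24 / (1 - r) ^ 2) * (K' * en r D g) / M)) :=
            mul_le_mul_of_nonneg_left h1 (by positivity)
        _ = _ := by rw [hC]; ring
    have hB' : ∑' j, wlev r' D k (j + (m + 1)) ≤ ω * (C / M) * ∑' n, wlev r D g n := hB
    have hA' : ∑ n ∈ Finset.range (m + 1), wlev r' D k n ≤ ω * ∑' n, wlev r D g n := hA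
    linarith
  have hpos : 0 < ω * (1 + C / M) := by positivity
  rw [← div_le_iff₀' hpos]
  refine le_trc hr hD fun g hg hf => ?_
  rw [div_le_iff₀' hpos]
  exact key g hg hf

/-- The trace depends continuously on the parameter, uniformly in the boundary values. -/
lemma trc_eventually_near {r₀ : ℝ} (hr : rho < r₀) (hr1 : r₀ < 1) {D : Form} (hD : IsEnergy D)
    {ε : ℝ} (hε : 0 < ε) :
    ∀ᶠ r in nhds r₀, ∀ u, trc r D u ≤ (1 + ε) * trc r₀ D u ∧
      trc r₀ D u ≤ (1 + ε) * trc r D u := by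
  obtain ⟨K, hK, h⟩ := hD.exists_le
  obtain ⟨K', hK', h'⟩ := hD.exists_ge
  have hr0 := rho_pos.trans hr
  let c : ℝ → ℝ → ℝ := fun r r' => K * 18 * (3 + 24 / (1 - r) ^ 2) * K' / (1 - rho / r')
  have hne : 1 - rho / r₀ ≠ 0 := by
    have := (div_lt_one hr0).2 hr; linarith
  have hne' : (1 - r₀) ^ 2 ≠ 0 := by
    have : 1 - r₀ ≠ 0 := by linarith
    positivity
  have hc1 : ContinuousAt (fun r => c r₀ r) r₀ := by
    refine ContinuousAt.div continuousAt_const ?_ hne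
    exact continuousAt_const.sub (continuousAt_const.div continuousAt_id hr0.ne')
  have hc2 : ContinuousAt (fun r => c r r₀) r₀ := by
    refine ContinuousAt.div ?_ continuousAt_const hne
    have hsq : ContinuousAt (fun r : ℝ => (1 - r) ^ 2) r₀ := by fun_prop
    have hdiv : ContinuousAt (fun r : ℝ => 24 / (1 - r) ^ 2) r₀ := continuousAt_const.div hsq hne'
    exact (continuousAt_const.mul (continuousAt_const.add hdiv)).mul continuousAt_const
  obtain ⟨M, hM⟩ := exists_nat_gt ((c r₀ r₀ + 1) / (ε / 2))
  have hcpos : 0 ≤ c r₀ r₀ := by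
    have : 0 < 1 - rho / r₀ := by
      have := (div_lt_one hr0).2 hr; linarith
    simp only [c]; positivity
  have hM0 : (0 : ℝ) < M := lt_of_le_of_lt (by positivity) hM
  have hMpos : 0 < M := by exact_mod_cast hM0
  have hlim : (1 : ℝ) * (1 + c r₀ r₀ / M) < 1 + ε := by
    have : c r₀ r₀ / M < ε / 2 := by
      rw [div_lt_iff₀ hM0]
      rw [div_lt_iff₀ (by positivity)] at hM
      linarith
    linarith
  have hm1 : ContinuousAt (fun r => max 1 (r₀ / r) ^ M * (1 + c r₀ r / M)) r₀ := by
    refine ContinuousAt.mul (ContinuousAt.pow (continuousAt_const.max ?_) M)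
      (continuousAt_const.add (hc1.div_const _))
    exact continuousAt_const.div continuousAt_id hr0.ne'
  have hm2 : ContinuousAt (fun r => max 1 (r / r₀) ^ M * (1 + c r r₀ / M)) r₀ := by
    refine ContinuousAt.mul (ContinuousAt.pow (continuousAt_const.max ?_) M)
      (continuousAt_const.add (hc2.div_const _))
    exact continuousAt_id.div_const _
  have hv : max 1 (r₀ / r₀) ^ M = (1 : ℝ) := by simp [div_self hr0.ne']
  have ev1 := hm1.tendsto.eventually_lt_const (u := 1 + ε) (by rw [hv]; exact hlim)
  have ev2 := hm2.tendsto.eventually_lt_const (u := 1 + ε) (by rw [hv]; exact hlim)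
  filter_upwards [ev1, ev2, Ioo_mem_nhds hr hr1] with r e1 e2 hrI u
  constructor
  · refine (trc_le_of_near hr hr1 hrI.1 hD hK.le h hK'.le h' hMpos u).trans ?_
    exact mul_le_mul_of_nonneg_right e1.le (trc_nonneg hr hD)
  · refine (trc_le_of_near hrI.1 hrI.2 hr hD hK.le h hK'.le h' hMpos u).trans ?_
    exact mul_le_mul_of_nonneg_right e2.le (trc_nonneg hrI.1 hD)

end GoldenGasket

/-! ### Upper bound and strict monotonicity of the eigenvalue. -/

namespace GoldenGasket

/-- The upper bound on the eigenvalue given by a function that depends on the level only. -/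
lemma trcA_upper {r s : ℝ} (hr : rho < r) (hs : 0 < s) : trcA r s ≤ 2 / (2 + r) := by
  have hr0 := rho_pos.trans hr
  have hE := symForm_isEnergy hs
  -- A function of the level only has no differences between lower corners, so s drops out. Levels 0
  -- and 1 act as resistances 1 and r/2 in series, and r/(r + 2) is the optimal intermediate value.
  let g : ℕ → ℝ → ℝ := fun n _ => if n = 0 then 1 else if n = 1 then r / (r + 2) else 0
  have hg : Adm ![1, 0, 0] g := by
    have := adm_of_eventually_horiz (g := g) (G := fun _ => 0) (N := 1) continuous_const
      (fun n hn b _ => by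
        have h0 : n ≠ 0 := by omega
        have h1 : n ≠ 1 := by omega
        simp [g, h0, h1])
    simpa [g] using this
  have hz : ∀ n ∉ Finset.range 2, wlev r (symForm s) g n = 0 := by
    intro n hn
    have hn' : 2 ≤ n := not_lt.1 fun h => hn (Finset.mem_range.2 h)
    have h0 : n ≠ 0 := by omega
    have h1 : n ≠ 1 := by omega
    simp [wlev, lev, tri, g, symForm_apply, h0, h1]
  have hf : FiniteEnergy r (symForm s) g := summable_of_ne_finset_zero hz
  refine (trc_le hr0 hE hg hf).trans (le_of_eq ?_)
  unfold en
  rw [tsum_eq_sum hz]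
  have hp : rho ^ 2 ≠ 0 := (rho_pow_pos 2).ne'
  have hst : stem 1 = {0, rho ^ 2} := by
    ext x; simp [stem]
  have h1 : lev (symForm s) g 1 = 2 * (r / (r + 2)) ^ 2 := by
    rw [lev, hst, Finset.sum_pair hp.symm]
    simp [tri, g, symForm_apply]; ring
  have h0 : lev (symForm s) g 0 = (1 - r / (r + 2)) ^ 2 := by
    simp [lev, stem, tri, g, symForm_apply]; ring
  rw [Finset.sum_range_succ, Finset.sum_range_one, wlev, wlev, h0, h1]
  field_simp
  ring

lemma form_add_le {D : Form} (hD : IsEnergy D) (x y : Fin 3 → ℝ) {η : ℝ} (hη : 0 < η) :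
    D (x + y) (x + y) ≤ (1 + η) * D x x + (1 + η⁻¹) * D y y := by
  have h1 := form_add_self hD.symm x y 1
  have h2 := hD.nonneg (x + (-η⁻¹) • y)
  rw [form_add_self hD.symm] at h2
  rw [one_smul] at h1
  rw [h1]
  have h3 := mul_nonneg hη.le h2
  have h4 : η * (D x x + 2 * -η⁻¹ * D x y + (-η⁻¹) ^ 2 * D y y) =
      η * D x x - 2 * D x y + η⁻¹ * D y y := by field_simp; ring
  rw [h4] at h3
  linarith

/-- Increasing the parameter strictly lowers the trace of an eigenform with eigenvalue below one. -/
lemma exists_trc_lt {r r' c : ℝ} (hr : rho < r) (hrr : r < r') (hr1 : r' < 1) {D : Form}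
    (hD : IsEnergy D) (hc : 0 < c) (hc1 : c < 1) (h : ∀ u, trc r D u = c * D u u) :
    ∃ c' < c, ∀ u, trc r' D u ≤ c' * D u u := by
  have hr0 := rho_pos.trans hr
  have hr0' : 0 < r' := hr0.trans hrr
  have hr1' : 0 < 1 - r := by linarith
  obtain ⟨K, hK, hle⟩ := hD.exists_le
  obtain ⟨K', hK', hge⟩ := hD.exists_ge
  -- Any η with c (1 + η) < 1 would do; this one makes the product the midpoint (1 + c)/2.
  set η := (1 - c) / (2 * c) with hη
  have hη0 : 0 < η := div_pos (by linarith) (by linarith)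
  have hηc : c * (1 + η) = (1 + c) / 2 := by rw [hη]; field_simp; ring
  set C := (1 + η⁻¹) * (K * (r / (1 - r) * (2 * K'))) with hC
  have hC0 : 0 < C := by positivity
  set δ := 1 - r / r' with hδ
  have hδ0 : 0 < δ := by
    have := (div_lt_one hr0').2 hrr; linarith
  have hgap : 0 < δ / C * ((1 - c) / 2) := mul_pos (by positivity) (by linarith)
  refine ⟨c - δ / C * ((1 - c) / 2), by linarith, fun u => ?_⟩
  -- Let τ be the energy below level 0. Raising r to r' saves at least δ τ. The rays show that D(u)
  -- exceeds (1 + η) times the energy by at most C τ, so τ cannot be small when the energy is close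
  -- to c D(u). Eliminating τ gives a bound linear in the energy, which survives the infimum.
  have key : ∀ g, Adm u g → FiniteEnergy r D g →
      trc r' D u + δ / C * D u u ≤ (1 + δ / C * (1 + η)) * en r D g := by
    intro g hg hf
    have hw := wlev_nonneg hr0 hD g
    set τ := ∑' n, wlev r D g (n + 1) with hτ
    have hτs : Summable fun n => wlev r D g (n + 1) := (summable_nat_add_iff 1).2 hf
    have hτ0 : 0 ≤ τ := tsum_nonneg fun n => hw _
    have hsplit : en r D g = wlev r D g 0 + τ := hf.tsum_eq_zero_add
    have hqn : ∀ n, wlev r' D g (n + 1) ≤ r / r' * wlev r D g (n + 1) := by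
      intro n
      have h1 : (r / r') ^ n ≤ 1 := pow_le_one₀ (by positivity) ((div_lt_one hr0').2 hrr).le
      have e : wlev r' D g (n + 1) = (r / r') ^ n * (r / r' * wlev r D g (n + 1)) := by
        unfold wlev; rw [div_pow, pow_succ, pow_succ]; field_simp
      rw [e]
      exact mul_le_of_le_one_left (mul_nonneg (by positivity) (hw _)) h1
    have hs' : Summable fun n => wlev r' D g (n + 1) :=
      Summable.of_nonneg_of_le (fun n => wlev_nonneg hr0' hD g _) hqn (hτs.mul_left _)
    have hf' : FiniteEnergy r' D g := (summable_nat_add_iff 1).1 hs'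
    have h1 : trc r' D u ≤ en r D g - δ * τ := by
      refine (trc_le hr0' hD hg hf').trans ?_
      have e1 : en r' D g = wlev r' D g 0 + ∑' n, wlev r' D g (n + 1) := hf'.tsum_eq_zero_add
      have e2 : wlev r' D g 0 = wlev r D g 0 := by simp [wlev]
      have e3 : ∑' n, wlev r' D g (n + 1) ≤ r / r' * τ := by
        rw [hτ, ← tsum_mul_left]
        exact Summable.tsum_le_tsum hqn hs' (hτs.mul_left _)
      rw [e1, e2, hsplit, hδ]; linarith
    have hfs := hf.change hr0 stdForm_isEnergy hD
    have hss : Summable fun n => wlev r stdForm g (n + 1) := (summable_nat_add_iff 1).2 hfs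
    have hτstd : ∑' n, wlev r stdForm g (n + 1) ≤ K' * τ := by
      rw [hτ, ← tsum_mul_left]
      exact Summable.tsum_le_tsum (fun n => wlev_le hr0 hge g _) hss (hτs.mul_left _)
    have hL := left_bound hr0 (hrr.trans hr1) hg hfs 1
    have hR := right_bound hr0 (hrr.trans hr1) hg hfs 1
    rw [pow_one] at hL hR
    rw [pow_one] at hR
    have hrt : 0 ≤ r / (1 - r) := by positivity
    have hb : r / (1 - r) * (2 * ∑' n, wlev r stdForm g (n + 1)) ≤
        r / (1 - r) * (2 * (K' * τ)) := by gcongr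
    have hv : D (u - tri g 0 0) (u - tri g 0 0) ≤ K * (r / (1 - r) * (2 * K')) * τ := by
      refine (hle _).trans ?_
      rw [stdForm_apply, mul_assoc]
      refine mul_le_mul_of_nonneg_left ?_ hK.le
      have e2 : (0 : ℝ) + rho ^ (0 + 2) = 1 - rho := by rw [zero_add, zero_add, rho_sq]
      simp only [Pi.sub_apply, tri, Matrix.cons_val_zero, Matrix.cons_val_one, Matrix.cons_val,
        zero_add] at *
      rw [rho_sq, hg.root]
      nlinarith
    have h2 : D u u ≤ (1 + η) * en r D g + C * τ := by
      have h3 := form_add_le hD (tri g 0 0) (u - tri g 0 0) hη0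
      rw [add_sub_cancel] at h3
      have h4 : D (tri g 0 0) (tri g 0 0) = wlev r D g 0 := by simp [wlev, lev, stem]
      rw [h4] at h3
      have h5 : wlev r D g 0 ≤ en r D g := by linarith
      have h6 := mul_le_mul_of_nonneg_left hv (by positivity : 0 ≤ 1 + η⁻¹)
      have h7 := mul_le_mul_of_nonneg_left h5 (by positivity : 0 ≤ 1 + η)
      have h8 : C * τ = (1 + η⁻¹) * (K * (r / (1 - r) * (2 * K')) * τ) := by rw [hC]; ring
      linarith
    have h9 := mul_le_mul_of_nonneg_left h2 (by positivity : 0 ≤ δ / C)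
    have h10 : δ / C * ((1 + η) * en r D g + C * τ) = δ / C * (1 + η) * en r D g + δ * τ := by
      field_simp
    linarith
  have hpos : 0 < 1 + δ / C * (1 + η) := by positivity
  have h3 : (trc r' D u + δ / C * D u u) / (1 + δ / C * (1 + η)) ≤ c * D u u := by
    rw [← h u]
    refine le_trc hr hD fun g hg hf => ?_
    rw [div_le_iff₀' hpos]
    exact key g hg hf
  rw [div_le_iff₀' hpos] at h3
  have h4 : (1 + δ / C * (1 + η)) * (c * D u u) =
      c * D u u + δ / C * ((c * (1 + η)) * D u u) := by ring
  rw [h4, hηc] at h3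
  linarith

/-! A lower bound on the eigenvalue. -/

lemma std_tri_refl (g : ℕ → ℝ → ℝ) (n : ℕ) (b : ℝ) :
    stdForm (tri (refl g) n b) (tri (refl g) n b) =
      stdForm (tri g n (1 - rho ^ n - b)) (tri g n (1 - rho ^ n - b)) := by
  have e := rho_pow_add_two n
  have e1 : 1 - rho ^ (n + 1) - b = 1 - rho ^ n - b + rho ^ (n + 2) := by linarith
  have e2 : 1 - rho ^ (n + 1) - (b + rho ^ (n + 2)) = 1 - rho ^ n - b := by linarith
  simp only [stdForm_apply, tri, refl, Matrix.cons_val_zero, Matrix.cons_val_one,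
    Matrix.cons_val, e1, e2]
  ring

/-- The two halves of a level. -/
lemma half_sums_le (g : ℕ → ℝ → ℝ) {n : ℕ} {S : Finset ℝ} (hS : S ⊆ stem n)
    (h : ∀ b ∈ S, b < (1 - rho ^ n) / 2) :
    ∑ b ∈ S, stdForm (tri g n b) (tri g n b) +
      ∑ b ∈ S, stdForm (tri (refl g) n b) (tri (refl g) n b) ≤ lev stdForm g n := by
  have e : ∑ b ∈ S, stdForm (tri (refl g) n b) (tri (refl g) n b) =
      ∑ b ∈ S.image (fun b => 1 - rho ^ n - b), stdForm (tri g n b) (tri g n b) := by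
    rw [Finset.sum_image fun x _ y _ hxy => by simpa using hxy]
    exact Finset.sum_congr rfl fun b _ => std_tri_refl g n b
  have hd : Disjoint S (S.image fun b => 1 - rho ^ n - b) := by
    rw [Finset.disjoint_left]
    intro x hx hx'
    obtain ⟨y, hy, rfl⟩ := Finset.mem_image.1 hx'
    linarith [h _ hx, h y hy]
  rw [e, ← Finset.sum_union hd]
  refine Finset.sum_le_sum_of_subset_of_nonneg (Finset.union_subset hS ?_)
    fun _ _ _ => stdForm_isEnergy.nonneg _
  intro x hx
  obtain ⟨y, hy, rfl⟩ := Finset.mem_image.1 hx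
  exact stem_reflect (hS hy)

/-- The energy (up to a factor) of the edges of level `n` on the detour around the edge from
`(1, 0)` to `(2, 0)`. -/
def detour (g : ℕ → ℝ → ℝ) : ℕ → ℝ
  | 1 => (g 1 0 - g 2 (rho ^ 3)) ^ 2
  | 2 => (g 2 (rho ^ 3) - g 3 (rho ^ 3)) ^ 2 + (g 2 0 - g 3 (rho ^ 4)) ^ 2
  | 3 => (g 3 (rho ^ 3) - g 4 (rho ^ 3)) ^ 2 + (g 3 (rho ^ 4) - g 4 (rho ^ 3)) ^ 2
  | _ => 0

lemma detour_nonneg (g : ℕ → ℝ → ℝ) (n : ℕ) : 0 ≤ detour g n := by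
  unfold detour; split <;> positivity

/-- The edges of the leftmost path and of the detour. -/
def leftEdges (g : ℕ → ℝ → ℝ) (n : ℕ) : ℝ := (g n 0 - g (n + 1) 0) ^ 2 + detour g n

lemma rho_cube : rho ^ 3 = 2 * rho - 1 := by linear_combination (rho - 1) * rho_sq

lemma rho_four : rho ^ 4 = 2 - 3 * rho := by
  linear_combination (rho ^ 2 - rho + 2) * rho_sq

lemma rho_five : rho ^ 5 = 5 * rho - 3 := by
  linear_combination (rho ^ 3 - rho ^ 2 + 2 * rho - 3) * rho_sq

/-- All chosen edges below level 0 belong to triangles left of the midline, so their mirror images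
use different triangles and both families fit into one level. The single triangle of level 0 is its
own mirror image and contributes one edge to each. -/
lemma leftEdges_le (g : ℕ → ℝ → ℝ) (n : ℕ) :
    (leftEdges g n + leftEdges (refl g) n) / 2 ≤ lev stdForm g n := by
  have p1 := rho_gt
  have p2 := rho_lt
  have base : ∀ k : ℕ → ℝ → ℝ, ∀ n, (k n 0 - k (n + 1) 0) ^ 2 / 2 ≤
      stdForm (tri k n 0) (tri k n 0) := by
    intro k n
    rw [stdForm_apply]
    simp only [tri, Matrix.cons_val_zero, Matrix.cons_val_one, Matrix.cons_val]
    nlinarith [sq_nonneg (k n 0 - k (n + 1) (0 + rho ^ (n + 2)))]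
  match n with
  | 0 =>
    have h : lev stdForm g 0 = stdForm (tri g 0 0) (tri g 0 0) := by simp [lev, stem]
    rw [h, stdForm_apply]
    simp [leftEdges, detour, tri, refl, rho_sq]
  | 1 =>
    have h := half_sums_le g (n := 1) (S := {0}) (by simpa using zero_mem_stem 1)
      (by intro b hb; rw [Finset.mem_singleton.1 hb]; linarith)
    rw [Finset.sum_singleton, Finset.sum_singleton] at h
    rw [stdForm_apply, stdForm_apply] at h
    simp only [tri, Matrix.cons_val_zero, Matrix.cons_val_one, Matrix.cons_val, zero_add] at h
    simp only [leftEdges, detour]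
    norm_num at h ⊢
    linarith
  | 2 =>
    have hm : rho ^ 3 ∈ stem 2 := by simpa using stem_right (zero_mem_stem 1)
    have h := half_sums_le g (n := 2) (S := {0, rho ^ 3})
      (by intro b hb; simp at hb; rcases hb with rfl | rfl
          · exact zero_mem_stem 2
          · exact hm)
      (by intro b hb; simp at hb
          rcases hb with rfl | rfl
          · linarith [rho_sq]
          · linarith [rho_sq, rho_cube])
    have hne : (0 : ℝ) ≠ rho ^ 3 := (rho_pow_pos 3).ne
    rw [Finset.sum_pair hne, Finset.sum_pair hne] at h
    rw [stdForm_apply, stdForm_apply, stdForm_apply, stdForm_apply] at h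
    simp only [tri, Matrix.cons_val_zero, Matrix.cons_val_one, Matrix.cons_val, zero_add] at h
    simp only [leftEdges, detour]
    norm_num at h ⊢
    linarith [sq_nonneg (g 2 (rho ^ 3) - g 3 (rho ^ 3 + rho ^ 4)),
      sq_nonneg (refl g 2 (rho ^ 3) - refl g 3 (rho ^ 3 + rho ^ 4))]
  | 3 =>
    have hm : rho ^ 3 ∈ stem 3 := stem_left (by simpa using stem_right (zero_mem_stem 1))
    have hm' : rho ^ 4 ∈ stem 3 := by simpa using stem_right (zero_mem_stem 2)
    have h := half_sums_le g (n := 3) (S := {0, rho ^ 4, rho ^ 3})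
      (by intro b hb; simp at hb; rcases hb with rfl | rfl | rfl
          · exact zero_mem_stem 3
          · exact hm'
          · exact hm)
      (by intro b hb; simp at hb
          rcases hb with rfl | rfl | rfl
          · linarith [rho_cube]
          · linarith [rho_cube, rho_four]
          · linarith [rho_cube])
    have hne : (0 : ℝ) ∉ ({rho ^ 4, rho ^ 3} : Finset ℝ) := by
      simp [(rho_pow_pos 4).ne, (rho_pow_pos 3).ne]
    have hne' : rho ^ 4 ≠ rho ^ 3 := by rw [rho_four, rho_cube]; intro h; linarith
    rw [Finset.sum_insert hne, Finset.sum_insert hne, Finset.sum_pair hne',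
      Finset.sum_pair hne'] at h
    have hZ : rho ^ 4 + rho ^ 5 = rho ^ 3 := by rw [rho_four, rho_five, rho_cube]; ring
    have b1 := base g 3
    have b2 := base (refl g) 3
    have c1 : ∀ k : ℕ → ℝ → ℝ, (k 3 (rho ^ 4) - k 4 (rho ^ 3)) ^ 2 / 2 ≤
        stdForm (tri k 3 (rho ^ 4)) (tri k 3 (rho ^ 4)) := by
      intro k
      have := std_right_le (tri k 3 (rho ^ 4))
      simp only [tri, Matrix.cons_val_zero, Matrix.cons_val] at this ⊢
      norm_num [hZ] at this ⊢
      linarith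
    have c2 : ∀ k : ℕ → ℝ → ℝ, (k 3 (rho ^ 3) - k 4 (rho ^ 3)) ^ 2 / 2 ≤
        stdForm (tri k 3 (rho ^ 3)) (tri k 3 (rho ^ 3)) := by
      intro k
      have := std_left_le (tri k 3 (rho ^ 3))
      simp only [tri, Matrix.cons_val_zero, Matrix.cons_val_one] at this ⊢
      norm_num at this ⊢
      linarith
    simp only [leftEdges, detour]
    linarith [c1 g, c1 (refl g), c2 g, c2 (refl g)]
  | n + 4 =>
    have h := half_sums_le g (n := n + 4) (S := {0}) (by simpa using zero_mem_stem _)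
      (by intro b hb; rw [Finset.mem_singleton.1 hb]
          have : rho ^ (n + 4) < 1 := pow_lt_one₀ rho_pos.le rho_lt_one (by omega)
          linarith)
    rw [Finset.sum_singleton, Finset.sum_singleton] at h
    simp only [leftEdges, detour, add_zero]
    linarith [base g (n + 4), base (refl g) (n + 4)]

/-- The left ray alone would give 1 - r = 0.38, which is below r² = 0.3844. The detour, of
resistance r + 2r² + 2r³, lies parallel to the edge of resistance r between levels 1 and 2 and
lowers it to less than 0.466. The total 1 + 0.466 + 1.012, the last term bounding r²/(1 - r), is
below 5/2. -/
lemma leftEdges_energy {r : ℝ} (hr : r = 31 / 50) {g : ℕ → ℝ → ℝ} (hg : Adm ![1, 0, 0] g)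
    (hs : Summable fun n => (r ^ n)⁻¹ * leftEdges g n) :
    2 / 5 ≤ ∑' n, (r ^ n)⁻¹ * leftEdges g n := by
  have hr0 : 0 < r := by rw [hr]; norm_num
  have hr1 : r < 1 := by rw [hr]; norm_num
  let w : ℕ → ℝ := fun n => (r ^ n)⁻¹ * (g n 0 - g (n + 1) 0) ^ 2
  let d : ℕ → ℝ := fun n => (r ^ n)⁻¹ * detour g n
  have hw0 : ∀ n, 0 ≤ w n := fun n => by simp only [w]; positivity
  have hd0 : ∀ n, 0 ≤ d n := fun n => mul_nonneg (by positivity) (detour_nonneg g n)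
  have hwd : ∀ n, (r ^ n)⁻¹ * leftEdges g n = w n + d n := fun n => by
    simp only [w, d, leftEdges]; ring
  simp only [hwd] at hs ⊢
  have hw : Summable w := Summable.of_nonneg_of_le hw0 (fun n => by linarith [hd0 n]) hs
  have hd : Summable d := Summable.of_nonneg_of_le hd0 (fun n => by linarith [hw0 n]) hs
  rw [hw.tsum_add hd]
  have hdz : ∀ n ∉ Finset.range 4, d n = 0 := by
    intro n hn
    obtain ⟨m, rfl⟩ : ∃ m, n = m + 4 := ⟨n - 4, by simp at hn; omega⟩
    simp [d, detour]
  rw [tsum_eq_sum hdz, ← hw.sum_add_tsum_nat_add 2]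
  simp only [Finset.sum_range_succ, Finset.sum_range_zero, zero_add]
  have hT := ray_bound hr0 hr1 (a := fun n => g n 0) hw0 hw (fun n => by
    simp only [w]; rw [← mul_assoc, mul_inv_cancel₀ (by positivity), one_mul]) hg.tendsto_left 2
  set T := ∑' j, w (j + 2) with hTd
  have hT0 : 0 ≤ T := tsum_nonneg fun j => hw0 _
  have h0 : g 0 0 = 1 := hg.root
  have e0 : d 0 = 0 := by simp [d, detour]
  have ew0 : w 0 = (1 - g 1 0) ^ 2 := by simp [w, h0]
  simp only [Matrix.cons_val_one] at hT
  have ew1 : (g 1 0 - g 2 0) ^ 2 = r * w 1 := by simp only [w]; field_simp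
  rw [e0, ew0]
  have d1 : (g 1 0 - g 2 (rho ^ 3)) ^ 2 ≤ r * d 1 := by
    simp only [d, detour]; rw [pow_one, mul_inv_cancel_left₀ hr0.ne']
  -- the detour as a series connection
  have s12 : (g 1 0 - g 2 0) ^ 2 ≤ (r + 2 * r ^ 2 + 2 * r ^ 3) * (d 1 + d 2 + d 3) := by
    have q2 : d 2 = (r ^ 2)⁻¹ * (g 2 (rho ^ 3) - g 3 (rho ^ 3)) ^ 2 +
      (r ^ 2)⁻¹ * (g 3 (rho ^ 4) - g 2 0) ^ 2 := by simp only [d, detour]; ring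
    have q3 : d 3 = (r ^ 3)⁻¹ * (g 3 (rho ^ 3) - g 4 (rho ^ 3)) ^ 2 +
      (r ^ 3)⁻¹ * (g 4 (rho ^ 3) - g 3 (rho ^ 4)) ^ 2 := by simp only [d, detour]; ring
    have c : ∀ (n : ℕ) (x : ℝ), x ^ 2 ≤ r ^ n * ((r ^ n)⁻¹ * x ^ 2) := fun n x => by
      rw [← mul_assoc, mul_inv_cancel₀ (by positivity), one_mul]
    have i1 := sq_add_le_mul_add hr0.le (by positivity) (hd0 1) (by positivity) d1
      (c 2 (g 2 (rho ^ 3) - g 3 (rho ^ 3)))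
    have := hd0 1
    have i2 := sq_add_le_mul_add (by positivity) (by positivity) (by positivity) (by positivity) i1
      (c 3 (g 3 (rho ^ 3) - g 4 (rho ^ 3)))
    have i3 := sq_add_le_mul_add (by positivity) (by positivity) (by positivity) (by positivity) i2
      (c 3 (g 4 (rho ^ 3) - g 3 (rho ^ 4)))
    have i4 := sq_add_le_mul_add (by positivity) (by positivity) (by positivity) (by positivity) i3
      (c 2 (g 3 (rho ^ 4) - g 2 0))
    rw [q2, q3]
    convert i4 using 1 <;> ring
  set Δ := d 1 + d 2 + d 3 with hΔ
  have hΔ0 : 0 ≤ Δ := by linarith [hd0 1, hd0 2, hd0 3]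
  have hpar : (g 1 0 - g 2 0) ^ 2 ≤ (466 / 1000) * (w 1 + Δ) := by
    rw [hr] at ew1 s12
    norm_num at ew1 s12
    nlinarith [hw0 1]
  have hT' : g 2 0 ^ 2 ≤ (1012 / 1000) * T := by
    rw [hr] at hT
    norm_num at hT
    linarith
  have j1 := sq_add_le_mul_add (a := 1 - g 1 0) (l := 1) zero_le_one
    (by norm_num : (0 : ℝ) ≤ 466 / 1000) (sq_nonneg (1 - g 1 0))
    (add_nonneg (hw0 1) hΔ0) (by rw [one_mul]) hpar
  have j2 := sq_add_le_mul_add (by norm_num) (by norm_num)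
    (add_nonneg (sq_nonneg _) (add_nonneg (hw0 1) hΔ0)) hT0 j1 hT'
  have j3 : (1 - g 1 0 + (g 1 0 - g 2 0) + g 2 0) = 1 := by ring
  rw [j3] at j2
  norm_num at j2
  linarith

/-- The value 31/50 lies just above ρ, and 2/5 exceeds its square 0.3844; this is the lower end of
the intermediate value argument for λ(r) = r². Monotonicity in s reduces to s = 1/4, where the form
has no bottom edge. -/
lemma trcA_gt {s : ℝ} (hs : 1 / 4 ≤ s) : 2 / 5 ≤ trcA (31 / 50) s := by
  have hr : rho < 31 / 50 := by linarith [rho_lt]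
  refine le_trans ?_ (trcA_mono hr (by norm_num) hs)
  refine le_trc hr stdForm_isEnergy fun g hg hf => ?_
  have hg' : Adm ![1, 0, 0] (refl g) := by
    have := hg.refl
    convert this using 1
    ext i; fin_cases i <;> simp [swap]
  have h0 : ∀ k n, 0 ≤ (((31 : ℝ) / 50) ^ n)⁻¹ * leftEdges k n := fun k n => by
    have := detour_nonneg k n
    unfold leftEdges; positivity
  have hle : ∀ n, (((31 : ℝ) / 50) ^ n)⁻¹ * leftEdges g n +
      (((31 : ℝ) / 50) ^ n)⁻¹ * leftEdges (refl g) n ≤ 2 * wlev (31 / 50) stdForm g n := by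
    intro n
    have := mul_le_mul_of_nonneg_left (leftEdges_le g n)
      (by positivity : (0 : ℝ) ≤ (((31 : ℝ) / 50) ^ n)⁻¹)
    unfold wlev; linarith
  have s1 : Summable fun n => (((31 : ℝ) / 50) ^ n)⁻¹ * leftEdges g n :=
    Summable.of_nonneg_of_le (h0 g) (fun n => by linarith [hle n, h0 (refl g) n]) (hf.mul_left 2)
  have s2 : Summable fun n => (((31 : ℝ) / 50) ^ n)⁻¹ * leftEdges (refl g) n :=
    Summable.of_nonneg_of_le (h0 _) (fun n => by linarith [hle n, h0 g n]) (hf.mul_left 2)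
  have h1 := leftEdges_energy rfl hg s1
  have h2 := leftEdges_energy rfl hg' s2
  have h3 := Summable.tsum_le_tsum hle (s1.add s2) (hf.mul_left 2)
  rw [s1.tsum_add s2, tsum_mul_left] at h3
  unfold en
  linarith

end GoldenGasket

namespace GoldenGasket

/-! Limits of minimizing sequences. -/

/-- A fixed nonprincipal ultrafilter gives limits at all vertices simultaneously and replaces a
diagonal subsequence. -/
lemma exists_hyperfilter_limit {a : ℕ → ℝ} {C : ℝ} (h : ∀ k, |a k| ≤ C) :
    ∃ l, Filter.Tendsto a (Filter.hyperfilter ℕ) (nhds l) := by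
  obtain ⟨l, -, hl⟩ := isCompact_Icc.ultrafilter_le_nhds ((Filter.hyperfilter ℕ).map a)
    (s := Icc (-C) C) (by
      rw [Filter.le_principal_iff]
      exact Filter.mem_map.2 (Filter.Eventually.of_forall fun k => abs_le.1 (h k)))
  exact ⟨l, hl⟩

lemma tendsto_form {ι : Type*} {F : Filter ι} {D : Form} (hD : IsEnergy D)
    {x y : ι → Fin 3 → ℝ} {x₀ y₀ : Fin 3 → ℝ} (hx : Filter.Tendsto x F (nhds x₀))
    (hy : Filter.Tendsto y F (nhds y₀)) :
    Filter.Tendsto (fun i => D (x i) (y i)) F (nhds (D x₀ y₀)) := by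
  rw [tendsto_pi_nhds] at hx hy
  rw [form_expand hD.symm hD.nonneg hD.const_null]
  simp_rw [form_expand hD.symm hD.nonneg hD.const_null (x _) (y _)]
  have a1 := (hx 1).sub (hx 0)
  have a2 := (hx 2).sub (hx 0)
  have b1 := (hy 1).sub (hy 0)
  have b2 := (hy 2).sub (hy 0)
  exact ((((a1.mul b1).mul_const _).add (((a1.mul b2).add (a2.mul b1)).mul_const _))).add
    ((a2.mul b2).mul_const _)

/-- The indicator of a vertex. -/
def bump (N : ℕ) (c : ℝ) (n : ℕ) (b : ℝ) : ℝ := if n = N ∧ b = c then 1 else 0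

lemma bump_adm (N : ℕ) (c : ℝ) : Adm 0 (bump (N + 1) c) := by
  have := adm_of_eventually_horiz (g := bump (N + 1) c) (G := fun _ => 0) (N := N + 1)
    continuous_const (fun n hn b _ => by
      have h0 : n ≠ N + 1 := by omega
      simp [bump, h0])
  convert this using 1
  ext i; fin_cases i <;> simp [bump]

lemma tri_bump_of_ne {N n : ℕ} (c b : ℝ) (h : n ≠ N) (h' : n ≠ N + 1) :
    tri (bump (N + 1) c) n b = 0 := by
  ext i; fin_cases i <;> simp [tri, bump, h, h']

/-- The energy of the sum of a function and a multiple of a bump. -/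
lemma en_add_bump {r : ℝ} {D : Form} (hD : IsEnergy D) {g : ℕ → ℝ → ℝ}
    (hf : FiniteEnergy r D g) (N : ℕ) (c t : ℝ) :
    FiniteEnergy r D (g + t • bump (N + 1) c) ∧ en r D (g + t • bump (N + 1) c) = en r D g +
      (2 * t * ∑ n ∈ Finset.range (N + 2), (r ^ n)⁻¹ *
        ∑ b ∈ stem n, D (tri g n b) (tri (bump (N + 1) c) n b) +
        t ^ 2 * en r D (bump (N + 1) c)) := by
  set w := bump (N + 1) c with hw
  let X : ℕ → ℝ := fun n => (r ^ n)⁻¹ * ∑ b ∈ stem n, D (tri g n b) (tri w n b)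
  have hz : ∀ n ∉ Finset.range (N + 2), ∀ b, tri w n b = 0 := by
    intro n hn b
    have hn' : N + 2 ≤ n := not_lt.1 fun h => hn (Finset.mem_range.2 h)
    exact tri_bump_of_ne c b (by omega) (by omega)
  have hX : ∀ n ∉ Finset.range (N + 2), X n = 0 := by
    intro n hn; simp [X, hz n hn]
  have hW : ∀ n ∉ Finset.range (N + 2), wlev r D w n = 0 := by
    intro n hn; simp [wlev, lev, hz n hn]
  have hXs : Summable X := summable_of_ne_finset_zero hX
  have hWs : Summable (wlev r D w) := summable_of_ne_finset_zero hW
  have e : wlev r D (g + t • w) =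
      fun n => wlev r D g n + (2 * t * X n + t ^ 2 * wlev r D w n) := by
    funext n
    simp only [wlev, lev, X, Finset.mul_sum, ← Finset.sum_add_distrib]
    refine Finset.sum_congr rfl fun b _ => ?_
    rw [tri_add, tri_smul, form_add_self hD.symm]
    ring
  unfold FiniteEnergy en
  rw [e]
  have hs := (hXs.mul_left (2 * t)).add (hWs.mul_left (t ^ 2))
  refine ⟨hf.add hs, ?_⟩
  rw [hf.tsum_add hs, (hXs.mul_left (2 * t)).tsum_add (hWs.mul_left (t ^ 2)), tsum_mul_left,
    tsum_mul_left, tsum_eq_sum hX]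

/-- The root value is fixed, and a bound on each level energy bounds the drop along every edge;
every vertex is reached from the root by going down. -/
lemma bounded_of_energy {r : ℝ} (hr : 0 < r) (hr1 : r < 1) {E : ℝ} {f : ℕ → ℕ → ℝ → ℝ}
    {u : Fin 3 → ℝ} (hf : ∀ k, Adm u (f k)) (hE : ∀ k n, wlev r stdForm (f k) n ≤ E) (n : ℕ) :
    ∃ C, ∀ k, ∀ b ∈ stem n, |f k n b| ≤ C := by
  induction n with
  | zero =>
    refine ⟨|u 0|, fun k b hb => ?_⟩
    obtain rfl : b = 0 := by simpa [stem] using hb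
    rw [(hf k).root]
  | succ n ih =>
    obtain ⟨C, hC⟩ := ih
    have hedge : ∀ k, ∀ b ∈ stem n, |f k n b - f k (n + 1) b| ≤ 2 * E + 1 ∧
        |f k n b - f k (n + 1) (b + rho ^ (n + 2))| ≤ 2 * E + 1 := by
      intro k b hb
      have h1 := std_tri_le (f k) hb
      rw [lev_eq_wlev hr] at h1
      have h0 := wlev_nonneg hr stdForm_isEnergy (f k) n
      have h2 : r ^ n * wlev r stdForm (f k) n ≤ E :=
        (mul_le_of_le_one_left h0 (pow_le_one₀ hr.le hr1.le)).trans (hE k n)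
      have h3 := std_left_le (tri (f k) n b)
      have h4 := std_right_le (tri (f k) n b)
      simp only [tri, Matrix.cons_val_zero, Matrix.cons_val_one, Matrix.cons_val] at h1 h3 h4
      have key : ∀ x : ℝ, x ^ 2 ≤ 2 * E → |x| ≤ 2 * E + 1 := by
        intro x hx
        nlinarith [sq_abs x, sq_nonneg (|x| - 1), abs_nonneg x]
      exact ⟨key _ (by linarith), key _ (by linarith)⟩
    refine ⟨C + (2 * E + 1), fun k b hb => ?_⟩
    rcases mem_stem_succ.1 hb with h | h
    · have h1 := hC k b h
      have h2 := (hedge k b h).1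
      rw [abs_le] at *
      constructor <;> linarith [h1.1, h1.2, h2.1, h2.2]
    · have h1 := hC k _ h
      have h2 := (hedge k _ h).2
      rw [sub_add_cancel] at h2
      rw [abs_le] at *
      constructor <;> linarith [h1.1, h1.2, h2.1, h2.2]

/-- A vertex of level N + 1 and offset c can be the left child of (N, c) and the right child of (N,
c - ρ^(N+2)). Each parent contributes when it exists. -/
lemma sum_bump_left {N : ℕ} (D : Form) (h : ℕ → ℝ → ℝ) (c : ℝ) :
    ∑ b ∈ stem N, D (tri h N b) (tri (bump (N + 1) c) N b) =
      (if c ∈ stem N then D (tri h N c) (Pi.single 1 1) else 0) +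
      (if c - rho ^ (N + 2) ∈ stem N then D (tri h N (c - rho ^ (N + 2))) (Pi.single 2 1)
        else 0) := by
  have e : ∀ b, D (tri h N b) (tri (bump (N + 1) c) N b) =
      (if b = c then D (tri h N b) (Pi.single 1 1) else 0) +
      (if b = c - rho ^ (N + 2) then D (tri h N b) (Pi.single 2 1) else 0) := by
    intro b
    have : tri (bump (N + 1) c) N b = (if b = c then (1 : ℝ) else 0) • Pi.single 1 1 +
        (if b = c - rho ^ (N + 2) then (1 : ℝ) else 0) • Pi.single 2 1 := by
      simp only [eq_sub_iff_add_eq]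
      ext i
      fin_cases i <;> simp [tri, bump] <;> split_ifs <;> simp
    rw [this, map_add, map_smul, map_smul]
    split_ifs <;> simp
  simp only [e, Finset.sum_add_distrib, Finset.sum_ite_eq']

lemma sum_bump_top {N : ℕ} (D : Form) (h : ℕ → ℝ → ℝ) {c : ℝ} (hc : c ∈ stem (N + 1)) :
    ∑ b ∈ stem (N + 1), D (tri h (N + 1) b) (tri (bump (N + 1) c) (N + 1) b) =
      D (tri h (N + 1) c) (Pi.single 0 1) := by
  have e : ∀ b, D (tri h (N + 1) b) (tri (bump (N + 1) c) (N + 1) b) =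
      if b = c then D (tri h (N + 1) b) (Pi.single 0 1) else 0 := by
    intro b
    have : tri (bump (N + 1) c) (N + 1) b = (if b = c then (1 : ℝ) else 0) • Pi.single 0 1 := by
      ext i
      fin_cases i <;> simp [tri, bump]
    rw [this, map_smul]
    split_ifs <;> simp
  simp only [e, Finset.sum_ite_eq', hc, if_true]

/-- If `D ≤ M D'` are both eigenforms with equality at `u`, then there is a function with boundary
values `u` that is harmonic for `D`, with equality on every triangle. -/
lemma exists_common_harmonic {r c M : ℝ} (hr : rho < r) (hr1 : r < 1) {D D' : Form}
    (hD : IsEnergy D) (hD' : IsEnergy D') (hM : 0 < M) (hle : ∀ x, D x x ≤ M * D' x x)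
    {u : Fin 3 → ℝ} (hu : D u u = M * D' u u) (h : ∀ u, trc r D u = c * D u u)
    (h' : ∀ u, trc r D' u = c * D' u u) :
    ∃ g : ℕ → ℝ → ℝ, g 0 0 = u 0 ∧
      Filter.Tendsto (fun n => g n 0) Filter.atTop (nhds (u 1)) ∧
      Filter.Tendsto (fun n => g n (1 - rho ^ n)) Filter.atTop (nhds (u 2)) ∧
      (∀ n, ∀ b ∈ stem n, D (tri g n b) (tri g n b) = M * D' (tri g n b) (tri g n b)) ∧
      ∀ N, ∀ b ∈ stem (N + 1),
        r * ((if b ∈ stem N then D (tri g N b) (Pi.single 1 1) else 0) +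
          (if b - rho ^ (N + 2) ∈ stem N then D (tri g N (b - rho ^ (N + 2))) (Pi.single 2 1)
            else 0)) + D (tri g (N + 1) b) (Pi.single 0 1) = 0 := by
  have hr0 := rho_pos.trans hr
  -- A minimizing sequence for D' also minimizes for D: its D-energies are at most M (c D'(u) + ε) =
  -- c D(u) + M ε. The pointwise limit need not be shown continuous; convergence along the two rays
  -- is enough.
  have hex : ∀ k : ℕ, ∃ g, Adm u g ∧ FiniteEnergy r D' g ∧ en r D' g < trc r D' u + 1 / ((k : ℝ) + 1) :=
    fun k => exists_near hr hD' u (by positivity)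
  choose f hfA hfF hfE using hex
  have hfFD : ∀ k, FiniteEnergy r D (f k) := fun k => (hfF k).mono hr0 hD hle
  let ε : ℕ → ℝ := fun k => 1 / ((k : ℝ) + 1)
  have hε : Filter.Tendsto ε (Filter.hyperfilter ℕ) (nhds 0) :=
    tendsto_one_div_add_atTop_nhds_zero_nat.mono_left Nat.hyperfilter_le_atTop
  have hε1 : ∀ k, ε k ≤ 1 := fun k => by
    simp only [ε]
    rw [div_le_one (by positivity)]
    linarith [(Nat.cast_nonneg k : (0 : ℝ) ≤ k)]
  have hE' : ∀ k, en r D' (f k) ≤ c * D' u u + ε k := fun k => by rw [← h' u]; exact (hfE k).le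
  -- uniform energy bound
  obtain ⟨K, hK, hge⟩ := hD'.exists_ge
  have hstd : ∀ k, FiniteEnergy r stdForm (f k) := fun k => (hfF k).mono hr0 stdForm_isEnergy hge
  set E := K * (c * D' u u + 1) with hEdef
  have henE : ∀ k, en r stdForm (f k) ≤ E := fun k =>
    (en_le hr0 stdForm_isEnergy hge (hfF k)).trans
      (mul_le_mul_of_nonneg_left ((hE' k).trans (by linarith [hε1 k])) hK.le)
  have hw0 : ∀ k n, 0 ≤ wlev r stdForm (f k) n := fun k n => wlev_nonneg hr0 stdForm_isEnergy _ n
  have hwE : ∀ k n, wlev r stdForm (f k) n ≤ E := fun k n =>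
    ((hstd k).le_tsum n fun m _ => hw0 k m).trans (henE k)
  have hlim : ∀ n b, ∃ l, b ∈ stem n →
      Filter.Tendsto (fun k => f k n b) (Filter.hyperfilter ℕ) (nhds l) := by
    intro n b
    by_cases hb : b ∈ stem n
    · obtain ⟨C, hC⟩ := bounded_of_energy hr0 hr1 hfA hwE n
      obtain ⟨l, hl⟩ := exists_hyperfilter_limit fun k => hC k b hb
      exact ⟨l, fun _ => hl⟩
    · exact ⟨0, fun h => absurd h hb⟩
  choose g hg using hlim
  have htri : ∀ n, ∀ b ∈ stem n, Filter.Tendsto (fun k => tri (f k) n b) (Filter.hyperfilter ℕ)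
      (nhds (tri g n b)) := by
    intro n b hb
    rw [tendsto_pi_nhds]
    intro i
    fin_cases i
    · exact hg n b hb
    · exact hg _ _ (stem_left hb)
    · exact hg _ _ (stem_right hb)
  have htail : ∀ k N, ∑' j, wlev r stdForm (f k) (j + N) ≤ E := by
    intro k N
    refine le_trans ?_ (henE k)
    unfold en
    rw [← (hstd k).sum_add_tsum_nat_add N]
    linarith [Finset.sum_nonneg fun (i : ℕ) (_ : i ∈ Finset.range N) => hw0 k i]
  have hr1' : 0 < 1 - r := by linarith
  have hray : ∀ (x : ℕ → ℝ) (l : ℝ), (∀ N, (x N - l) ^ 2 ≤ r ^ N / (1 - r) * (2 * E)) →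
      Filter.Tendsto x Filter.atTop (nhds l) := by
    intro x l hx
    have h1 : Filter.Tendsto (fun N => r ^ N / (1 - r) * (2 * E)) Filter.atTop (nhds 0) := by
      have := ((tendsto_pow_atTop_nhds_zero_of_lt_one hr0.le hr1).div_const (1 - r)).mul_const
        (2 * E)
      simpa using this
    have h2 := squeeze_zero (fun N => sq_nonneg (x N - l)) hx h1
    have h3 : Filter.Tendsto (fun N => |x N - l|) Filter.atTop (nhds 0) := by
      have := (Real.continuous_sqrt.tendsto 0).comp h2
      simpa [Function.comp_def, Real.sqrt_sq_eq_abs] using this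
    have h4 := (tendsto_zero_iff_abs_tendsto_zero _).2 h3
    simpa using h4.add_const l
  refine ⟨g, ?_, ?_, ?_, ?_, ?_⟩
  · refine tendsto_nhds_unique (hg 0 0 (zero_mem_stem 0)) ?_
    simp only [(hfA _).root]
    exact tendsto_const_nhds
  · refine hray _ _ fun N => le_of_tendsto
      (((hg N 0 (zero_mem_stem N)).sub_const (u 1)).pow 2) (Filter.Eventually.of_forall fun k => ?_)
    refine (left_bound hr0 hr1 (hfA k) (hstd k) N).trans ?_
    have := htail k N
    gcongr
  · refine hray _ _ fun N => le_of_tendsto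
      (((hg N _ (last_mem_stem N)).sub_const (u 2)).pow 2) (Filter.Eventually.of_forall fun k => ?_)
    refine (right_bound hr0 hr1 (hfA k) (hstd k) N).trans ?_
    have := htail k N
    gcongr
  · intro n b hb
    -- The terms M D' - D are nonnegative on every triangle, and their weighted sum is at most M ε,
    -- so each of them vanishes in the limit.
    have hgap : ∀ k, M * D' (tri (f k) n b) (tri (f k) n b) - D (tri (f k) n b) (tri (f k) n b) ≤
        r ^ n * (M * ε k) := by
      intro k
      have h1 : M * D' (tri (f k) n b) (tri (f k) n b) - D (tri (f k) n b) (tri (f k) n b) ≤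
          M * lev D' (f k) n - lev D (f k) n := by
        rw [lev, lev, Finset.mul_sum, ← Finset.sum_sub_distrib]
        exact Finset.single_le_sum (f := fun b => M * D' (tri (f k) n b) (tri (f k) n b) -
          D (tri (f k) n b) (tri (f k) n b)) (fun b _ => sub_nonneg.2 (hle _)) hb
      have hs : Summable fun n => M * wlev r D' (f k) n - wlev r D (f k) n :=
        ((hfF k).mul_left M).sub (hfFD k)
      have h2 : M * wlev r D' (f k) n - wlev r D (f k) n ≤ M * en r D' (f k) - en r D (f k) := by
        unfold en
        rw [← tsum_mul_left, ← ((hfF k).mul_left M).tsum_sub (hfFD k)]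
        exact hs.le_tsum n fun m _ => sub_nonneg.2 (wlev_le hr0 hle _ m)
      have h3 := trc_le hr0 hD (hfA k) (hfFD k)
      rw [h u, hu] at h3
      have h4 := mul_le_mul_of_nonneg_left (hE' k) hM.le
      have h5 : M * wlev r D' (f k) n - wlev r D (f k) n ≤ M * ε k := by linarith
      have h6 := mul_le_mul_of_nonneg_left h5 (pow_pos hr0 n).le
      rw [lev_eq_wlev hr0 D', lev_eq_wlev hr0 D] at h1
      linarith
    have t1 := ((tendsto_form hD' (htri n b hb) (htri n b hb)).const_mul M).sub
      (tendsto_form hD (htri n b hb) (htri n b hb))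
    have t2 : Filter.Tendsto (fun k => r ^ n * (M * ε k)) (Filter.hyperfilter ℕ) (nhds 0) := by
      simpa using (hε.const_mul M).const_mul (r ^ n)
    have := le_of_tendsto_of_tendsto t1 t2 (Filter.Eventually.of_forall hgap)
    linarith [hle (tri g n b)]
  · intro N b₀ hb₀
    let X : (ℕ → ℝ → ℝ) → ℝ := fun k => ∑ n ∈ Finset.range (N + 2), (r ^ n)⁻¹ *
      ∑ b ∈ stem n, D (tri k n b) (tri (bump (N + 1) b₀) n b)
    have hXlim : Filter.Tendsto (fun k => X (f k)) (Filter.hyperfilter ℕ) (nhds (X g)) := by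
      refine tendsto_finsetSum _ fun n _ => Filter.Tendsto.const_mul _ ?_
      exact tendsto_finsetSum _ fun b hb => tendsto_form hD (htri n b hb) tendsto_const_nhds
    -- First variation: adding t times a bump keeps the boundary values, and near-minimality leaves
    -- a quadratic in t that is nonnegative in the limit.
    have hX0 : X g = 0 := by
      refine eq_zero_of_forall_quadratic (Y := en r D (bump (N + 1) b₀)) fun t => ?_
      have hk : ∀ k, 0 ≤ M * ε k + (2 * t * X (f k) + t ^ 2 * en r D (bump (N + 1) b₀)) := by
        intro k
        obtain ⟨h1, h2⟩ := en_add_bump hD (hfFD k) N b₀ t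
        have hA := (hfA k).add ((bump_adm N b₀).smul t)
        rw [smul_zero, add_zero] at hA
        have h3 := trc_le hr0 hD hA h1
        rw [h2, h u, hu] at h3
        have h4 := en_le hr0 hD hle (hfF k)
        have h5 := mul_le_mul_of_nonneg_left (hE' k) hM.le
        simp only [X]
        linarith
      have hl : Filter.Tendsto
          (fun k => M * ε k + (2 * t * X (f k) + t ^ 2 * en r D (bump (N + 1) b₀)))
          (Filter.hyperfilter ℕ)
          (nhds (M * 0 + (2 * t * X g + t ^ 2 * en r D (bump (N + 1) b₀)))) :=
        (hε.const_mul M).add ((hXlim.const_mul (2 * t)).add tendsto_const_nhds)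
      have := ge_of_tendsto hl (Filter.Eventually.of_forall hk)
      linarith
    have hX1 : X g = (r ^ N)⁻¹ * ∑ b ∈ stem N, D (tri g N b) (tri (bump (N + 1) b₀) N b) +
        (r ^ (N + 1))⁻¹ *
          ∑ b ∈ stem (N + 1), D (tri g (N + 1) b) (tri (bump (N + 1) b₀) (N + 1) b) := by
      simp only [X]
      rw [Finset.sum_range_succ, Finset.sum_range_succ, Finset.sum_eq_zero, zero_add]
      intro n hn
      have hn' := Finset.mem_range.1 hn
      simp only [tri_bump_of_ne b₀ _ (show n ≠ N by omega) (show n ≠ N + 1 by omega), map_zero,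
        Finset.sum_const_zero, mul_zero]
    rw [hX0, sum_bump_left, sum_bump_top D g hb₀] at hX1
    have h7 := congrArg (fun x => r ^ (N + 1) * x) hX1
    simp only [mul_zero] at h7
    refine Eq.trans ?_ h7.symm
    generalize (if b₀ ∈ stem N then D (tri g N b₀) (Pi.single 1 1) else 0) +
      (if b₀ - rho ^ (N + 2) ∈ stem N then D (tri g N (b₀ - rho ^ (N + 2))) (Pi.single 2 1)
        else 0) = A
    rw [pow_succ]
    field_simp

/-! ### Uniqueness of the eigenform. -/

/-- A psd form with a nonconstant null vector `u` vanishes only on the plane spanned by the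
constants and `u`, unless it is zero. -/
lemma exists_coeff_of_null {Q : Form} (hs : ∀ x y, Q x y = Q y x) (hn : ∀ x, 0 ≤ Q x x)
    (h1 : Q (fun _ => 1) (fun _ => 1) = 0) {u : Fin 3 → ℝ} (hu : Q u u = 0)
    (hu' : ¬(u 1 - u 0 = 0 ∧ u 2 - u 0 = 0)) (hQ : ∃ x, Q x x ≠ 0) {x : Fin 3 → ℝ}
    (hx : Q x x = 0) : ∃ z, x 1 - x 0 = z * (u 1 - u 0) ∧ x 2 - x 0 = z * (u 2 - u 0) := by
  have e1 := form_eq_zero_of_null hs hn hu ![0, 1, 0]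
  have e2 := form_eq_zero_of_null hs hn hu ![0, 0, 1]
  rw [form_expand hs hn h1 u] at e1 e2
  obtain ⟨y, hy⟩ := hQ
  rw [form_expand hs hn h1 y] at hy
  rw [form_expand hs hn h1 x] at hx
  have hp := hn ![0, 1, 0]
  have hz := hn ![0, 0, 1]
  simp only [Matrix.cons_val_zero, Matrix.cons_val_one, Matrix.cons_val, sub_zero, mul_one,
    mul_zero, add_zero, zero_add] at e1 e2
  set p := Q ![0, 1, 0] ![0, 1, 0]
  set w := Q ![0, 1, 0] ![0, 0, 1]
  set z := Q ![0, 0, 1] ![0, 0, 1]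
  set α := u 1 - u 0
  set β := u 2 - u 0
  set a := x 1 - x 0
  set b := x 2 - x 0
  have hpos : 0 < α ^ 2 + β ^ 2 := by
    rcases not_and_or.1 hu' with h | h
    · positivity
    · positivity
  have hpz : p + z ≠ 0 := by
    intro h0
    have p0 : p = 0 := by linarith
    have z0 : z = 0 := by linarith
    rw [p0] at e1
    rw [z0] at e2
    have w0 : w = 0 := by
      rcases not_and_or.1 hu' with h | h
      · have : α * w = 0 := by linarith
        exact (mul_eq_zero.1 this).resolve_left h
      · have : β * w = 0 := by linarith
        exact (mul_eq_zero.1 this).resolve_left h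
    apply hy
    rw [p0, z0, w0]; ring
  -- In the coordinates of differences Q has rank one with kernel spanned by (α, β). Hence Q is its
  -- trace p + z times the squared component orthogonal to (α, β).
  have hsq : (p + z) * (β * a - α * b) ^ 2 = 0 := by
    linear_combination (α ^ 2 + β ^ 2) * hx + (-α * a ^ 2 - 2 * β * a * b + α * b ^ 2) * e1 +
      (β * a ^ 2 - 2 * α * a * b - β * b ^ 2) * e2
  have hab : β * a - α * b = 0 := by
    have := (mul_eq_zero.1 hsq).resolve_left hpz
    exact pow_eq_zero_iff two_ne_zero |>.1 this
  refine ⟨(α * a + β * b) / (α ^ 2 + β ^ 2), ?_, ?_⟩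
  · rw [div_mul_eq_mul_div, eq_div_iff hpos.ne']; linear_combination β * hab
  · rw [div_mul_eq_mul_div, eq_div_iff hpos.ne']; linear_combination -α * hab

/-- A geometric series of increments determines its first term by its sum. -/
lemma first_term_of_ray {a z : ℕ → ℝ} {α x : ℝ} (h0 : a 0 = 0) (ha : ∀ n, a (n + 1) = a n + α * z n)
    (hz : ∀ n, z (n + 1) = x * z n) (hl : Filter.Tendsto a Filter.atTop (nhds α)) (hα : α ≠ 0) :
    z 0 = 1 - x := by
  have hsum : ∀ n, a n * (1 - x) = α * z 0 - α * z n := by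
    intro n
    induction n with
    | zero => rw [h0]; ring
    | succ n ih => rw [ha, hz]; linear_combination ih
  have hzt : Filter.Tendsto (fun n => α * z n) Filter.atTop (nhds 0) := by
    have := ((Filter.tendsto_add_atTop_iff_nat 1).2 hl).sub hl
    rw [sub_self] at this
    exact this.congr fun n => by rw [ha]; ring
  have h1 : Filter.Tendsto (fun n => a n * (1 - x)) Filter.atTop (nhds (α * z 0 - 0)) := by
    simp only [hsum]
    exact tendsto_const_nhds.sub hzt
  have h2 := tendsto_nhds_unique h1 (hl.mul_const (1 - x))
  exact mul_left_cancel₀ hα (by linarith)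

lemma mem_stem_one {b : ℝ} : b ∈ stem 1 ↔ b = 0 ∨ b - rho ^ 2 = 0 := by
  rw [mem_stem_succ]; simp [stem]

lemma mem_stem_two {b : ℝ} : b ∈ stem 2 ↔
    (b = 0 ∨ b - rho ^ 2 = 0) ∨ b - rho ^ 3 = 0 ∨ b - rho ^ 3 - rho ^ 2 = 0 := by
  rw [mem_stem_succ, mem_stem_one, mem_stem_one]

lemma mem_stem_three {b : ℝ} : b ∈ stem 3 ↔
    ((b = 0 ∨ b - rho ^ 2 = 0) ∨ b - rho ^ 3 = 0 ∨ b - rho ^ 3 - rho ^ 2 = 0) ∨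
    (b - rho ^ 4 = 0 ∨ b - rho ^ 4 - rho ^ 2 = 0) ∨
      b - rho ^ 4 - rho ^ 3 = 0 ∨ b - rho ^ 4 - rho ^ 3 - rho ^ 2 = 0 := by
  rw [mem_stem_succ, mem_stem_two, mem_stem_two]

/-- No function can be harmonic for a symmetric eigenform and proportional to its boundary values
on every triangle. -/
lemma no_proportional_harmonic {r s : ℝ} (hr : 0 < r) (hs : 1 / 4 ≤ s)
    {u : Fin 3 → ℝ} (hu : ¬(u 1 - u 0 = 0 ∧ u 2 - u 0 = 0)) {g z : ℕ → ℝ → ℝ} (h0 : g 0 0 = u 0)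
    (hL : Filter.Tendsto (fun n => g n 0) Filter.atTop (nhds (u 1)))
    (hR : Filter.Tendsto (fun n => g n (1 - rho ^ n)) Filter.atTop (nhds (u 2)))
    (hzl : ∀ n, ∀ b ∈ stem n, g (n + 1) b = g n b + z n b * (u 1 - u 0))
    (hzr : ∀ n, ∀ b ∈ stem n, g (n + 1) (b + rho ^ (n + 2)) = g n b + z n b * (u 2 - u 0))
    (hH : ∀ N, ∀ b ∈ stem (N + 1),
        r * ((if b ∈ stem N then symForm s (tri g N b) (Pi.single 1 1) else 0) +
          (if b - rho ^ (N + 2) ∈ stem N then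
            symForm s (tri g N (b - rho ^ (N + 2))) (Pi.single 2 1) else 0)) +
          symForm s (tri g (N + 1) b) (Pi.single 0 1) = 0) : False := by
  set α := u 1 - u 0 with hα
  set β := u 2 - u 0 with hβ
  set B := s - 1 / 4 with hB
  have hB0 : 0 ≤ B := by linarith
  have f0 : ∀ n, ∀ b ∈ stem n, symForm s (tri g n b) (Pi.single 0 1) = -(α + β) / 2 * z n b := by
    intro n b hb
    simp only [symForm_apply, tri, hzl n b hb, hzr n b hb, Matrix.cons_val_zero,
      Matrix.cons_val_one, Matrix.cons_val, Pi.single_apply]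
    simp; ring
  have f1 : ∀ n, ∀ b ∈ stem n,
      symForm s (tri g n b) (Pi.single 1 1) = (α / 2 + B * (α - β)) * z n b := by
    intro n b hb
    simp only [symForm_apply, tri, hzl n b hb, hzr n b hb, Matrix.cons_val_zero,
      Matrix.cons_val_one, Matrix.cons_val, Pi.single_apply]
    simp [hB]; ring
  have f2 : ∀ n, ∀ b ∈ stem n,
      symForm s (tri g n b) (Pi.single 2 1) = (β / 2 + B * (β - α)) * z n b := by
    intro n b hb
    simp only [symForm_apply, tri, hzl n b hb, hzr n b hb, Matrix.cons_val_zero,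
      Matrix.cons_val_one, Matrix.cons_val, Pi.single_apply]
    simp [hB]; ring
  have hH' : ∀ N, ∀ b ∈ stem (N + 1),
      r * ((if b ∈ stem N then (α / 2 + B * (α - β)) * z N b else 0) +
        (if b - rho ^ (N + 2) ∈ stem N then (β / 2 + B * (β - α)) * z N (b - rho ^ (N + 2))
          else 0)) + -(α + β) / 2 * z (N + 1) b = 0 := by
    intro N b hb
    have := hH N b hb
    rw [f0 _ _ hb] at this
    convert this using 4
    · split_ifs with h
      · rw [f1 _ _ h]
      · rfl
    · split_ifs with h
      · rw [f2 _ _ h]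
      · rfl
  -- the two boundary rays
  have hleft : ∀ N, r * ((α / 2 + B * (α - β)) * z N 0) + -(α + β) / 2 * z (N + 1) 0 = 0 := by
    intro N
    have := hH' N 0 (zero_mem_stem _)
    rw [if_pos (zero_mem_stem N), if_neg (fun h => by
      linarith [stem_nonneg h, rho_pow_pos (N + 2)]), add_zero] at this
    exact this
  have hright : ∀ N, r * ((β / 2 + B * (β - α)) * z N (1 - rho ^ N)) +
      -(α + β) / 2 * z (N + 1) (1 - rho ^ (N + 1)) = 0 := by
    intro N
    have := hH' N _ (last_mem_stem (N + 1))
    have e : 1 - rho ^ (N + 1) - rho ^ (N + 2) = 1 - rho ^ N := by rw [rho_pow_add_two]; ring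
    rw [e, if_pos (last_mem_stem N), if_neg (fun h => by
      linarith [stem_le h, rho_pow_add_two N, rho_pow_pos (N + 2)]),
      zero_add] at this
    exact this
  have haL : ∀ N, g (N + 1) 0 - u 0 = (g N 0 - u 0) + α * z N 0 := by
    intro N; rw [hzl N 0 (zero_mem_stem N)]; ring
  have haR : ∀ N, g (N + 1) (1 - rho ^ (N + 1)) - u 0 =
      (g N (1 - rho ^ N) - u 0) + β * z N (1 - rho ^ N) := by
    intro N
    have e : 1 - rho ^ (N + 1) = 1 - rho ^ N + rho ^ (N + 2) := by rw [rho_pow_add_two]; ring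
    rw [e, hzr N _ (last_mem_stem N)]; ring
  have hL' := hL.sub_const (u 0)
  have hR' := hR.sub_const (u 0)
  have zeroL : (∀ N, z N 0 = 0) → α = 0 := by
    intro hz
    have : ∀ N, g N 0 - u 0 = 0 := by
      intro N
      induction N with
      | zero => rw [h0, sub_self]
      | succ N ih => rw [haL, ih, hz]; ring
    simp only [this] at hL'
    exact (tendsto_nhds_unique tendsto_const_nhds hL').symm
  have zeroR : (∀ N, z N (1 - rho ^ N) = 0) → β = 0 := by
    intro hz
    have : ∀ N, g N (1 - rho ^ N) - u 0 = 0 := by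
      intro N
      induction N with
      | zero => rw [pow_zero, sub_self, h0, sub_self]
      | succ N ih => rw [haR, ih, hz]; ring
    simp only [this] at hR'
    exact (tendsto_nhds_unique tendsto_const_nhds hR').symm
  -- Here the flow through the top corner of every triangle is zero, so harmonicity along the left
  -- ray forces z = 0 there, and no boundary value other than u 0 can be reached at q_1.
  by_cases hsum : α + β = 0
  · have hβα : β = -α := by linarith
    have hz : ∀ N, z N 0 = 0 := by
      intro N
      have := hleft N
      rw [hsum, hβα] at this
      by_contra hne
      have h1 : r * (1 / 2 + 2 * B) * z N 0 * α = 0 := by linarith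
      have h2 : α = 0 := (mul_eq_zero.1 h1).resolve_left (by positivity)
      exact hu ⟨h2, by rw [hβα, h2, neg_zero]⟩
    have hα0 := zeroL hz
    exact hu ⟨hα0, by rw [hβα, hα0, neg_zero]⟩
  -- The share of the flow through a triangle that leaves by its left lower corner; it is the same
  -- for all triangles, and 1 - p leaves by the right one. It need not lie in [0, 1].
  obtain ⟨p, hp⟩ : ∃ p, p = (α + 2 * B * (α - β)) / (α + β) := ⟨_, rfl⟩
  have hp' : p * (α + β) = α + 2 * B * (α - β) := by rw [hp]; field_simp
  -- the flow equations
  have hflow : ∀ N, ∀ b ∈ stem (N + 1), z (N + 1) b =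
      r * ((if b ∈ stem N then p * z N b else 0) +
        (if b - rho ^ (N + 2) ∈ stem N then (1 - p) * z N (b - rho ^ (N + 2)) else 0)) := by
    intro N b hb
    have := hH' N b hb
    refine mul_left_cancel₀ hsum ?_
    split_ifs at this ⊢
    · linear_combination -2 * this - r * (z N b - z N (b - rho ^ (N + 2))) * hp'
    · linear_combination -2 * this - r * z N b * hp'
    · linear_combination -2 * this + r * z N (b - rho ^ (N + 2)) * hp'
    · linear_combination -2 * this
  have hleft' : ∀ N, z (N + 1) 0 = r * p * z N 0 := by
    intro N
    refine mul_left_cancel₀ hsum ?_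
    linear_combination -2 * hleft N - r * z N 0 * hp'
  have hright' : ∀ N, z (N + 1) (1 - rho ^ (N + 1)) = r * (1 - p) * z N (1 - rho ^ N) := by
    intro N
    refine mul_left_cancel₀ hsum ?_
    linear_combination -2 * hright N + r * z N (1 - rho ^ N) * hp'
  have hc : z 0 0 ≠ 0 := by
    intro hz
    refine hu ⟨zeroL fun N => ?_, zeroR fun N => ?_⟩
    · induction N with
      | zero => exact hz
      | succ N ih => rw [hleft', ih, mul_zero]
    · induction N with
      | zero => rw [pow_zero, sub_self]; exact hz
      | succ N ih => rw [hright', ih, mul_zero]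
  -- Along the left ray the increments α z form a geometric series of ratio r p whose sum must be α.
  -- If α = 0 the ray gives no information, hence the case distinction below.
  have rayL : α ≠ 0 → z 0 0 = 1 - r * p := fun h =>
    first_term_of_ray (a := fun n => g n 0 - u 0) (z := fun n => z n 0) (by simp [h0]) haL hleft'
      hL' h
  have rayR : β ≠ 0 → z 0 0 = 1 - r * (1 - p) := fun h => by
    have := first_term_of_ray (a := fun n => g n (1 - rho ^ n) - u 0)
      (z := fun n => z n (1 - rho ^ n)) (by simp [h0]) haR hright' hR' h
    simpa using this
  -- explicit vertices
  have b1 := rho_gt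
  have b2 := rho_lt
  have q2 := rho_sq
  have q3 := rho_cube
  have q4 := rho_four
  have q5 := rho_five
  have q6 : rho ^ 6 = 5 - 8 * rho := by linear_combination rho * q5 + 5 * q2
  have m1 : rho ^ 2 ∈ stem 1 := by simpa using stem_right (zero_mem_stem 0)
  have m22 : rho ^ 2 ∈ stem 2 := stem_left m1
  have m23 : rho ^ 3 ∈ stem 2 := by simpa using stem_right (zero_mem_stem 1)
  have m32 : rho ^ 2 ∈ stem 3 := stem_left m22
  have m33 : rho ^ 3 ∈ stem 3 := stem_left m23
  have m42 : rho ^ 2 ∈ stem 4 := stem_left m32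
  have m43 : rho ^ 3 + rho ^ 5 ∈ stem 4 := stem_right m33
  have n1 : rho ^ 3 ∉ stem 1 := fun h => by
    rcases mem_stem_one.1 h with h | h <;> linarith
  have n1' : rho ^ 2 - rho ^ 3 ∉ stem 1 := fun h => by
    rcases mem_stem_one.1 h with h | h <;> linarith
  have n2 : rho ^ 3 - rho ^ 4 ∉ stem 2 := fun h => by
    rcases mem_stem_two.1 h with (h | h) | h | h <;> linarith
  have n3 : rho ^ 3 + rho ^ 5 ∉ stem 3 := fun h => by
    rcases mem_stem_three.1 h with ((h | h) | h | h) | (h | h) | h | h <;> linarith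
  have n3' : rho ^ 2 - rho ^ 5 ∉ stem 3 := fun h => by
    rcases mem_stem_three.1 h with ((h | h) | h | h) | (h | h) | h | h <;> linarith
  have c10 : z 1 0 = r * p * z 0 0 := hleft' 0
  have c12 : z 1 (rho ^ 2) = r * (1 - p) * z 0 0 := by
    have := hright' 0
    simp only [zero_add, pow_one, pow_zero, sub_self] at this
    rw [q2]; exact this
  have c23 : z 2 (rho ^ 3) = r * ((1 - p) * z 1 0) := by
    have := hflow 1 (rho ^ 3) m23
    rw [if_neg, if_pos, zero_add, show rho ^ 3 - rho ^ (1 + 2) = 0 by ring] at this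
    · exact this
    · rw [show rho ^ 3 - rho ^ (1 + 2) = 0 by ring]; exact zero_mem_stem 1
    · exact n1
  have c22 : z 2 (rho ^ 2) = r * (p * z 1 (rho ^ 2)) := by
    have := hflow 1 (rho ^ 2) m22
    rw [if_pos m1, if_neg, add_zero] at this
    · exact this
    · exact n1'
  have g1l : g 1 0 = g 0 0 + z 0 0 * α := hzl 0 0 (zero_mem_stem 0)
  have g1r : g 1 (rho ^ 2) = g 0 0 + z 0 0 * β := by
    simpa using hzr 0 0 (zero_mem_stem 0)
  have g23 : g 2 (rho ^ 3) = g 1 0 + z 1 0 * β := by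
    simpa using hzr 1 0 (zero_mem_stem 1)
  have g22 : g 2 (rho ^ 2) = g 1 (rho ^ 2) + z 1 (rho ^ 2) * α := hzl 1 _ m1
  have e34 : rho ^ 3 + rho ^ (2 + 2) = rho ^ 2 := by rw [q2, q3]; norm_num; rw [q4]; ring
  have g32 : g 3 (rho ^ 2) = g 2 (rho ^ 2) + z 2 (rho ^ 2) * α := hzl 2 _ m22
  have g32' : g 3 (rho ^ 2) = g 2 (rho ^ 3) + z 2 (rho ^ 3) * β := by
    rw [← hzr 2 _ m23, e34]
  -- The vertex (3, ρ²) is reached by right-left-left and by left-right-right, since ρ³ + ρ⁴ = ρ².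
  -- With α = 0 only right steps change g, and equality of the two values demands r p (1 + r (1 -
  -- p)) = 1, impossible because p = -2B ≤ 0. The case β = 0 is the mirror image.
  by_cases hα0 : α = 0
  · have hβ0 : β ≠ 0 := fun h => hu ⟨hα0, h⟩
    have hpB : p = -(2 * B) := by
      rw [hα0] at hp'
      exact mul_right_cancel₀ hβ0 (by linarith)
    rw [hα0] at g1l g22 g32
    have h1 : z 0 0 * β * (r * p * (1 + r * (1 - p)) - 1) = 0 := by
      rw [g32, g22, g1r, g23, g1l, c23, c10] at g32'
      linear_combination -g32'
    have h2 : r * p * (1 + r * (1 - p)) = 1 := by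
      have := (mul_eq_zero.1 h1).resolve_left (mul_ne_zero hc hβ0)
      linarith
    have h3 : r * p * (1 + r * (1 - p)) ≤ 0 := by
      rw [hpB]
      have : 0 ≤ r * (2 * B) * (1 + r * (1 + 2 * B)) := by positivity
      linarith
    linarith
  by_cases hβ0 : β = 0
  · have hpB : 1 - p = -(2 * B) := by
      rw [hβ0] at hp'
      refine mul_right_cancel₀ hα0 ?_
      linarith
    rw [hβ0] at g1r g23 g32'
    have h1 : z 0 0 * α * (r * (1 - p) * (1 + r * p) - 1) = 0 := by
      rw [g32, g22, g1r, g23, g1l, c22, c12] at g32'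
      linear_combination g32'
    have h2 : r * (1 - p) * (1 + r * p) = 1 := by
      have := (mul_eq_zero.1 h1).resolve_left (mul_ne_zero hc hα0)
      linarith
    have h3 : r * (1 - p) * (1 + r * p) ≤ 0 := by
      have hp1 : p = 1 + 2 * B := by linarith
      rw [hpB, hp1]
      have : 0 ≤ r * (2 * B) * (1 + r * (1 + 2 * B)) := by positivity
      linarith
    linarith
  -- Both rays now determine z 0 0, which gives p = 1/2 and then α = β. The first loop closes by
  -- symmetry, so a second one is needed.
  have hph : p = 1 / 2 := by
    have h1 := rayL hα0
    have h2 := rayR hβ0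
    have h3 : r * (2 * p - 1) = 0 := by linarith
    have := (mul_eq_zero.1 h3).resolve_left hr.ne'
    linarith
  have hαβ : β = α := by
    rw [hph] at hp'
    have h1 : (1 / 2 + 2 * B) * (β - α) = 0 := by linarith
    have := (mul_eq_zero.1 h1).resolve_left (by positivity)
    linarith
  have c33 : z 3 (rho ^ 3) = r * (p * z 2 (rho ^ 3)) := by
    have := hflow 2 (rho ^ 3) m33
    rw [if_pos m23, if_neg, add_zero] at this
    · exact this
    · exact n2
  have c32 : z 3 (rho ^ 2) = r * (p * z 2 (rho ^ 2) + (1 - p) * z 2 (rho ^ 3)) := by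
    have := hflow 2 (rho ^ 2) m32
    have e : rho ^ 2 - rho ^ (2 + 2) = rho ^ 3 := by linarith
    rw [e, if_pos m22, if_pos m23] at this
    exact this
  have c43 : z 4 (rho ^ 3 + rho ^ 5) = r * ((1 - p) * z 3 (rho ^ 3)) := by
    have := hflow 3 (rho ^ 3 + rho ^ 5) m43
    have e : rho ^ 3 + rho ^ 5 - rho ^ (3 + 2) = rho ^ 3 := by ring
    rw [e, if_pos m33, if_neg, zero_add] at this
    · exact this
    · exact n3
  have c42 : z 4 (rho ^ 2) = r * (p * z 3 (rho ^ 2)) := by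
    have := hflow 3 (rho ^ 2) m42
    rw [if_pos m32, if_neg, add_zero] at this
    · exact this
    · exact n3'
  have g33 : g 3 (rho ^ 3) = g 2 (rho ^ 3) + z 2 (rho ^ 3) * α := hzl 2 _ m23
  have g43 : g 4 (rho ^ 3 + rho ^ 5) = g 3 (rho ^ 3) + z 3 (rho ^ 3) * β := hzr 3 _ m33
  have g42 : g 4 (rho ^ 2) = g 3 (rho ^ 2) + z 3 (rho ^ 2) * α := hzl 3 _ m32
  have g52 : g 5 (rho ^ 2) = g 4 (rho ^ 2) + z 4 (rho ^ 2) * α := hzl 4 _ m42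
  have e356 : rho ^ 3 + rho ^ 5 + rho ^ (4 + 2) = rho ^ 2 := by
    norm_num; linarith
  have g52' : g 5 (rho ^ 2) = g 4 (rho ^ 3 + rho ^ 5) + z 4 (rho ^ 3 + rho ^ 5) * β := by
    rw [← hzr 4 _ m43, e356]
  -- The second loop ends at (5, ρ²), by ρ³ + ρ⁵ + ρ⁶ = ρ². One path passes through (3, ρ²), which
  -- is fed by two parents, the other through (3, ρ³), which is fed by one; the larger flow on the
  -- first path makes the two values differ by this amount.
  have hfin : z 0 0 * α * (r ^ 3 / 8 + r ^ 4 / 16) = 0 := by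
    rw [g52, g42, g43, g33, g32, g22, g23, g1l, g1r, c42, c43, c33, c32, c22, c23, c12, c10, hph,
      hαβ] at g52'
    linear_combination g52'
  have := mul_ne_zero (mul_ne_zero hc hα0) (show r ^ 3 / 8 + r ^ 4 / 16 ≠ 0 by positivity)
  exact this hfin

/-- Any eigenform with the same eigenvalue is a multiple of a given symmetric eigenform. -/
lemma eigenform_unique {r c s : ℝ} (hr : rho < r) (hr1 : r < 1) (hs : 1 / 4 ≤ s) {D' : Form}
    (hD' : IsEnergy D') (h : ∀ u, trc r (symForm s) u = c * symForm s u u)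
    (h' : ∀ u, trc r D' u = c * D' u u) : ∃ t : ℝ, 0 < t ∧ D' = t • symForm s := by
  have hD : IsEnergy (symForm s) := symForm_isEnergy (by linarith)
  obtain ⟨M, hM, hle, u, hu, heq⟩ := exists_best_bound hD hD'
  -- Q is positive semidefinite with the nonconstant null vector u. If it vanishes the forms are
  -- proportional; otherwise its null vectors are the affine copies of u.
  let Q : Form := M • D' - symForm s
  have hQ : ∀ x y, Q x y = M * D' x y - symForm s x y := fun x y => rfl
  have hQs : ∀ x y, Q x y = Q y x := fun x y => by rw [hQ, hQ, hD.symm, hD'.symm]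
  have hQn : ∀ x, 0 ≤ Q x x := fun x => by rw [hQ]; linarith [hle x]
  have hQ1 : Q (fun _ => 1) (fun _ => 1) = 0 := by
    rw [hQ, hD.const_null, hD'.const_null]; ring
  by_cases hz : ∀ x, Q x x = 0
  · refine ⟨M⁻¹, inv_pos.2 hM, ?_⟩
    refine LinearMap.ext fun x => LinearMap.ext fun y => ?_
    have h1 := form_eq_zero_of_null hQs hQn (hz x) y
    rw [hQ] at h1
    change D' x y = M⁻¹ * symForm s x y
    field_simp
    linarith
  · push Not at hz
    exfalso
    obtain ⟨g, g0, gL, gR, gE, gH⟩ := exists_common_harmonic hr hr1 hD hD' hM hle heq h h'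
    have hu' : ¬(u 1 - u 0 = 0 ∧ u 2 - u 0 = 0) := by
      rintro ⟨h1, h2⟩
      refine hu ⟨u 0, fun i => ?_⟩
      fin_cases i
      · rfl
      · exact sub_eq_zero.1 h1
      · exact sub_eq_zero.1 h2
    have hQu : Q u u = 0 := by rw [hQ, heq]; ring
    have hex : ∀ n b, ∃ z, b ∈ stem n → g (n + 1) b = g n b + z * (u 1 - u 0) ∧
        g (n + 1) (b + rho ^ (n + 2)) = g n b + z * (u 2 - u 0) := by
      intro n b
      by_cases hb : b ∈ stem n
      · have hx : Q (tri g n b) (tri g n b) = 0 := by rw [hQ, gE n b hb]; ring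
        obtain ⟨z, h1, h2⟩ := exists_coeff_of_null hQs hQn hQ1 hQu hu' hz hx
        simp only [tri, Matrix.cons_val_zero, Matrix.cons_val_one, Matrix.cons_val] at h1 h2
        exact ⟨z, fun _ => ⟨by linarith, by linarith⟩⟩
      · exact ⟨0, fun h => absurd h hb⟩
    choose z hz using hex
    exact no_proportional_harmonic (rho_pos.trans hr) hs hu' g0 gL gR
      (fun n b hb => (hz n b hb).1) (fun n b hb => (hz n b hb).2) gH

end GoldenGasket

/-! ### The eigenvalue as a function of the parameter. -/

namespace GoldenGasket

/-- The parameter of a symmetric eigenform. -/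
def eigenParam (r : ℝ) : ℝ :=
  if h : r ∈ Ioo rho 1 then (exists_eigenform h.1 h.2).choose else 1

/-- The eigenvalue of the renormalization map. -/
def eigenval (r : ℝ) : ℝ := trcA r (eigenParam r)

section
variable {r : ℝ}

lemma eigenParam_spec (hr : r ∈ Ioo rho 1) : 1 / 4 ≤ eigenParam r ∧
    ∀ u, trc r (symForm (eigenParam r)) u = eigenval r * symForm (eigenParam r) u u := by
  have := (exists_eigenform hr.1 hr.2).choose_spec
  simpa only [eigenval, eigenParam, dif_pos hr] using this

lemma eigenform_isEnergy (hr : r ∈ Ioo rho 1) : IsEnergy (symForm (eigenParam r)) :=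
  symForm_isEnergy (by linarith [(eigenParam_spec hr).1])

lemma eigenval_pos (hr : r ∈ Ioo rho 1) : 0 < eigenval r := by
  have := trcA_lower hr.1 hr.2 (eigenParam_spec hr).1
  have h1 := hr.2
  unfold eigenval
  linarith

lemma eigenval_le_two_div (hr : r ∈ Ioo rho 1) : eigenval r ≤ 2 / (2 + r) :=
  trcA_upper hr.1 (by linarith [(eigenParam_spec hr).1])

lemma eigenval_lt_one (hr : r ∈ Ioo rho 1) : eigenval r < 1 := by
  have h0 := rho_pos.trans hr.1
  refine (eigenval_le_two_div hr).trans_lt ?_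
  rw [div_lt_one (by linarith)]
  linarith

/-- Every eigenvalue is `eigenval r`, and every eigenform is a multiple of the symmetric one. -/
lemma eigenpair_unique (hr : r ∈ Ioo rho 1) {W : Set (List (Fin 3))} (hW : IsIndexSet W) {c : ℝ} (hc : 0 < c)
    {D' : Form} (hD' : D' ∈ resistanceForms) (h : SolvesRenormalization W r c D') :
    c = eigenval r ∧ ∃ t : ℝ, 0 < t ∧ D' = t • symForm (eigenParam r) := by
  have hE' := isEnergy_of_mem hD'
  have hE := eigenform_isEnergy hr
  have hs := (eigenParam_spec hr).2
  rw [solves_iff hW hr.1 hE' hc] at h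
  obtain rfl : c = eigenval r := le_antisymm
    (eigenvalue_le hr.1 hE' hE h fun u => (hs u).le)
    (le_eigenvalue hr.1 hE' hE h fun u => (hs u).ge)
  exact ⟨rfl, eigenform_unique hr.1 hr.2 (eigenParam_spec hr).1 hE' hs h⟩

lemma eigenform_solves (hr : r ∈ Ioo rho 1) {W : Set (List (Fin 3))} (hW : IsIndexSet W) :
    SolvesRenormalization W r (eigenval r) (symForm (eigenParam r)) :=
  (solves_iff hW hr.1 (eigenform_isEnergy hr) (eigenval_pos hr)).2 (eigenParam_spec hr).2

lemma eigenval_le_of (hr : r ∈ Ioo rho 1) {D : Form} (hD : IsEnergy D) {c : ℝ} (h : ∀ u, trc r D u ≤ c * D u u) :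
    eigenval r ≤ c :=
  eigenvalue_le hr.1 (eigenform_isEnergy hr) hD (eigenParam_spec hr).2 h

lemma le_eigenval_of (hr : r ∈ Ioo rho 1) {D : Form} (hD : IsEnergy D) {c : ℝ} (h : ∀ u, c * D u u ≤ trc r D u) :
    c ≤ eigenval r :=
  le_eigenvalue hr.1 (eigenform_isEnergy hr) hD (eigenParam_spec hr).2 h

end

lemma eigenval_strictAntiOn : StrictAntiOn eigenval (Ioo rho 1) := by
  intro r hr r' hr' hlt
  obtain ⟨c', h1, h2⟩ := exists_trc_lt hr.1 hlt hr'.2 (eigenform_isEnergy hr) (eigenval_pos hr)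
    (eigenval_lt_one hr) (eigenParam_spec hr).2
  exact (eigenval_le_of hr' (eigenform_isEnergy hr) h2).trans_lt h1

/-- No continuity of the eigenform is needed: the eigenform at r₀ serves as comparison form for all
nearby r, and its traces at r and r₀ agree up to a factor 1 + ε/2. -/
lemma eigenval_continuousOn : ContinuousOn eigenval (Ioo rho 1) := by
  intro r₀ h₀
  refine ContinuousAt.continuousWithinAt (Metric.tendsto_nhds.2 fun ε hε => ?_)
  have hE := eigenform_isEnergy h₀
  have hs := (eigenParam_spec h₀).2
  have hl1 := eigenval_lt_one h₀
  have hl0 := eigenval_pos h₀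
  have hδ : 0 < ε / 2 := by linarith
  filter_upwards [trc_eventually_near h₀.1 h₀.2 hE hδ, isOpen_Ioo.mem_nhds h₀] with r hn hr
  have h1 : eigenval r ≤ (1 + ε / 2) * eigenval r₀ :=
    eigenval_le_of hr hE fun u => by
      have := (hn u).1
      rw [hs u] at this
      linarith
  have h2 : (1 + ε / 2)⁻¹ * eigenval r₀ ≤ eigenval r :=
    le_eigenval_of hr hE fun u => by
      have := (hn u).2
      rw [hs u] at this
      rw [mul_assoc, inv_mul_le_iff₀ (by linarith)]
      exact this
  rw [inv_mul_le_iff₀ (by linarith)] at h2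
  have h3 := eigenval_lt_one hr
  rw [Real.dist_eq, abs_lt]
  constructor <;> nlinarith

lemma exists_eigenval_eq_sq : ∃ r ∈ Ioo rho 1, eigenval r = r ^ 2 := by
  have hsub : Icc (31 / 50 : ℝ) (9 / 10) ⊆ Ioo rho 1 := fun x hx =>
    ⟨by linarith [rho_lt, hx.1], by linarith [hx.2]⟩
  have hcont : ContinuousOn (fun r => eigenval r - r ^ 2) (Icc (31 / 50 : ℝ) (9 / 10)) :=
    (eigenval_continuousOn.mono hsub).sub (by fun_prop)
  have ha : (31 / 50 : ℝ) ∈ Ioo rho 1 := hsub ⟨le_rfl, by norm_num⟩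
  have hb : (9 / 10 : ℝ) ∈ Ioo rho 1 := hsub ⟨by norm_num, le_rfl⟩
  have h1 : (2 : ℝ) / 5 ≤ eigenval (31 / 50) := trcA_gt (eigenParam_spec ha).1
  -- At 9/10 the bound is 2/2.9 < 0.81, while at 31/50 the lower bound 2/5 exceeds 0.3844, so λ(r) -
  -- r² changes sign between them.
  have h2 := eigenval_le_two_div hb
  obtain ⟨r, hr, h⟩ := intermediate_value_Icc' (by norm_num) hcont
    (show (0 : ℝ) ∈ Icc _ _ by constructor <;> norm_num at * <;> linarith)
  exact ⟨r, hsub hr, by linarith⟩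

lemma eq_of_eigenval_eq_sq {r r' : ℝ} (hr : r ∈ Ioo rho 1) (hr' : r' ∈ Ioo rho 1)
    (h : eigenval r = r ^ 2) (h' : eigenval r' = r' ^ 2) : r = r' := by
  have h0 := rho_pos.trans hr.1
  have h0' := rho_pos.trans hr'.1
  rcases lt_trichotomy r r' with hlt | heq | hlt
  · have := eigenval_strictAntiOn hr hr' hlt
    nlinarith
  · exact heq
  · have := eigenval_strictAntiOn hr' hr hlt
    nlinarith

end GoldenGasket

end

theorem theorem5p1 (W : Set (List (Fin 3))) (hW : IsIndexSet W) :
    -- part (a)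
    (∃ lam : ℝ → ℝ,
      (∀ r ∈ Set.Ioo rho 1, 0 < lam r ∧
        ∃ D ∈ symmetricForms, SolvesRenormalization W r (lam r) D ∧
          ∀ c : ℝ, 0 < c → ∀ D' ∈ resistanceForms, SolvesRenormalization W r c D' →
            c = lam r ∧ ∃ t : ℝ, 0 < t ∧ D' = t • D) ∧
      ContinuousOn lam (Set.Ioo rho 1) ∧
      StrictAntiOn lam (Set.Ioo rho 1)) ∧
    -- part (b)
    (∃ r ∈ Set.Ioo rho 1,
      (∃ D ∈ resistanceForms, SolvesRenormalization W r (r ^ 2) D ∧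
        ∀ D' ∈ resistanceForms, SolvesRenormalization W r (r ^ 2) D' →
          ∃ t : ℝ, 0 < t ∧ D' = t • D) ∧
      ∀ r' ∈ Set.Ioo rho 1,
        (∃ D' ∈ resistanceForms, SolvesRenormalization W r' (r' ^ 2) D') → r' = r) := by
  refine ⟨⟨eigenval, fun r hr => ⟨eigenval_pos hr, symForm (eigenParam r),
    symForm_mem (eigenParam_spec hr).1, eigenform_solves hr hW,
    fun c hc D' hD' h => eigenpair_unique hr hW hc hD' h⟩, eigenval_continuousOn,
    eigenval_strictAntiOn⟩, ?_⟩
  obtain ⟨r, hr, h⟩ := exists_eigenval_eq_sq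
  refine ⟨r, hr, ⟨symForm (eigenParam r), (symForm_mem (eigenParam_spec hr).1).1,
    h ▸ eigenform_solves hr hW, fun D' hD' h' =>
      (eigenpair_unique hr hW (by rw [← h]; exact eigenval_pos hr) hD' h').2⟩, ?_⟩
  rintro r' hr' ⟨D', hD', h'⟩
  have h0 : 0 < r' ^ 2 := pow_pos (rho_pos.trans hr'.1) 2
  exact eq_of_eigenval_eq_sq hr' hr (eigenpair_unique hr' hW h0 hD' h').1.symm h
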